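/- Lattices are full-rank discrete subgroups $L$ of a Euclidean space, with dual $L^\sharp=\{x : x\cdot L\subset\mathbb{Z}\}$. A lattice is even if $x\cdot x\in 2\mathbb{Z}$ for all $x \in L$; a root of $L$ is an $\alpha\in L$ with $\alpha\cdot\alpha=2$. For $L$ even, $\mathrm{res}\,L$ denotes the group $L^\sharp/L$ with the quadratic form $x\mapsto \frac{x\cdot x}{2} \bmod \mathbb{Z}$. Let $(g,p,m,k)$ be either $(8,5,4,2)$ or $(6,3,5,3)$, let $\rho$ be a Weyl vector (half-sum of the positive roots for some positive system) of the root lattice $\mathrm{A}_{p-1}^k$ (orthogonal direct sum of $k$ copies of $\mathrm{A}_{p-1}$), and let $$\mathrm{Q}_g=\{x\in \mathrm{A}_{p-1}^k : x\cdot\rho\equiv 0 \bmod p\}.$$ (i) $\mathrm{Q}_g$ is an even lattice of rank $g$ without roots satisfying $\mathrm{Q}_g^\sharp/\mathrm{Q}_g\simeq(\mathbb{Z}/p\mathbb{Z})^m$, and every even lattice of rank $g$ without roots and with discriminant group isomorphic to $(\mathbb{Z}/p\mathbb{Z})^m$ is isometric to $\mathrm{Q}_g$. (ii) View $\mathrm{res}\,\mathrm{Q}_g$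 as a quadratic space over $\mathbb{Z}/p\mathbb{Z}$. It contains totally isotropic flags, that is, pairs $(D,P)$ with $P$ a totally isotropic plane and $D\subset P$ a line. The orthogonal group $\mathrm{O}(\mathrm{Q}_g)$ acts transitively on the set of totally isotropic planes of $\mathrm{res}\,\mathrm{Q}_g$, on the set of its totally isotropic lines, and on the set of its totally isotropic flags. (iii) The inverse image in $\mathrm{Q}_g^\sharp$ of any totally isotropic plane of $\mathrm{res}\,\mathrm{Q}_g$ is isometric to the root lattice $\mathrm{E}_g$, and the inverse image of any totally isotropic line is isometric to $\mathrm{A}_{p-1}^k$, that is, to $\mathrm{A}_4\oplus\mathrm{A}_4$ for $g=8$ and to $\mathrm{A}_2\oplus\mathrm{A}_2\oplus\mathrm{A}_2$ for $g=6$. -/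

import Mathlib

open scoped InnerProductSpace

noncomputable section

section Lattices

variable {E : Type*} [NormedAddCommGroup E] [InnerProductSpace ℝ E]

/-- An even lattice in the Euclidean space `E`: a discrete subgroup spanning `E`
over `ℝ`, all of whose vectors have even integral norm `x · x`.
(By polarization such a lattice is automatically integral.) -/
structure IsEvenLattice (L : Submodule ℤ E) : Prop where
  discrete : DiscreteTopology L
  span_eq_top : Submodule.span ℝ (L : Set E) = ⊤
  even : ∀ x ∈ L, ∃ n : ℤ, ⟪x, x⟫_ℝ = 2 * n

/-- The set `R(L)` of roots of `L`. -/
def latticeRoots (L : Submodule ℤ E) : Set E := {α | α ∈ L ∧ ⟪α, α⟫_ℝ = 2}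

/-- The dual lattice `L^♯ = {x | x · L ⊆ ℤ}`. -/
def dualLattice (L : Submodule ℤ E) : Submodule ℤ E :=
  LinearMap.BilinForm.dualSubmodule (innerₗ E) L

theorem mem_dualLattice {L : Submodule ℤ E} {x : E} :
    x ∈ dualLattice L ↔ ∀ y ∈ L, ∃ n : ℤ, ⟪x, y⟫_ℝ = n := by
  simp only [dualLattice, LinearMap.BilinForm.mem_dualSubmodule, Submodule.mem_one,
    innerₗ_apply_apply, algebraMap_int_eq, eq_intCast, eq_comm]

/-- The underlying group `L^♯ / L` of the residue (discriminant group) of `L`. -/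
abbrev Res (L : Submodule ℤ E) : Type _ :=
  dualLattice L ⧸ L.submoduleOf (dualLattice L)

/-- The map `x ↦ x · x / 2 mod ℤ` on `L^♯`. -/
def dualQ (L : Submodule ℤ E) (x : dualLattice L) : AddCircle (1 : ℝ) :=
  ((⟪(x : E), (x : E)⟫_ℝ / 2 : ℝ) : AddCircle (1 : ℝ))

theorem addCircle_coe_eq_of_sub_int {a b : ℝ} (n : ℤ) (h : a - b = n) :
    (a : AddCircle (1 : ℝ)) = b := by
  rw [← sub_eq_zero, ← AddCircle.coe_sub, AddCircle.coe_eq_zero_iff]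
  exact ⟨n, by simp [h]⟩

theorem dualQ_congr {L : Submodule ℤ E} (hL : IsEvenLattice L) (x y : dualLattice L)
    (h : x - y ∈ L.submoduleOf (dualLattice L)) : dualQ L x = dualQ L y := by
  have hz : (x : E) - y ∈ L := h
  obtain ⟨n, hn⟩ := hL.even _ hz
  obtain ⟨m, hm⟩ := mem_dualLattice.1 y.2 _ hz
  refine addCircle_coe_eq_of_sub_int (n + m) ?_
  have hx : (x : E) = ((x : E) - y) + y := by abel
  rw [hx, inner_add_left, inner_add_right, inner_add_right, hn, hm, real_inner_comm, hm]
  push_cast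
  ring

theorem polar_dualQ (L : Submodule ℤ E) (x y : dualLattice L) :
    dualQ L (x + y) - dualQ L x - dualQ L y
      = ((⟪(x : E), (y : E)⟫_ℝ : ℝ) : AddCircle (1 : ℝ)) := by
  simp only [dualQ, ← AddCircle.coe_sub, Submodule.coe_add]
  congr 1
  rw [inner_add_left, inner_add_right, inner_add_right, real_inner_comm (x : E) (y : E)]
  ring

/-- The linking quadratic form of `res L`: the quadratic form on `L^♯ / L` induced by
`x ↦ x · x / 2 mod ℤ` (its values lie in `ℚ / ℤ ⊆ ℝ / ℤ`). -/
def resForm {L : Submodule ℤ E} (hL : IsEvenLattice L) :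
    QuadraticMap ℤ (Res L) (AddCircle (1 : ℝ)) :=
  QuadraticMap.ofPolar
    (fun x => Quotient.liftOn' x (dualQ L) fun a b h =>
      dualQ_congr hL a b ((Submodule.quotientRel_def _).1 h))
    (by
      intro a x
      induction x using Submodule.Quotient.induction_on with
      | _ x =>
        change dualQ L (a • x) = (a * a) • dualQ L x
        rw [dualQ, dualQ, ← AddCircle.coe_zsmul]
        congr 1
        rw [Submodule.coe_smul, ← Int.cast_smul_eq_zsmul ℝ, inner_smul_left, inner_smul_right,
          zsmul_eq_mul]
        simp
        ring)
    (by
      intro x x' y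
      induction x using Submodule.Quotient.induction_on with
      | _ x =>
      induction x' using Submodule.Quotient.induction_on with
      | _ x' =>
      induction y using Submodule.Quotient.induction_on with
      | _ y =>
        change dualQ L (x + x' + y) - dualQ L (x + x') - dualQ L y
          = (dualQ L (x + y) - dualQ L x - dualQ L y)
            + (dualQ L (x' + y) - dualQ L x' - dualQ L y)
        simp only [polar_dualQ, ← AddCircle.coe_add, Submodule.coe_add, inner_add_left])
    (by
      intro a x y
      induction x using Submodule.Quotient.induction_on with
      | _ x =>
      induction y using Submodule.Quotient.induction_on with
      | _ y =>
        change dualQ L (a • x + y) - dualQ L (a • x) - dualQ L y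
          = a • (dualQ L (x + y) - dualQ L x - dualQ L y)
        rw [polar_dualQ, polar_dualQ, ← AddCircle.coe_zsmul, Submodule.coe_smul,
          ← Int.cast_smul_eq_zsmul ℝ, inner_smul_left, zsmul_eq_mul]
        simp)

/-- `D` is a totally isotropic subspace of dimension `i` over `ℤ/p` of `res L`. -/
def IsTotIsotropic {L : Submodule ℤ E} (hL : IsEvenLattice L) (p i : ℕ)
    (D : Submodule ℤ (Res L)) : Prop :=
  Nonempty (D ≃+ (Fin i → ZMod p)) ∧ ∀ x ∈ D, resForm hL x = 0

/-- A totally isotropic flag: a line contained in a totally isotropic plane. -/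
def IsIsotropicFlag {L : Submodule ℤ E} (hL : IsEvenLattice L) (p : ℕ)
    (D P : Submodule ℤ (Res L)) : Prop :=
  IsTotIsotropic hL p 1 D ∧ IsTotIsotropic hL p 2 P ∧ D ≤ P

/-- The inverse image in `L^♯` of a subgroup of `res L`. -/
def resPreimage (L : Submodule ℤ E) (D : Submodule ℤ (Res L)) : Submodule ℤ E :=
  (D.comap (L.submoduleOf (dualLattice L)).mkQ).map (dualLattice L).subtype

/-- The image of a subgroup under a linear isometry. -/
def mapLattice {F : Type*} [NormedAddCommGroup F] [InnerProductSpace ℝ F]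
    (φ : E ≃ₗᵢ[ℝ] F) (L : Submodule ℤ E) : Submodule ℤ F :=
  L.map (φ.toLinearEquiv.toLinearMap.restrictScalars ℤ)

/-- Isometric lattices. -/
def LatticeIsometric {F : Type*} [NormedAddCommGroup F] [InnerProductSpace ℝ F]
    (L : Submodule ℤ E) (M : Submodule ℤ F) : Prop :=
  ∃ φ : E ≃ₗᵢ[ℝ] F, mapLattice φ L = M

theorem mem_mapLattice {F : Type*} [NormedAddCommGroup F] [InnerProductSpace ℝ F]
    (φ : E ≃ₗᵢ[ℝ] F) (L : Submodule ℤ E) (y : F) :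
    y ∈ mapLattice φ L ↔ ∃ x ∈ L, φ x = y := Iff.rfl

/-- The orthogonal group `O(L)`. -/
def latticeO (L : Submodule ℤ E) : Subgroup (E ≃ₗᵢ[ℝ] E) where
  carrier := {γ | mapLattice γ L = L}
  one_mem' := by
    change mapLattice 1 L = L
    ext y
    simp [mem_mapLattice]
  mul_mem' := by
    intro a b ha hb
    change mapLattice (a * b) L = L
    have ha' : mapLattice a L = L := ha
    have hb' : mapLattice b L = L := hb
    conv_rhs => rw [← ha', ← hb']
    ext y
    simp [mem_mapLattice]
  inv_mem' := by
    intro a ha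
    change mapLattice a⁻¹ L = L
    have ha' : mapLattice a L = L := ha
    conv_lhs => rw [← ha']
    ext y
    constructor
    · rintro ⟨_, ⟨x, hx, rfl⟩, rfl⟩
      have : a⁻¹ (a x) = x := a.symm_apply_apply x
      change a⁻¹ (a x) ∈ L
      rwa [this]
    · intro hy
      exact ⟨a y, ⟨y, hy, rfl⟩, a.symm_apply_apply y⟩

theorem latticeO_apply_mem {L : Submodule ℤ E} (γ : latticeO L) {x : E} (hx : x ∈ L) :
    (γ : E ≃ₗᵢ[ℝ] E) x ∈ L := by
  have h : mapLattice (γ : E ≃ₗᵢ[ℝ] E) L = L := γ.2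
  exact h.le ⟨x, hx, rfl⟩

theorem latticeO_apply_mem_dual {L : Submodule ℤ E} (γ : latticeO L) {x : E}
    (hx : x ∈ dualLattice L) : (γ : E ≃ₗᵢ[ℝ] E) x ∈ dualLattice L := by
  rw [mem_dualLattice] at hx ⊢
  intro y hy
  have h : mapLattice (γ : E ≃ₗᵢ[ℝ] E) L = L := γ.2
  rw [← h] at hy
  obtain ⟨z, hz, rfl⟩ := hy
  obtain ⟨n, hn⟩ := hx z hz
  exact ⟨n, by rw [← hn]; exact LinearIsometryEquiv.inner_map_map _ _ _⟩

/-- The action of an element of `O(L)` on `L^♯`. -/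
def dualMap {L : Submodule ℤ E} (γ : latticeO L) : dualLattice L →ₗ[ℤ] dualLattice L :=
  ((γ : E ≃ₗᵢ[ℝ] E).toLinearEquiv.toLinearMap.restrictScalars ℤ).restrict
    fun _ hx => latticeO_apply_mem_dual γ hx

/-- The action of an element of `O(L)` on `res L`. -/
def resMap {L : Submodule ℤ E} (γ : latticeO L) : Res L →ₗ[ℤ] Res L :=
  Submodule.mapQ _ _ (dualMap γ) fun _ hx => latticeO_apply_mem γ hx

/-- `L` is an even lattice of rank `g` without roots whose discriminant group is
isomorphic to `(ℤ/p)^m`. -/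
def IsEvenRootless (g p m : ℕ) (L : Submodule ℤ E) : Prop :=
  IsEvenLattice L ∧ Module.finrank ℝ E = g ∧ latticeRoots L = ∅ ∧
    Nonempty (Res L ≃+ (Fin m → ZMod p))

/-- `ρ` is a Weyl vector of the root system `R(L)`: the half-sum of the positive roots for
the positive system `{α ∈ R(L) | 0 < α · v}` defined by some regular vector `v`. -/
def IsWeylVector (L : Submodule ℤ E) (ρ : E) : Prop :=
  ∃ v : E, (∀ α ∈ latticeRoots L, ⟪α, v⟫_ℝ ≠ 0) ∧
    ρ = (1 / 2 : ℝ) • ∑ᶠ α ∈ {α | α ∈ latticeRoots L ∧ 0 < ⟪α, v⟫_ℝ}, α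

/-- The sublattice `{x ∈ L | x · ρ ≡ 0 mod p}`. -/
def weylSublattice (p : ℕ) (L : Submodule ℤ E) (ρ : E) : Submodule ℤ E where
  carrier := {x | x ∈ L ∧ ∃ n : ℤ, ⟪x, ρ⟫_ℝ = p * n}
  zero_mem' := ⟨L.zero_mem, 0, by simp⟩
  add_mem' := by
    rintro x y ⟨hx, a, ha⟩ ⟨hy, b, hb⟩
    exact ⟨L.add_mem hx hy, a + b, by rw [inner_add_left, ha, hb]; push_cast; ring⟩
  smul_mem' := by
    rintro c x ⟨hx, a, ha⟩
    refine ⟨L.smul_mem c hx, c * a, ?_⟩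
    rw [← Int.cast_smul_eq_zsmul ℝ, inner_smul_left, ha]
    simp
    ring

end Lattices

/-- The Euclidean space spanned by `k` orthogonal copies of the root system `A_{p-1}`. -/
def spaceA (k p : ℕ) : Submodule ℝ (EuclideanSpace ℝ (Fin k × Fin p)) where
  carrier := {x | ∀ i, ∑ j, x (i, j) = 0}
  zero_mem' := by simp
  add_mem' := by
    intro x y hx hy i
    simp [Finset.sum_add_distrib, hx i, hy i]
  smul_mem' := by
    intro c x hx i
    simp [← Finset.mul_sum, hx i]

/-- The root lattice `A_{p-1}^k = A_{p-1} ⊕ ⋯ ⊕ A_{p-1}` (`k` orthogonal summands), where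
`A_{p-1}` is the lattice of vectors of `ℤ^p` with coordinates of sum zero. -/
def latticeA (k p : ℕ) : Submodule ℤ (spaceA k p) where
  carrier := {x | ∀ a, ∃ n : ℤ, (x : EuclideanSpace ℝ (Fin k × Fin p)) a = n}
  zero_mem' := fun _ => ⟨0, by simp⟩
  add_mem' := by
    intro x y hx hy a
    obtain ⟨m, hm⟩ := hx a
    obtain ⟨n, hn⟩ := hy a
    exact ⟨m + n, by simp [hm, hn]⟩
  smul_mem' := by
    intro c x hx a
    obtain ⟨n, hn⟩ := hx a
    exact ⟨c * n, by simp [hn]⟩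

/-- The root lattice `E_8`: the vectors of `ℝ^8` whose coordinates are all in `ℤ` or
all in `ℤ + 1/2`, with even sum. -/
def latticeE8 : Submodule ℤ (EuclideanSpace ℝ (Fin 8)) where
  carrier := {x | ((∀ i, ∃ n : ℤ, x i = n) ∨ (∀ i, ∃ n : ℤ, x i = n + 1 / 2)) ∧
    ∃ n : ℤ, ∑ i, x i = 2 * n}
  zero_mem' := ⟨Or.inl fun _ => ⟨0, by simp⟩, 0, by simp⟩
  add_mem' := by
    rintro x y ⟨hx, a, ha⟩ ⟨hy, b, hb⟩
    refine ⟨?_, a + b, ?_⟩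
    · rcases hx with hx | hx <;> rcases hy with hy | hy
      · refine Or.inl fun i => ?_
        obtain ⟨m, hm⟩ := hx i
        obtain ⟨n, hn⟩ := hy i
        exact ⟨m + n, by simp [hm, hn]⟩
      · refine Or.inr fun i => ?_
        obtain ⟨m, hm⟩ := hx i
        obtain ⟨n, hn⟩ := hy i
        exact ⟨m + n, by simp [hm, hn]; ring⟩
      · refine Or.inr fun i => ?_
        obtain ⟨m, hm⟩ := hx i
        obtain ⟨n, hn⟩ := hy i
        exact ⟨m + n, by simp [hm, hn]; ring⟩
      · refine Or.inl fun i => ?_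
        obtain ⟨m, hm⟩ := hx i
        obtain ⟨n, hn⟩ := hy i
        exact ⟨m + n + 1, by simp [hm, hn]; ring⟩
    · simp only [PiLp.add_apply, Finset.sum_add_distrib, ha, hb]
      push_cast
      ring
  smul_mem' := by
    rintro c x ⟨hx, a, ha⟩
    refine ⟨?_, c * a, ?_⟩
    · rcases hx with hx | hx
      · refine Or.inl fun i => ?_
        obtain ⟨n, hn⟩ := hx i
        exact ⟨c * n, by simp [hn]⟩
      · rcases Int.even_or_odd' c with ⟨d, rfl | rfl⟩
        · refine Or.inl fun i => ?_
          obtain ⟨n, hn⟩ := hx i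
          exact ⟨2 * d * n + d, by simp [hn]; ring⟩
        · refine Or.inr fun i => ?_
          obtain ⟨n, hn⟩ := hx i
          exact ⟨(2 * d + 1) * n + d, by simp [hn]; ring⟩
    · simp only [PiLp.smul_apply, zsmul_eq_mul, ← Finset.mul_sum, ha]
      push_cast
      ring

/-- The 6-dimensional subspace `x₆ = x₇ = -x₈` of `ℝ^8`
(coordinates are numbered from `0` in the code). -/
def spaceE6 : Submodule ℝ (EuclideanSpace ℝ (Fin 8)) where
  carrier := {x | x 5 = x 6 ∧ x 6 = -x 7}
  zero_mem' := by simp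
  add_mem' := by
    rintro x y ⟨h1, h2⟩ ⟨h3, h4⟩
    refine ⟨by simp [h1, h3], ?_⟩
    simp [h2, h4]
    ring
  smul_mem' := by
    rintro c x ⟨h1, h2⟩
    exact ⟨by simp [h1], by simp [h2]⟩

/-- The root lattice `E_6`: the intersection of `E_8` with the subspace
`x₆ = x₇ = -x₈`, i.e. the orthogonal in `E_8` of the copy of `A_2` spanned by
the roots `e₆ - e₇` and `e₇ + e₈`. -/
def latticeE6 : Submodule ℤ spaceE6 :=
  latticeE8.comap (spaceE6.subtype.restrictScalars ℤ)

/-- For a Weyl vector `ρ` of `A_{p-1}^k`, the lattice `Q_g`, `g = k (p - 1)`: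
the vectors `x` of `A_{p-1}^k` with `x · ρ ≡ 0 mod p`. -/
def latticeQ (k p : ℕ) (ρ : spaceA k p) : Submodule ℤ (spaceA k p) :=
  weylSublattice p (latticeA k p) ρ

end

/-! Write `p = q + 1` and `A = A_q^k`; in both cases `m = k + 2` and `g = k q`. Everything follows
from one statement about pairs of lattices. Let `L` be even without roots, with `res L ≃
(ℤ/p)^(k+2)`, and let `M` be the inverse image of an isotropic line. Then `M` is even of determinant
`p^k`, and `L` is the kernel of a linear form `ℓ : M → ℤ/p` (`exists_label`) that vanishes on no
root of `M`. The claim is that the pair `(M, L)` is isometric to `(A, Q_g)`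
(`exists_isometry_latticeA`).

The label `ℓ` constrains the roots of `M`. A subsystem `A_n` carries `n + 1` distinct residues, so
`n < p`, and `D₄` has no such labelling (`no_D4_labels`). The roots therefore split into orthogonal
blocks of type `A_n`. Should these blocks not have full rank, every vector of `M` outside their span
would be far from it, and a relative form of Hermite's inequality (`det_gram_mul_le_card_res`) would
make the determinant of `M` exceed `p^k`. So the blocks have full rank, and divisibility of `∏ (nᵢ +
1)` by `p^k` forces `M ≃ A_q^k` (`exists_full_config`). In each summand the labels exhaust `ℤ/p`;
ordering the coordinates by them turns `ℓ` into `x ↦ x · ρ mod p`.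

Uniqueness follows because Chevalley–Warning provides an isotropic line in any `res L` of rank at
least three (`exists_isotropic`). Transitivity on lines follows by applying the claim to two lines
of the same `res Q_g`.

For flags, once the line is sent to `A`, the plane corresponds to an even overlattice of `A` of
index `p`, that is, to an isotropic line of `(ℤ/p)^k` with the form `∑ tᵢ²`. These lines are
permuted transitively by sign changes of coordinates (`exists_signFlip_seedA`), and each sign change
is induced by an isometry of `A` fixing `ρ` (`signIsometry`): minus the permutation reversing the
order of the coordinates of `ρ` in a summand. Hence all flags are equivalent, and so are all planes,
as each contains a line. Finally, explicit root blocks and a glue vector in `E_8` and `E_6` identify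
them with the overlattice of the reference flag (`latticeIsometric_overA`). -/

/-! ### Lattice bases, Gram determinants and the order of the discriminant group -/

section GramDeterminants

variable {E : Type*} [NormedAddCommGroup E] [InnerProductSpace ℝ E]

/-- `b` is a `ℤ`-basis of the subgroup `M`, linearly independent over `ℝ`. -/
structure IsLatticeBasis {ι : Type*} (M : Submodule ℤ E) (b : ι → E) : Prop where
  linearIndependent : LinearIndependent ℝ b
  span_eq : Submodule.span ℤ (Set.range b) = M

theorem LinearIndependent.restrict_int {ι : Type*} {b : ι → E} (hb : LinearIndependent ℝ b) :
    LinearIndependent ℤ b :=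
  hb.restrict_scalars (by
    intro m n h
    simpa using h)

/-- The `ℤ`-basis of `M` given by a lattice basis. -/
noncomputable def IsLatticeBasis.basis {ι : Type*} {M : Submodule ℤ E} {b : ι → E}
    (hb : IsLatticeBasis M b) : Module.Basis ι ℤ M :=
  (Module.Basis.span hb.linearIndependent.restrict_int).map (LinearEquiv.ofEq _ _ hb.span_eq)

theorem IsLatticeBasis.coe_basis {ι : Type*} {M : Submodule ℤ E} {b : ι → E}
    (hb : IsLatticeBasis M b) (i : ι) : (hb.basis i : E) = b i := by
  simp [IsLatticeBasis.basis, Module.Basis.span_apply]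

theorem IsLatticeBasis.mem {ι : Type*} {M : Submodule ℤ E} {b : ι → E}
    (hb : IsLatticeBasis M b) (i : ι) : b i ∈ M := by
  rw [← hb.span_eq]; exact Submodule.subset_span ⟨i, rfl⟩

theorem span_real_span_int (s : Set E) :
    Submodule.span ℝ (Submodule.span ℤ s : Set E) = Submodule.span ℝ s :=
  Submodule.span_span_of_tower ℤ ℝ s

theorem exists_latticeBasis [FiniteDimensional ℝ E] {M : Submodule ℤ E} (hM : IsEvenLattice M) :
    ∃ b : Fin (Module.finrank ℝ E) → E, IsLatticeBasis M b := by
  have := hM.discrete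
  have : IsZLattice ℝ M := ⟨hM.span_eq_top⟩
  have := ZLattice.module_free ℝ M
  have := ZLattice.module_finite ℝ M
  let b0 := Module.finBasisOfFinrankEq ℤ M (ZLattice.rank ℝ M)
  refine ⟨fun i => b0 i, ?_, ?_⟩
  · have := (b0.ofZLatticeBasis ℝ M).linearIndependent
    have h : (fun i => (b0 i : E)) = b0.ofZLatticeBasis ℝ M := by
      ext i
      simp
    rw [h]
    exact this
  · have := b0.ofZLatticeBasis_span ℝ M
    convert this using 3
    ext i
    simp

open Matrix in
theorem gram_sum_smul {ι κ : Type*} [Fintype ι] [Fintype κ] (b : κ → E) (T : Matrix ι κ ℝ) :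
    gram ℝ (fun i => ∑ j, T i j • b j) = T * gram ℝ b * Tᵀ := by
  ext i j
  simp only [gram_apply, mul_apply, sum_inner, inner_sum, inner_smul_left, inner_smul_right,
    transpose_apply, Finset.sum_mul, RCLike.conj_to_real]
  refine Finset.sum_congr rfl fun x _ => ?_
  rw [Finset.mul_sum]
  refine Finset.sum_congr rfl fun y _ => ?_
  rw [real_inner_comm]
  ring

/-- Integral coordinates with respect to a lattice basis. -/
theorem IsLatticeBasis.exists_matrix {ι κ : Type*} [Fintype ι] {M : Submodule ℤ E} {b : ι → E}
    (hb : IsLatticeBasis M b) (u : κ → E) (hu : ∀ i, u i ∈ M) :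
    ∃ T : Matrix κ ι ℤ, ∀ i, u i = ∑ j, (T i j : ℝ) • b j := by
  have (i : κ) : ∃ c : ι → ℤ, ∑ j, c j • b j = u i := by
    have := hu i
    rw [← hb.span_eq] at this
    exact (Submodule.mem_span_range_iff_exists_fun ℤ).1 this
  choose T hT using this
  exact ⟨T, fun i => by simp_rw [← hT i, Int.cast_smul_eq_zsmul]⟩

open Matrix in
theorem det_gram_of_matrix {ι : Type*} [Fintype ι] [DecidableEq ι] {b u : ι → E}
    (T : Matrix ι ι ℤ) (hT : ∀ i, u i = ∑ j, (T i j : ℝ) • b j) :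
    (gram ℝ u).det = (T.det : ℝ) ^ 2 * (gram ℝ b).det := by
  have h : u = fun i => ∑ j, (T.map (Int.cast : ℤ → ℝ)) i j • b j := by
    ext1 i
    simpa using hT i
  have hd : (T.map (Int.cast : ℤ → ℝ)).det = T.det := (Int.castRingHom ℝ).map_det T |>.symm
  rw [h, gram_sum_smul, det_mul, det_mul, det_transpose, hd]
  ring

/-- The index of a sublattice is the determinant of the change of basis. -/
theorem relIndex_eq_natAbs_det_matrix {ι : Type*} [Fintype ι] [DecidableEq ι]
    {L M : Submodule ℤ E} {u b : ι → E} (hLM : L ≤ M) (hu : IsLatticeBasis L u)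
    (hb : IsLatticeBasis M b) (T : Matrix ι ι ℤ) (hT : ∀ i, u i = ∑ j, (T i j : ℝ) • b j) :
    L.toAddSubgroup.relIndex M.toAddSubgroup = T.det.natAbs := by
  refine (AddSubgroup.relIndex_eq_natAbs_det L.toAddSubgroup M.toAddSubgroup hLM
    hu.basis hb.basis).trans ?_
  congr 1
  change hb.basis.det (fun i => (⟨(hu.basis i : E), hLM (hu.basis i).2⟩ : M)) = T.det
  rw [Module.Basis.det_apply, ← Matrix.det_transpose]
  congr 1
  ext i j
  rw [Matrix.transpose_apply, Module.Basis.toMatrix_apply]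
  have : (⟨(hu.basis i : E), hLM (hu.basis i).2⟩ : M) = ∑ j, T i j • hb.basis j := by
    ext
    simp only [Submodule.coe_sum, Submodule.coe_smul, hb.coe_basis, hu.coe_basis, hT]
    simp_rw [Int.cast_smul_eq_zsmul]
  have h2 := congrArg (fun x => hb.basis.repr x j) this
  simp only [map_sum, map_zsmul, Module.Basis.repr_self, Finsupp.coe_finsetSum,
    Finset.sum_apply, Finsupp.smul_apply] at h2
  rw [Finset.sum_eq_single j] at h2
  · simpa using h2
  · intro k _ hk
    simp [Finsupp.single_eq_of_ne hk.symm]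
  · simp

open Matrix in
theorem det_gram_sublattice {ι : Type*} [Fintype ι] [DecidableEq ι]
    {L M : Submodule ℤ E} {u b : ι → E} (hLM : L ≤ M) (hu : IsLatticeBasis L u)
    (hb : IsLatticeBasis M b) :
    (gram ℝ u).det = (L.toAddSubgroup.relIndex M.toAddSubgroup : ℝ) ^ 2 * (gram ℝ b).det := by
  obtain ⟨T, hT⟩ := hb.exists_matrix u fun i => hLM (hu.mem i)
  rw [det_gram_of_matrix T hT, relIndex_eq_natAbs_det_matrix hLM hu hb T hT]
  congr 1
  rw [← Int.cast_natCast, Int.natCast_natAbs, Int.cast_abs, sq_abs]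

theorem IsEvenLattice.exists_inner_eq {M : Submodule ℤ E} (hM : IsEvenLattice M) {x y : E}
    (hx : x ∈ M) (hy : y ∈ M) : ∃ n : ℤ, ⟪x, y⟫_ℝ = n := by
  obtain ⟨a, ha⟩ := hM.even _ hx
  obtain ⟨b, hb⟩ := hM.even _ hy
  obtain ⟨c, hc⟩ := hM.even _ (M.add_mem hx hy)
  refine ⟨c - a - b, ?_⟩
  rw [inner_add_left, inner_add_right, inner_add_right, real_inner_comm x y, ha, hb] at hc
  push_cast
  linarith

theorem IsEvenLattice.le_dual {M : Submodule ℤ E} (hM : IsEvenLattice M) :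
    M ≤ dualLattice M := fun _ hx =>
  mem_dualLattice.2 fun _ hy => hM.exists_inner_eq hx hy

theorem innerₗ_nondegenerate : (innerₗ E : LinearMap.BilinForm ℝ E).Nondegenerate := by
  refine ⟨fun x hx => ?_, fun x hx => ?_⟩
  · exact inner_self_eq_zero.1 (hx x)
  · exact inner_self_eq_zero.1 (hx x)

open Matrix in
/-- The order of the discriminant group is the Gram determinant. -/
theorem card_res_eq_det_gram [FiniteDimensional ℝ E] {ι : Type*} [Fintype ι] [DecidableEq ι]
    {M : Submodule ℤ E} {b : ι → E} (hM : IsEvenLattice M) (hb : IsLatticeBasis M b) :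
    (gram ℝ b).det = Nat.card (Res M) := by
  have hspan : Submodule.span ℝ (Set.range b) = ⊤ := by
    have := hM.span_eq_top
    rwa [← hb.span_eq, span_real_span_int] at this
  let B : Module.Basis ι ℝ E := Module.Basis.mk hb.linearIndependent hspan.ge
  have hB : (B : ι → E) = b := Module.Basis.coe_mk _ _
  let D := LinearMap.BilinForm.dualBasis (innerₗ E) innerₗ_nondegenerate B
  have hD : IsLatticeBasis (dualLattice M) D := by
    refine ⟨D.linearIndependent, ?_⟩
    rw [← LinearMap.BilinForm.dualSubmodule_span_of_basis, hB, hb.span_eq, dualLattice]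
  have hDB (i j : ι) : ⟪D i, b j⟫_ℝ = if j = i then 1 else 0 := by
    have := LinearMap.BilinForm.apply_dualBasis_left innerₗ_nondegenerate B i j
    rw [hB] at this
    exact this
  choose G hG using fun i j => hM.exists_inner_eq (hb.mem i) (hb.mem j)
  -- The coordinates of `b i` in the dual basis are Gram entries, so the index of `M` in its dual is
  -- the Gram determinant.
  have hT (i : ι) : b i = ∑ j, ((Matrix.of G) i j : ℝ) • D j := by
    rw [← B.repr.injective.eq_iff]
    have : ∀ x y : E, (∀ j, ⟪x, b j⟫_ℝ = ⟪y, b j⟫_ℝ) → x = y := by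
      intro x y h
      rw [← sub_eq_zero]
      refine (innerₗ_nondegenerate (E := E)).1 _ fun z => ?_
      have hz : z ∈ Submodule.span ℝ (Set.range b) := hspan ▸ Submodule.mem_top
      refine Submodule.span_induction ?_ ?_ ?_ ?_ hz
      · rintro _ ⟨j, rfl⟩
        simp [h j]
      · simp
      · intro y z _ _ h1 h2
        rw [map_add, h1, h2, add_zero]
      · intro c z _ h
        rw [map_smul, h, smul_zero]
    congr 1
    refine this _ _ fun j => ?_
    rw [sum_inner]
    simp [inner_smul_left, hDB, hG]
  have h1 := relIndex_eq_natAbs_det_matrix hM.le_dual hb hD _ hT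
  have h2 : (gram ℝ b).det = ((Matrix.of G).det : ℝ) := by
    rw [show gram ℝ b = (Matrix.of G).map (Int.cast : ℤ → ℝ) by ext i j; simp [gram_apply, hG]]
    exact ((Int.castRingHom ℝ).map_det (Matrix.of G)).symm
  have h3 : (0 : ℝ) < (gram ℝ b).det := (posDef_gram_of_linearIndependent hb.linearIndependent).det_pos
  have h4 : Nat.card (Res M) = M.toAddSubgroup.relIndex (dualLattice M).toAddSubgroup := rfl
  rw [h4, h1, h2]
  rw [h2] at h3
  have : 0 < (Matrix.of G).det := by exact_mod_cast h3
  rw [← Int.cast_natCast, Int.natCast_natAbs, abs_of_pos this]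

end GramDeterminants

/-! ### Hermite's inequality relative to a sublattice -/

section HermiteReduction

variable {E : Type*} [NormedAddCommGroup E] [InnerProductSpace ℝ E]

-- Replacing `w` by its component orthogonal to the span is a unipotent change of family, after
-- which the Gram matrix is block diagonal.
open Matrix in
theorem det_gram_sumElim [FiniteDimensional ℝ E] {κ : Type*} [Fintype κ] [DecidableEq κ]
    (u : κ → E) (w : E) :
    (gram ℝ (Sum.elim u fun _ : Unit => w)).det =
      (gram ℝ u).det * ‖w - (Submodule.span ℝ (Set.range u)).starProjection w‖ ^ 2 := by
  set V := Submodule.span ℝ (Set.range u) with hV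
  set q := w - V.starProjection w with hq
  have hqV : q ∈ Vᗮ := V.sub_starProjection_mem_orthogonal w
  obtain ⟨c, hc⟩ := (Submodule.mem_span_range_iff_exists_fun ℝ).1
    (V.starProjection_apply_mem w)
  let T : Matrix (κ ⊕ Unit) (κ ⊕ Unit) ℝ :=
    fromBlocks 1 0 (Matrix.of fun _ i => c i) 1
  have h1 : (Sum.elim u fun _ : Unit => w) =
      fun i => ∑ j, T i j • (Sum.elim u fun _ : Unit => q) j := by
    ext1 i
    rcases i with i | i
    · simp [T, Matrix.one_apply]
    · simp [T, hc, hq]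
  have h2 : gram ℝ (Sum.elim u fun _ : Unit => q) =
      fromBlocks (gram ℝ u) 0 0 (Matrix.of fun _ _ => ‖q‖ ^ 2) := by
    ext i j
    rcases i with i | i <;> rcases j with j | j
    · simp [gram_apply]
    · simpa [gram_apply] using hqV (u i) (Submodule.subset_span ⟨i, rfl⟩)
    · simpa [gram_apply, real_inner_comm] using hqV (u j) (Submodule.subset_span ⟨j, rfl⟩)
    · simp [gram_apply]
  have hT : T.det = 1 := by simp [T]
  rw [h1, gram_sum_smul, det_mul, det_mul, det_transpose, hT, h2, det_fromBlocks_zero₂₁]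
  simp

open Matrix in
theorem exists_nat_det_gram {M : Submodule ℤ E} (hM : IsEvenLattice M) {κ : Type*} [Fintype κ]
    [DecidableEq κ] (u : κ → E) (hu : ∀ i, u i ∈ M) : ∃ n : ℕ, (gram ℝ u).det = n := by
  choose G hG using fun i j => hM.exists_inner_eq (hu i) (hu j)
  have h2 : (gram ℝ u).det = ((Matrix.of G).det : ℝ) := by
    rw [show gram ℝ u = (Matrix.of G).map (Int.cast : ℤ → ℝ) by ext i j; simp [gram_apply, hG]]
    exact ((Int.castRingHom ℝ).map_det (Matrix.of G)).symm
  have h3 : 0 ≤ (gram ℝ u).det := (posSemidef_gram (𝕜 := ℝ) u).det_nonneg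
  rw [h2] at h3 ⊢
  have h4 : 0 ≤ (Matrix.of G).det := by exact_mod_cast h3
  obtain ⟨n, hn⟩ := Int.eq_ofNat_of_zero_le h4
  exact ⟨n, by rw [hn]; simp⟩

theorem norm_sub_starProjection_le [FiniteDimensional ℝ E] (V : Submodule ℝ E) (x : E) {v : E}
    (hv : v ∈ V) : ‖x - V.starProjection x‖ ^ 2 ≤ ‖x - v‖ ^ 2 := by
  have h1 : x - v = (x - V.starProjection x) + (V.starProjection x - v) := by abel
  have h2 : ⟪x - V.starProjection x, V.starProjection x - v⟫_ℝ = 0 := by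
    rw [real_inner_comm]
    exact V.sub_starProjection_mem_orthogonal x _
      (V.sub_mem (V.starProjection_apply_mem x) hv)
  rw [h1, norm_add_sq_real, h2]
  nlinarith [sq_nonneg ‖V.starProjection x - v‖]

/-- Among the vectors of an even lattice outside a subspace spanned by lattice vectors,
there is one closest to the subspace. -/
theorem exists_min_dist [FiniteDimensional ℝ E] {M : Submodule ℤ E} (hM : IsEvenLattice M)
    {κ : Type*} [Fintype κ] (u : κ → E) (hu : ∀ i, u i ∈ M) (hli : LinearIndependent ℝ u)
    (hcard : Fintype.card κ < Module.finrank ℝ E) :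
    ∃ w ∈ M, w ∉ Submodule.span ℝ (Set.range u) ∧
      ∀ x ∈ M, x ∉ Submodule.span ℝ (Set.range u) →
        ‖w - (Submodule.span ℝ (Set.range u)).starProjection w‖ ^ 2 ≤
        ‖x - (Submodule.span ℝ (Set.range u)).starProjection x‖ ^ 2 := by
  classical
  set V := Submodule.span ℝ (Set.range u) with hV
  have hne : ∃ x ∈ M, x ∉ V := by
    by_contra! h
    have : (⊤ : Submodule ℝ E) ≤ V := by
      rw [← hM.span_eq_top]
      exact Submodule.span_le.2 h
    have h2 := finrank_span_eq_card hli
    rw [← hV, top_le_iff.1 this, finrank_top] at h2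
    omega
  -- Up to the constant factor `det (gram u)`, the squared distance to `V` is a Gram determinant of
  -- lattice vectors, hence a natural number; `Nat.find` therefore minimises the distance.
  have hex : ∃ n : ℕ, ∃ x ∈ M, x ∉ V ∧
      (Matrix.gram ℝ (Sum.elim u fun _ : Unit => x)).det = n := by
    obtain ⟨x, hx, hxV⟩ := hne
    obtain ⟨n, hn⟩ := exists_nat_det_gram hM (Sum.elim u fun _ : Unit => x) (by
      rintro (i | i)
      · exact hu i
      · exact hx)
    exact ⟨n, x, hx, hxV, hn⟩
  obtain ⟨w, hw, hwV, hwn⟩ := Nat.find_spec hex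
  refine ⟨w, hw, hwV, fun x hx hxV => ?_⟩
  obtain ⟨n, hn⟩ := exists_nat_det_gram hM (Sum.elim u fun _ : Unit => x) (by
    rintro (i | i)
    · exact hu i
    · exact hx)
  have hle : Nat.find hex ≤ n := Nat.find_le ⟨x, hx, hxV, hn⟩
  have hle' : (Nat.find hex : ℝ) ≤ n := by exact_mod_cast hle
  rw [← hwn, ← hn, det_gram_sumElim, det_gram_sumElim] at hle'
  exact le_of_mul_le_mul_left hle' (Matrix.posDef_gram_of_linearIndependent hli).det_pos

/-- **Hermite's inequality**, relative form: if `u` is a basis of a sublattice of `M` and all other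
vectors of `M` have distance at least `√μ` to its real span, then the determinant of `M` is
bounded below. -/
theorem det_gram_mul_le_card_res [FiniteDimensional ℝ E] {M : Submodule ℤ E}
    (hM : IsEvenLattice M) (s : ℕ) {κ : Type} [Fintype κ] [DecidableEq κ] (u : κ → E)
    (hu : ∀ i, u i ∈ M) (hli : LinearIndependent ℝ u)
    (hcard : Fintype.card κ + s = Module.finrank ℝ E) (μ : ℝ) (hμ : 0 < μ)
    (hsep : ∀ x ∈ M, x ∈ Submodule.span ℤ (Set.range u) ∨
      ∀ v ∈ Submodule.span ℝ (Set.range u), μ ≤ ‖x - v‖ ^ 2) :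
    (Matrix.gram ℝ u).det * μ ^ s * (3 / 4) ^ (s.choose 2) ≤ Nat.card (Res M) := by
  induction s generalizing κ μ with
  | zero =>
    -- The real span is everything, so the second alternative of `hsep`, taken at `v = x`, would
    -- give `μ ≤ 0`; hence `u` is a basis of `M`.
    have htop : Submodule.span ℝ (Set.range u) = ⊤ :=
      Submodule.eq_top_of_finrank_eq ((finrank_span_eq_card hli).trans (by simpa using hcard))
    have hb : IsLatticeBasis M u := by
      refine ⟨hli, le_antisymm (Submodule.span_le.2 ?_) fun x hx => ?_⟩
      · rintro _ ⟨i, rfl⟩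
        exact hu i
      · refine (hsep x hx).resolve_right fun h => ?_
        have := h x (htop ▸ Submodule.mem_top)
        simp at this
        linarith
    rw [card_res_eq_det_gram hM hb]
    simp
  | succ s ih =>
    obtain ⟨w, hw, hwV, hmin⟩ := exists_min_dist hM u hu hli (by omega)
    set V := Submodule.span ℝ (Set.range u) with hV
    set q : E → E := fun x => x - V.starProjection x with hq
    set m := ‖q w‖ ^ 2 with hm
    have hZV : Submodule.span ℤ (Set.range u) ≤ V.restrictScalars ℤ := by
      refine Submodule.span_le.2 ?_
      rintro _ ⟨i, rfl⟩
      exact Submodule.subset_span ⟨i, rfl⟩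
    have hμm : μ ≤ m := by
      rcases hsep w hw with h | h
      · exact absurd (hZV h) hwV
      · exact h _ (V.starProjection_apply_mem w)
    have hmpos : 0 < m := hμ.trans_le hμm
    have hVu' : Submodule.span ℝ (Set.range (Sum.elim u fun _ : Unit => w)) =
        V ⊔ Submodule.span ℝ {w} := by
      rw [Set.Sum.elim_range, Submodule.span_union, Set.range_const]
    have hZu' : Submodule.span ℤ (Set.range (Sum.elim u fun _ : Unit => w)) =
        Submodule.span ℤ (Set.range u) ⊔ Submodule.span ℤ {w} := by
      rw [Set.Sum.elim_range, Submodule.span_union, Set.range_const]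
    have hdet := det_gram_sumElim u w
    -- The closest vector `w` is adjoined to the basis, which multiplies its Gram determinant by
    -- `m`. The separation for the new family is `3/4 * m`: after subtracting a multiple of `w`, the
    -- part of `x` orthogonal to `V` has a component along `q w` of squared norm at most `m / 4`,
    -- while its total squared norm is at least `m` by minimality.
    have key := ih (Sum.elim u fun _ : Unit => w) (by
        rintro (i | i)
        · exact hu i
        · exact hw)
      (by
        rw [← Matrix.det_gram_ne_zero_iff_linearIndependent, hdet]
        exact (mul_pos (Matrix.posDef_gram_of_linearIndependent hli).det_pos hmpos).ne')
      (by simp; omega) (3 / 4 * m) (by positivity)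
      (by
        intro x hx
        by_cases hcase : ∃ n : ℤ, x - n • w ∈ V
        · left
          obtain ⟨n, hn⟩ := hcase
          have hxM : x - n • w ∈ M := M.sub_mem hx (M.smul_mem n hw)
          have h1 : x - n • w ∈ Submodule.span ℤ (Set.range u) := by
            refine (hsep _ hxM).resolve_right fun h => ?_
            have := h _ hn
            simp at this
            linarith
          rw [hZu', ← sub_add_cancel x (n • w)]
          exact Submodule.add_mem_sup h1
            (Submodule.smul_mem _ _ (Submodule.mem_span_singleton_self w))
        · right
          push Not at hcase
          intro v hv
          rw [hVu'] at hv
          obtain ⟨v0, hv0, y, hy, rfl⟩ := Submodule.mem_sup.1 hv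
          obtain ⟨τ, rfl⟩ := Submodule.mem_span_singleton.1 hy
          set t := ⟪q x, q w⟫_ℝ / m with ht
          set n := round t with hn
          have hround := abs_sub_round t
          have hqn : q (x - n • w) = q x - (n : ℝ) • q w := by
            simp only [hq, ← Int.cast_smul_eq_zsmul ℝ, map_sub, map_smul]
            module
          have h1 : m ≤ ‖q x - (n : ℝ) • q w‖ ^ 2 := by
            rw [← hqn]
            exact hmin _ (M.sub_mem hx (M.smul_mem n hw)) (hcase n)
          have h2 : ‖q x - τ • q w‖ ^ 2 ≤ ‖x - (v0 + τ • w)‖ ^ 2 := by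
            have := norm_sub_starProjection_le V (x - τ • w) hv0
            have e1 : x - τ • w - V.starProjection (x - τ • w) = q x - τ • q w := by
              simp only [hq, map_sub, map_smul]
              module
            rw [e1] at this
            convert this using 3
            abel
          have hexp (r : ℝ) : ‖q x - r • q w‖ ^ 2 = ‖q x‖ ^ 2 - 2 * r * (t * m) + r ^ 2 * m := by
            rw [norm_sub_sq_real, inner_smul_right, norm_smul, mul_pow, Real.norm_eq_abs, sq_abs,
              ht, div_mul_cancel₀ _ hmpos.ne']
            ring
          rw [hexp] at h1 h2
          have h3 : (t - n) ^ 2 ≤ 1 / 4 := by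
            rw [← sq_abs]
            nlinarith [abs_nonneg (t - n)]
          have h4 : (t - n) ^ 2 * m ≤ 1 / 4 * m := by gcongr
          have h5 : 0 ≤ (t - τ) ^ 2 * m := by positivity
          nlinarith)
    rw [hdet] at key
    refine le_trans ?_ key
    have hpos : 0 < (Matrix.gram ℝ u).det :=
      (Matrix.posDef_gram_of_linearIndependent hli).det_pos
    have e : (Matrix.gram ℝ u).det * ‖w - V.starProjection w‖ ^ 2 * (3 / 4 * m) ^ s
        * (3 / 4) ^ s.choose 2
        = (Matrix.gram ℝ u).det * m ^ (s + 1) * (3 / 4) ^ ((s + 1).choose 2) := by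
      rw [Nat.choose_succ_succ' s 1, Nat.choose_one_right, pow_add, mul_pow, ← hm]
      ring
    rw [e]
    gcongr

end HermiteReduction

/-! ### Root subsystems of type `A_n` in a labelled even lattice -/

section RootBlocks

variable {E : Type*} [NormedAddCommGroup E] [InnerProductSpace ℝ E]

/-- The vectors `u i` have the Gram matrix of `e_i - e_0` in the root lattice `A_n`. -/
def IsBlock {M : Submodule ℤ E} {n : ℕ} (u : Fin n → M) : Prop :=
  ∀ i j, ⟪(u i : E), (u j : E)⟫_ℝ = if i = j then 2 else 1

/-- `x` is a root of `M`. -/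
def IsRoot {M : Submodule ℤ E} (x : M) : Prop := ⟪(x : E), (x : E)⟫_ℝ = 2

variable {M : Submodule ℤ E}

theorem IsRoot.neg {x : M} (hx : IsRoot x) : IsRoot (-x) := by
  simpa [IsRoot] using hx

theorem IsEvenLattice.two_le_norm (hM : IsEvenLattice M) {x : M} (hx : x ≠ 0) :
    2 ≤ ⟪(x : E), (x : E)⟫_ℝ := by
  obtain ⟨n, hn⟩ := hM.even _ x.2
  have h0 : 0 < ⟪(x : E), (x : E)⟫_ℝ := real_inner_self_pos.2 (by simpa using hx)
  rw [hn] at h0 ⊢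
  have : 0 < n := by
    have : (0 : ℝ) < n := by linarith
    exact_mod_cast this
  have : (1 : ℝ) ≤ n := by exact_mod_cast this
  linarith

/-- The nonzero vector `x - y` has norm `4 - 2 (x · y)`, which must be at least `2`. -/
theorem IsRoot.inner_le_one (hM : IsEvenLattice M) {x y : M} (hx : IsRoot x) (hy : IsRoot y)
    (hxy : x ≠ y) : ⟪(x : E), (y : E)⟫_ℝ ≤ 1 := by
  have h := hM.two_le_norm (sub_ne_zero.2 hxy)
  rw [Submodule.coe_sub, inner_sub_left, inner_sub_right, inner_sub_right, hx, hy,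
    real_inner_comm (x : E) (y : E)] at h
  linarith

theorem IsBlock.isRoot {n : ℕ} {u : Fin n → M} (hu : IsBlock u) (i : Fin n) : IsRoot (u i) :=
  (hu i i).trans (if_pos rfl)

theorem IsBlock.isRoot_sub {n : ℕ} {u : Fin n → M} (hu : IsBlock u) {i j : Fin n} (hij : i ≠ j) :
    IsRoot (u i - u j) := by
  rw [IsRoot, Submodule.coe_sub, inner_sub_left, inner_sub_right, inner_sub_right, hu i i, hu i j,
    hu j i, hu j j, if_pos rfl, if_pos rfl, if_neg hij, if_neg hij.symm]
  norm_num

theorem IsBlock.cons {n : ℕ} {u : Fin n → M} (hu : IsBlock u) {v : M} (hv : IsRoot v)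
    (huv : ∀ i, ⟪(v : E), (u i : E)⟫_ℝ = 1) : IsBlock (Fin.cons v u : Fin (n + 1) → M) := by
  intro i j
  refine Fin.cases ?_ (fun i => ?_) i <;> refine Fin.cases ?_ (fun j => ?_) j
  · exact hv.trans (if_pos rfl).symm
  · simp [huv, (Fin.succ_ne_zero j).symm]
  · simp [real_inner_comm, huv, Fin.succ_ne_zero i]
  · simpa using hu i j

theorem IsBlock.label_injective {n p : ℕ} {u : Fin n → M} (hu : IsBlock u) (ℓ : M →+ ZMod p)
    (hℓ : ∀ x : M, IsRoot x → ℓ x ≠ 0) : Function.Injective fun i => ℓ (u i) := by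
  intro i j h
  by_contra hij
  exact hℓ _ (hu.isRoot_sub hij) (by simpa [sub_eq_zero] using h)

/-- The residues `0` and `ℓ (u i)` are pairwise distinct, because the `u i` and their differences
are roots. -/
theorem IsBlock.lt_of_label {n p : ℕ} [NeZero p] {u : Fin n → M} (hu : IsBlock u)
    (ℓ : M →+ ZMod p) (hℓ : ∀ x : M, IsRoot x → ℓ x ≠ 0) : n < p := by
  have hinj : Function.Injective (Fin.cons 0 fun i => ℓ (u i) : Fin (n + 1) → ZMod p) :=
    Fin.cons_injective_iff.2 ⟨by
      rintro ⟨i, hi⟩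
      exact hℓ _ (hu.isRoot i) hi, hu.label_injective ℓ hℓ⟩
  simpa [ZMod.card] using Fintype.card_le_of_injective _ hinj

/-- The twelve expressions are the labels of the positive roots of `D₄`. Modulo `3` there are not
even three distinct nonzero residues; modulo `5` the finitely many assignments are checked. -/
theorem no_D4_labels {p : ℕ} (hp : p = 3 ∨ p = 5) (x y z b : ZMod p) (hx : x ≠ 0) (hy : y ≠ 0)
    (hz : z ≠ 0) (hxy : x - y ≠ 0) (hxz : x - z ≠ 0) (hyz : y - z ≠ 0) (hb : b ≠ 0)
    (h1 : b - x ≠ 0) (h2 : b - y ≠ 0) (h3 : b - x + z ≠ 0) (h4 : b - y + z ≠ 0)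
    (h5 : b - x - y + z ≠ 0) : False := by
  rcases hp with rfl | rfl
  · revert x y z b; decide
  · revert x y z b; decide

/-- A root whose inner products with a block are all `0` or `1`, not all `0`, allows to extend
the block; the alternative, a subsystem `D₄`, is excluded by the labels. -/
theorem IsBlock.exists_cons_of_nonneg {p n : ℕ} (hp : p = 3 ∨ p = 5)
    {u : Fin n → M} (hu : IsBlock u) (ℓ : M →+ ZMod p) (hℓ : ∀ x : M, IsRoot x → ℓ x ≠ 0)
    {β : M} (hβ : IsRoot β)
    (h01 : ∀ i, ⟪(β : E), (u i : E)⟫_ℝ = 0 ∨ ⟪(β : E), (u i : E)⟫_ℝ = 1)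
    (h1 : ∃ i, ⟪(β : E), (u i : E)⟫_ℝ = 1) :
    ∃ v : M, IsBlock (Fin.cons v u : Fin (n + 1) → M) := by
  have hβ' : ⟪(β : E), (β : E)⟫_ℝ = 2 := hβ
  by_cases hall : ∀ i, ⟪(β : E), (u i : E)⟫_ℝ = 1
  · exact ⟨β, hu.cons hβ hall⟩
  obtain ⟨j, hj⟩ := not_forall.1 hall
  replace hj := (h01 j).resolve_right hj
  obtain ⟨i, hi⟩ := h1
  have hij : i ≠ j := by rintro rfl; rw [hi] at hj; norm_num at hj
  -- In coordinates with `u a = e_a - e_0`, a `β` meeting only `u i` behaves like `e_i - e_new`, so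
  -- the new block vector is `u i - β = e_new - e_0`.
  by_cases hone : ∀ k, k ≠ i → ⟪(β : E), (u k : E)⟫_ℝ = 0
  · refine ⟨u i - β, hu.cons ?_ fun k => ?_⟩
    · simp only [IsRoot, Submodule.coe_sub, inner_sub_left, inner_sub_right, hβ',
        real_inner_comm (β : E) (u i : E), hi, hu i i]
      norm_num
    · by_cases hk : k = i
      · subst hk
        rw [Submodule.coe_sub, inner_sub_left, hi, hu k k, if_pos rfl]
        norm_num
      · simp [inner_sub_left, hone k hk, hu i k, Ne.symm hk]
  push Not at hone
  obtain ⟨k, hki, hk⟩ := hone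
  replace hk := (h01 k).resolve_left hk
  have hkj : k ≠ j := by rintro rfl; rw [hk] at hj; norm_num at hj
  -- Now `β` has products `1, 1, 0` with `u i, u k, u j`, and these four roots generate a `D₄`. The
  -- forbidden labels are those of explicit combinations, each checked below to have norm `2`.
  exfalso
  have ci := real_inner_comm (β : E) (u i : E)
  have cj := real_inner_comm (β : E) (u j : E)
  have ck := real_inner_comm (β : E) (u k : E)
  rw [hi] at ci
  rw [hj] at cj
  rw [hk] at ck
  have gii := hu i i
  have gij := hu i j
  have gik := hu i k
  have gji := hu j i
  have gjj := hu j j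
  have gjk := hu j k
  have gki := hu k i
  have gkj := hu k j
  have gkk := hu k k
  simp only [hij, hij.symm, hki, hki.symm, hkj, hkj.symm, if_true, if_false]
    at gii gij gik gji gjj gjk gki gkj gkk
  refine no_D4_labels hp (ℓ (u i)) (ℓ (u k)) (ℓ (u j)) (ℓ β) (hℓ _ (hu.isRoot i))
    (hℓ _ (hu.isRoot k)) (hℓ _ (hu.isRoot j)) ?_ ?_ ?_ (hℓ _ hβ) ?_ ?_ ?_ ?_ ?_
  · rw [← map_sub]; exact hℓ _ (hu.isRoot_sub hki.symm)
  · rw [← map_sub]; exact hℓ _ (hu.isRoot_sub hij)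
  · rw [← map_sub]; exact hℓ _ (hu.isRoot_sub hkj)
  all_goals
    simp only [← map_sub, ← map_add]
    refine hℓ _ ?_
    simp only [IsRoot, Submodule.coe_sub, Submodule.coe_add, inner_sub_left, inner_sub_right,
      inner_add_left, inner_add_right, hβ', hi, hj, hk, ci, cj, ck, gii, gij, gik, gji, gjj, gjk,
      gki, gkj, gkk]
    norm_num

/-- A root outside the span differs from the roots `± u i` and `u i - u j` of the block, so
`IsRoot.inner_le_one` applies to each of them. -/
theorem IsBlock.abs_inner_le (hM : IsEvenLattice M) {n : ℕ} {u : Fin n → M} (hu : IsBlock u)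
    {β : M} (hβ : IsRoot β) (hnot : β ∉ Submodule.span ℤ (Set.range u)) :
    (∀ i, ⟪(β : E), (u i : E)⟫_ℝ ≤ 1) ∧ (∀ i, -1 ≤ ⟪(β : E), (u i : E)⟫_ℝ) ∧
      ∀ i j, ⟪(β : E), (u i : E)⟫_ℝ - ⟪(β : E), (u j : E)⟫_ℝ ≤ 1 := by
  have hmem (i : Fin n) : u i ∈ Submodule.span ℤ (Set.range u) := Submodule.subset_span ⟨i, rfl⟩
  refine ⟨fun i => hβ.inner_le_one hM (hu.isRoot i) ?_, fun i => ?_, fun i j => ?_⟩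
  · rintro rfl; exact hnot (hmem i)
  · have := hβ.inner_le_one hM (hu.isRoot i).neg (by
      rintro rfl; exact hnot (Submodule.neg_mem _ (hmem i)))
    rw [Submodule.coe_neg, inner_neg_right] at this
    linarith
  · by_cases hij : i = j
    · subst hij; simp
    · have := hβ.inner_le_one hM (hu.isRoot_sub hij) (by
        rintro rfl; exact hnot (Submodule.sub_mem _ (hmem i) (hmem j)))
      rwa [Submodule.coe_sub, inner_sub_right] at this

theorem int_cast_eq_zero_or_one {x : ℝ} (hx : ∃ n : ℤ, x = n) (h0 : -1 < x) (h1 : x ≤ 1) :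
    x = 0 ∨ x = 1 := by
  obtain ⟨n, rfl⟩ := hx
  have h0' : -1 < n := by exact_mod_cast h0
  have h1' : n ≤ 1 := by exact_mod_cast h1
  obtain h | h : n = 0 ∨ n = 1 := by omega
  · left; simp [h]
  · right; simp [h]

/-- The products with the block lie in `{-1, 0, 1}` and differ by at most `1`, so they cannot take
both signs; up to replacing `β` by `-β` they are `0` or `1`. -/
theorem IsBlock.exists_cons (hM : IsEvenLattice M) {p n : ℕ} (hp : p = 3 ∨ p = 5)
    {u : Fin n → M} (hu : IsBlock u) (ℓ : M →+ ZMod p) (hℓ : ∀ x : M, IsRoot x → ℓ x ≠ 0)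
    {β : M} (hβ : IsRoot β) (hnot : β ∉ Submodule.span ℤ (Set.range u))
    (hne : ∃ i, ⟪(β : E), (u i : E)⟫_ℝ ≠ 0) :
    ∃ v : M, IsBlock (Fin.cons v u : Fin (n + 1) → M) := by
  obtain ⟨h1, h2, h3⟩ := hu.abs_inner_le hM hβ hnot
  have hint (i : Fin n) := hM.exists_inner_eq β.2 (u i).2
  obtain ⟨i, hi⟩ := hne
  rcases lt_or_ge (-1) ⟪(β : E), (u i : E)⟫_ℝ with hlt | hge
  · have hi1 := (int_cast_eq_zero_or_one (hint i) hlt (h1 i)).resolve_left hi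
    refine hu.exists_cons_of_nonneg hp ℓ hℓ hβ (fun j => ?_) ⟨i, hi1⟩
    refine int_cast_eq_zero_or_one (hint j) ?_ (h1 j)
    have := h3 i j
    have hj0 : 0 ≤ ⟪(β : E), (u j : E)⟫_ℝ := by linarith
    linarith
  · have hi1 : ⟪(β : E), (u i : E)⟫_ℝ = -1 := le_antisymm hge (h2 i)
    refine hu.exists_cons_of_nonneg hp ℓ hℓ hβ.neg (fun j => ?_) ⟨i, by simp [hi1]⟩
    rw [Submodule.coe_neg, inner_neg_left]
    obtain ⟨m, hm⟩ := hint j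
    refine int_cast_eq_zero_or_one ⟨-m, by simp [hm]⟩ ?_ (by linarith [h2 j])
    have := h3 j i
    linarith

/-- Every root lies in a saturated block: all other roots lie in its span or are orthogonal
to it. -/
theorem exists_saturated_block (hM : IsEvenLattice M) {p : ℕ} (hp : p = 3 ∨ p = 5)
    (ℓ : M →+ ZMod p) (hℓ : ∀ x : M, IsRoot x → ℓ x ≠ 0) {α : M} (hα : IsRoot α) :
    ∃ (n : ℕ) (u : Fin n → M), IsBlock u ∧ (∃ i, u i = α) ∧ ∀ β : M, IsRoot β →
      β ∈ Submodule.span ℤ (Set.range u) ∨ ∀ i, ⟪(β : E), (u i : E)⟫_ℝ = 0 := by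
  have : NeZero p := ⟨by omega⟩
  by_contra! hcon
  -- If no block through `α` were saturated, blocks could be extended to any length, against
  -- `IsBlock.lt_of_label`.
  have hP (n : ℕ) : ∃ u : Fin (n + 1) → M, IsBlock u ∧ ∃ i, u i = α := by
    induction n with
    | zero =>
      refine ⟨fun _ => α, fun i j => ?_, 0, rfl⟩
      rw [if_pos (by omega)]
      exact hα
    | succ n ih =>
      obtain ⟨u, hu, i, hi⟩ := ih
      obtain ⟨β, hβ, hnot, hne⟩ := hcon _ u hu ⟨i, hi⟩
      obtain ⟨v, hv⟩ := hu.exists_cons hM hp ℓ hℓ hβ hnot hne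
      exact ⟨_, hv, i.succ, by simpa using hi⟩
  obtain ⟨u, hu, -⟩ := hP p
  have := hu.lt_of_label ℓ hℓ
  omega

end RootBlocks

theorem coe_mem_span_int {F : Type*} [AddCommGroup F] {M : Submodule ℤ F} {ι : Type*} {w : ι → M}
    {x : M} : (x : F) ∈ Submodule.span ℤ (Set.range fun i => (w i : F)) ↔
      x ∈ Submodule.span ℤ (Set.range w) := by
  have : (Set.range fun i => (w i : F)) = M.subtype '' Set.range w := by
    rw [← Set.range_comp]; rfl
  rw [this, Submodule.span_image]
  simp

/-! ### Orthogonal families of saturated blocks, and the distance of other vectors to them -/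

section Configurations

variable {E : Type*} [NormedAddCommGroup E] [InnerProductSpace ℝ E] {M : Submodule ℤ E}

/-- A family of mutually orthogonal saturated blocks. -/
structure IsConfig {κ : Type} {n : κ → ℕ} (u : (i : κ) → Fin (n i) → M) : Prop where
  isBlock : ∀ i, IsBlock (u i)
  orth : ∀ i j, i ≠ j → ∀ a b, ⟪(u i a : E), (u j b : E)⟫_ℝ = 0
  pos : ∀ i, 0 < n i
  sat : ∀ i (β : M), IsRoot β → β ∈ Submodule.span ℤ (Set.range (u i)) ∨
    ∀ a, ⟪(β : E), (u i a : E)⟫_ℝ = 0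

/-- All vectors of the blocks of a configuration. -/
def flat {κ : Type} {n : κ → ℕ} (u : (i : κ) → Fin (n i) → M) : (Σ i, Fin (n i)) → M :=
  fun x => u x.1 x.2

/-- This is the determinant of `A_n`: its Gram matrix on the vectors `e_i - e_0` is a rank-one
perturbation of the identity. -/
theorem det_one_add_ones (n : ℕ) :
    (Matrix.of fun i j : Fin n => if i = j then (2 : ℝ) else 1).det = n + 1 := by
  have h : (Matrix.of fun i j : Fin n => if i = j then (2 : ℝ) else 1) =
      (1 : Matrix (Fin n) (Fin n) ℝ) + Matrix.replicateCol Unit (fun _ => (1 : ℝ)) *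
        Matrix.replicateRow Unit (fun _ => (1 : ℝ)) := by
    ext i j
    by_cases hij : i = j
    · subst hij
      simp [Matrix.mul_apply]
      norm_num
    · simp [Matrix.mul_apply, hij]
  rw [h, Matrix.det_one_add_replicateCol_mul_replicateRow]
  simp [dotProduct, add_comm]

theorem IsConfig.inner_flat {κ : Type} [DecidableEq κ] {n : κ → ℕ}
    {u : (i : κ) → Fin (n i) → M} (hu : IsConfig u) (x y : Σ i, Fin (n i)) :
    ⟪(flat u x : E), (flat u y : E)⟫_ℝ = if x.1 = y.1 then (if x = y then 2 else 1) else 0 := by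
  obtain ⟨i, a⟩ := x
  obtain ⟨j, b⟩ := y
  by_cases hij : i = j
  · subst hij
    simp [flat, hu.isBlock i a b]
  · simp [flat, hij, hu.orth i j hij]

theorem IsConfig.det_gram {κ : Type} [Fintype κ] [DecidableEq κ] {n : κ → ℕ}
    {u : (i : κ) → Fin (n i) → M} (hu : IsConfig u) :
    (Matrix.gram ℝ fun x => (flat u x : E)).det = ∏ i, ((n i : ℝ) + 1) := by
  let _ : LinearOrder κ := LinearOrder.lift' (Fintype.equivFin κ) (Fintype.equivFin κ).injective
  have hbt : (Matrix.gram ℝ fun x => (flat u x : E)).BlockTriangular Sigma.fst := by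
    intro x y hxy
    have hne : x.1 ≠ y.1 := hxy.ne'
    rw [Matrix.gram_apply, hu.inner_flat, if_neg hne]
  have hdet := hbt.det_fintype
  convert hdet using 2 with i
  rw [← det_one_add_ones]
  refine (Matrix.det_submatrix_equiv_self
    (Equiv.sigmaSubtype (β := fun i => Fin (n i)) i) _).symm.trans ?_
  congr 1
  ext ⟨⟨i, a⟩, rfl⟩ ⟨⟨j, b⟩, hj⟩
  obtain rfl : j = i := hj
  rw [Matrix.submatrix_apply, Matrix.toSquareBlock_def]
  simp only [Matrix.of_apply, Matrix.gram_apply]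
  exact (hu.isBlock j a b).symm

theorem IsConfig.linearIndependent {κ : Type} [Finite κ] {n : κ → ℕ}
    {u : (i : κ) → Fin (n i) → M} (hu : IsConfig u) :
    LinearIndependent ℝ fun x => (flat u x : E) := by
  classical
  cases nonempty_fintype κ
  rw [← Matrix.det_gram_ne_zero_iff_linearIndependent, hu.det_gram]
  exact Finset.prod_ne_zero_iff.2 fun i _ => by positivity

theorem inner_eq_zero_of_mem_span_int {s : Set M} {x : E} (h : ∀ y ∈ s, ⟪x, (y : E)⟫_ℝ = 0) {y : M}
    (hy : y ∈ Submodule.span ℤ s) : ⟪x, (y : E)⟫_ℝ = 0 := by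
  induction hy using Submodule.span_induction with
  | mem y hy => exact h y hy
  | zero => simp
  | add y z _ _ hy hz => rw [Submodule.coe_add, inner_add_right, hy, hz, add_zero]
  | smul c y _ hy =>
    rw [Submodule.coe_smul, ← Int.cast_smul_eq_zsmul ℝ, inner_smul_right, hy, mul_zero]

/-- By saturation the new root `α` is orthogonal to all old blocks. A vector of the saturated block
through `α` has product `1` or `2` with `α`, so it lies in no old span and is, again by saturation,
orthogonal to the old blocks. -/
theorem IsConfig.exists_option (hM : IsEvenLattice M) {p : ℕ} (hp : p = 3 ∨ p = 5)
    (ℓ : M →+ ZMod p) (hℓ : ∀ x : M, IsRoot x → ℓ x ≠ 0) {κ : Type} {n : κ → ℕ}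
    {u : (i : κ) → Fin (n i) → M} (hu : IsConfig u) {α : M} (hα : IsRoot α)
    (hnot : α ∉ Submodule.span ℤ (Set.range (flat u))) :
    ∃ (n' : Option κ → ℕ) (u' : (i : Option κ) → Fin (n' i) → M), IsConfig u' := by
  obtain ⟨m, v, hv, ⟨a0, ha0⟩, hsat⟩ := exists_saturated_block hM hp ℓ hℓ hα
  have hαorth (i : κ) : ∀ a, ⟪(α : E), (u i a : E)⟫_ℝ = 0 := by
    refine (hu.sat i α hα).resolve_left fun h => hnot ?_
    refine Submodule.span_mono ?_ h
    rintro _ ⟨a, rfl⟩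
    exact ⟨⟨i, a⟩, rfl⟩
  have horth (i : κ) (b : Fin m) : ∀ a, ⟪(v b : E), (u i a : E)⟫_ℝ = 0 := by
    refine (hu.sat i (v b) (hv.isRoot b)).resolve_left fun h => ?_
    have h0 : ⟪(α : E), (v b : E)⟫_ℝ = 0 :=
      inner_eq_zero_of_mem_span_int (by rintro _ ⟨a, rfl⟩; exact hαorth i a) h
    rw [← ha0, hv a0 b] at h0
    split_ifs at h0 <;> norm_num at h0
  let n' : Option κ → ℕ
    | none => m
    | some i => n i
  let u' : (i : Option κ) → Fin (n' i) → M
    | none => v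
    | some i => u i
  refine ⟨n', u', ?_, ?_, ?_, ?_⟩
  · rintro (_ | i)
    · exact hv
    · exact hu.isBlock i
  · rintro (_ | i) (_ | j) hij a b
    · exact absurd rfl hij
    · exact horth j a b
    · rw [real_inner_comm]
      exact horth i b a
    · exact hu.orth i j (fun h => hij (by rw [h])) a b
  · rintro (_ | i)
    · exact a0.pos
    · exact hu.pos i
  · rintro (_ | i)
    · exact hsat
    · exact hu.sat i

/-- There is a configuration whose span contains all roots. -/
theorem exists_complete_config [FiniteDimensional ℝ E] (hM : IsEvenLattice M) {p : ℕ}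
    (hp : p = 3 ∨ p = 5) (ℓ : M →+ ZMod p) (hℓ : ∀ x : M, IsRoot x → ℓ x ≠ 0) :
    ∃ (κ : Type) (_ : Finite κ) (n : κ → ℕ) (u : (i : κ) → Fin (n i) → M), IsConfig u ∧
      ∀ β : M, IsRoot β → β ∈ Submodule.span ℤ (Set.range (flat u)) := by
  by_contra! hcon
  have h (s : ℕ) : ∃ (κ : Type) (_ : Finite κ) (n : κ → ℕ) (u : (i : κ) → Fin (n i) → M),
      IsConfig u ∧ Nat.card κ = s := by
    induction s with
    | zero =>
      refine ⟨Empty, inferInstance, fun _ => 0, fun i => i.elim, ⟨?_, ?_, ?_, ?_⟩, by simp⟩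
      all_goals rintro ⟨⟩
    | succ s ih =>
      obtain ⟨κ, _, n, u, hu, hs⟩ := ih
      obtain ⟨β, hβ, hnot⟩ := hcon κ inferInstance n u hu
      obtain ⟨n', u', hu'⟩ := hu.exists_option hM hp ℓ hℓ hβ hnot
      exact ⟨Option κ, inferInstance, n', u', hu', by rw [Finite.card_option, hs]⟩
  -- Each block contributes at least one vector to an independent family, so there cannot be more
  -- blocks than the rank.
  obtain ⟨κ, _, n, u, hu, hs⟩ := h (Module.finrank ℝ E + 1)
  cases nonempty_fintype κ
  have h1 := hu.linearIndependent.fintype_card_le_finrank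
  have h2 : Fintype.card κ ≤ Fintype.card (Σ i, Fin (n i)) :=
    Fintype.card_le_of_injective (fun i => ⟨i, ⟨0, hu.pos i⟩⟩) fun i j hij => congrArg Sigma.fst hij
  rw [Nat.card_eq_fintype_card] at hs
  omega

/-- Vectors reduced modulo a sublattice. -/
theorem exists_reduced (hM : IsEvenLattice M) (A : Submodule ℤ M) (x : M) :
    ∃ x' : M, x - x' ∈ A ∧ ∀ γ ∈ A, 2 * ⟪(x' : E), (γ : E)⟫_ℝ ≤ ⟪(γ : E), (γ : E)⟫_ℝ := by
  classical
  have hnat (y : M) : ∃ n : ℕ, ⟪(y : E), (y : E)⟫_ℝ = n := by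
    obtain ⟨m, hm⟩ := hM.even _ y.2
    have h0 : (0 : ℝ) ≤ 2 * m := hm ▸ real_inner_self_nonneg
    have : 0 ≤ m := by
      have : (0 : ℝ) ≤ m := by linarith
      exact_mod_cast this
    obtain ⟨n, rfl⟩ := Int.eq_ofNat_of_zero_le this
    exact ⟨2 * n, by rw [hm]; simp⟩
  -- Take a vector of least norm in the coset `x + A`; comparing it with its translate by `-γ` gives
  -- the inequality.
  have hex : ∃ n : ℕ, ∃ y : M, x - y ∈ A ∧ ⟪(y : E), (y : E)⟫_ℝ = n := by
    obtain ⟨n, hn⟩ := hnat x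
    exact ⟨n, x, by simp, hn⟩
  obtain ⟨y, hy, hyn⟩ := Nat.find_spec hex
  refine ⟨y, hy, fun γ hγ => ?_⟩
  obtain ⟨n, hn⟩ := hnat (y - γ)
  have hle : Nat.find hex ≤ n := Nat.find_le ⟨y - γ, by
    rw [show x - (y - γ) = (x - y) + γ by abel]
    exact A.add_mem hy hγ, hn⟩
  have hle' : (Nat.find hex : ℝ) ≤ n := by exact_mod_cast hle
  rw [← hyn, ← hn, Submodule.coe_sub, inner_sub_left, inner_sub_right, inner_sub_right,
    real_inner_comm (y : E) (γ : E)] at hle'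
  linarith

/-- The contribution of one block to the norm of a projection. -/
theorem block_projection_bound {n : ℕ} (a : Fin n → ℝ) (hint : ∀ i, ∃ m : ℤ, a i = m)
    (h1 : ∀ i, a i ≤ 1) (h2 : ∀ i, -1 ≤ a i) (h3 : ∀ i j, a i - a j ≤ 1) :
    ∑ i, a i ^ 2 - (∑ i, a i) ^ 2 / (n + 1) ≤ (n + 1) / 4 := by
  -- The entries are `0` and `1`, or `0` and `-1`. With `s` the absolute value of their sum, the
  -- quantity is `s - s ^ 2 / (n + 1)`, maximal at `s = (n + 1) / 2`.
  have hsq : ∑ i, a i ^ 2 = ∑ i, a i ∨ ∑ i, a i ^ 2 = -∑ i, a i := by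
    by_cases hneg : ∃ i, a i = -1
    · obtain ⟨i, hi⟩ := hneg
      right
      rw [← Finset.sum_neg_distrib]
      refine Finset.sum_congr rfl fun j _ => ?_
      obtain ⟨m, hm⟩ := hint j
      rcases int_cast_eq_zero_or_one (x := -a j) ⟨-m, by simp [hm]⟩
        (by linarith [h3 j i]) (by linarith [h2 j]) with h | h
      · have : a j = 0 := by linarith
        simp [this]
      · have : a j = -1 := by linarith
        simp [this]
    · left
      push Not at hneg
      refine Finset.sum_congr rfl fun j _ => ?_
      rcases int_cast_eq_zero_or_one (hint j) (lt_of_le_of_ne (h2 j) (hneg j).symm) (h1 j)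
        with h | h <;> simp [h]
  have hn : (0 : ℝ) < n + 1 := by positivity
  rw [sub_le_iff_le_add, ← sub_le_iff_le_add', le_div_iff₀ hn]
  rcases hsq with h | h <;> rw [h]
  · nlinarith [sq_nonneg (∑ i, a i - (n + 1) / 2)]
  · nlinarith [sq_nonneg (∑ i, a i + (n + 1) / 2)]

/-- If `y` is the orthogonal projection of `x` to a subspace containing `v`, then `v` is at least
as far from `x` as `y`. -/
theorem norm_sq_sub_inner_le {s : Set E} {x y v : E} (hy : y ∈ Submodule.span ℝ s)
    (h : ∀ z ∈ s, ⟪x, z⟫_ℝ = ⟪y, z⟫_ℝ) (hv : v ∈ Submodule.span ℝ s) :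
    ⟪x, x⟫_ℝ - ⟪x, y⟫_ℝ ≤ ‖x - v‖ ^ 2 := by
  have h' : ∀ z ∈ Submodule.span ℝ s, ⟪x, z⟫_ℝ = ⟪y, z⟫_ℝ := by
    intro z hz
    induction hz using Submodule.span_induction with
    | mem z hz => exact h z hz
    | zero => simp
    | add z w _ _ hz hw => rw [inner_add_right, inner_add_right, hz, hw]
    | smul c z _ hz => rw [inner_smul_right, inner_smul_right, hz]
  have h1 := h' v hv
  have h2 := h' y hy
  have h3 : 0 ≤ ⟪y - v, y - v⟫_ℝ := real_inner_self_nonneg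
  rw [← real_inner_self_eq_norm_sq]
  simp only [inner_sub_left, inner_sub_right] at h3 ⊢
  rw [real_inner_comm x v, h1, h2]
  rw [real_inner_comm y v] at h3
  linarith

/-- A vector reduced modulo the blocks has product at most `1` with every root of a block, so
`block_projection_bound` controls its projection to each block; the blocks being orthogonal, these
contributions add up. -/
theorem IsConfig.sub_le_norm_sub_sq {κ : Type} [Fintype κ] {n : κ → ℕ}
    (hM : IsEvenLattice M)
    {u : (i : κ) → Fin (n i) → M} (hu : IsConfig u) (x : M)
    (hx : ∀ γ ∈ Submodule.span ℤ (Set.range (flat u)),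
      2 * ⟪(x : E), (γ : E)⟫_ℝ ≤ ⟪(γ : E), (γ : E)⟫_ℝ) (v : E)
    (hv : v ∈ Submodule.span ℝ (Set.range fun y => (flat u y : E))) :
    ⟪(x : E), (x : E)⟫_ℝ - ∑ i, ((n i : ℝ) + 1) / 4 ≤ ‖(x : E) - v‖ ^ 2 := by
  classical
  have hmem (i : κ) (a : Fin (n i)) : u i a ∈ Submodule.span ℤ (Set.range (flat u)) :=
    Submodule.subset_span ⟨⟨i, a⟩, rfl⟩
  have hroot {γ : M} (hγ : γ ∈ Submodule.span ℤ (Set.range (flat u))) (hr : IsRoot γ) :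
      ⟪(x : E), (γ : E)⟫_ℝ ≤ 1 := by
    have := hx γ hγ
    rw [show ⟪(γ : E), (γ : E)⟫_ℝ = 2 from hr] at this
    linarith
  have hb (i : κ) := block_projection_bound (fun a => ⟪(x : E), (u i a : E)⟫_ℝ)
    (fun a => hM.exists_inner_eq x.2 (u i a).2)
    (fun a => hroot (hmem i a) ((hu.isBlock i).isRoot a))
    (fun a => by
      have := hroot (Submodule.neg_mem _ (hmem i a)) ((hu.isBlock i).isRoot a).neg
      rw [Submodule.coe_neg, inner_neg_right] at this
      linarith)
    (fun a b => by
      by_cases hab : a = b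
      · subst hab; simp
      · have := hroot (Submodule.sub_mem _ (hmem i a) (hmem i b))
          ((hu.isBlock i).isRoot_sub hab)
        rwa [Submodule.coe_sub, inner_sub_right] at this)
  -- Coefficients of the orthogonal projection of `x`: the Gram matrix `1 + J` of a block, with `J`
  -- the all-ones matrix, has inverse `1 - J / (n + 1)`.
  let c : (i : κ) → Fin (n i) → ℝ := fun i a =>
    ⟪(x : E), (u i a : E)⟫_ℝ - (∑ b, ⟪(x : E), (u i b : E)⟫_ℝ) / (n i + 1)
  let y : E := ∑ i, ∑ a, c i a • (u i a : E)
  have hy : y ∈ Submodule.span ℝ (Set.range fun y => (flat u y : E)) :=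
    Submodule.sum_mem _ fun i _ => Submodule.sum_mem _ fun a _ =>
      Submodule.smul_mem _ _ (Submodule.subset_span ⟨⟨i, a⟩, rfl⟩)
  have hxy : ∀ z ∈ Set.range fun y => (flat u y : E), ⟪(x : E), z⟫_ℝ = ⟪y, z⟫_ℝ := by
    rintro _ ⟨⟨j, b⟩, rfl⟩
    change ⟪(x : E), (u j b : E)⟫_ℝ = ⟪y, (u j b : E)⟫_ℝ
    simp only [y, sum_inner, inner_smul_left, RCLike.conj_to_real]
    rw [Finset.sum_eq_single j]
    · have (a : Fin (n j)) : c j a * ⟪(u j a : E), (u j b : E)⟫_ℝ =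
          c j a + if a = b then c j b else 0 := by
        rw [hu.isBlock j a b]
        split_ifs with h
        · subst h; ring
        · ring
      simp_rw [this]
      rw [Finset.sum_add_distrib, Finset.sum_ite_eq' Finset.univ b, if_pos (Finset.mem_univ _)]
      simp only [c, Finset.sum_sub_distrib, Finset.sum_const, Finset.card_univ, Fintype.card_fin,
        nsmul_eq_mul]
      have : ((n j : ℝ) + 1) ≠ 0 := by positivity
      field_simp
      ring
    · intro i _ hij
      exact Finset.sum_eq_zero fun a _ => by rw [hu.orth i j hij, mul_zero]
    · simp
  have hle := norm_sq_sub_inner_le hy hxy hv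
  have hinner : ⟪(x : E), y⟫_ℝ ≤ ∑ i, ((n i : ℝ) + 1) / 4 := by
    simp only [y, inner_sum, inner_smul_right]
    refine Finset.sum_le_sum fun i _ => le_trans (le_of_eq ?_) (hb i)
    simp only [c, sub_mul, Finset.sum_sub_distrib, ← Finset.mul_sum]
    simp_rw [← pow_two]
    ring
  linarith

/-- A reduced representative of norm less than `4` is zero or a root, hence in the span of the
blocks; one of norm at least `4` stays far from it. -/
theorem IsConfig.separation {κ : Type} [Fintype κ] {n : κ → ℕ}
    (hM : IsEvenLattice M)
    {u : (i : κ) → Fin (n i) → M} (hu : IsConfig u)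
    (hroots : ∀ β : M, IsRoot β → β ∈ Submodule.span ℤ (Set.range (flat u))) (x : E) (hx : x ∈ M) :
    x ∈ Submodule.span ℤ (Set.range fun y => (flat u y : E)) ∨
      ∀ v ∈ Submodule.span ℝ (Set.range fun y => (flat u y : E)),
        4 - ∑ i, ((n i : ℝ) + 1) / 4 ≤ ‖x - v‖ ^ 2 := by
  obtain ⟨x', hx', hred⟩ := exists_reduced hM (Submodule.span ℤ (Set.range (flat u))) ⟨x, hx⟩
  by_cases h4 : 4 ≤ ⟪(x' : E), (x' : E)⟫_ℝ
  · right
    intro v hv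
    have hd : x - x' ∈ Submodule.span ℝ (Set.range fun y => (flat u y : E)) :=
      Submodule.span_le_restrictScalars ℤ ℝ _ (coe_mem_span_int.2 hx')
    have := hu.sub_le_norm_sub_sq hM x' hred _ (Submodule.sub_mem _ hv hd)
    rw [show (x' : E) - (v - (x - x')) = x - v by abel] at this
    linarith
  · left
    have : x' ∈ Submodule.span ℤ (Set.range (flat u)) := by
      by_cases h0 : x' = 0
      · rw [h0]; exact Submodule.zero_mem _
      · refine hroots _ ?_
        have h2 := hM.two_le_norm h0
        obtain ⟨m, hm⟩ := hM.even _ x'.2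
        rw [hm] at h4 h2
        have h4' : m < 2 := by
          have : (m : ℝ) < 2 := by linarith
          exact_mod_cast this
        have h2' : 1 ≤ m := by
          have : (1 : ℝ) ≤ m := by linarith
          exact_mod_cast this
        obtain rfl : m = 1 := by omega
        rw [IsRoot, hm]
        norm_num
    have := Submodule.add_mem _ hx' this
    rw [sub_add_cancel] at this
    exact coe_mem_span_int.2 this

end Configurations

/-! ### The roots have full rank and form copies of `A_{p-1}` -/

section FullRank

variable {E : Type*} [NormedAddCommGroup E] [InnerProductSpace ℝ E] {M : Submodule ℤ E}

/-- If nonzero vectors reduced modulo the span of `u` are far from its real span, then so are all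
other vectors. -/
theorem separation_of_reduced (hM : IsEvenLattice M) {κ : Type} (u : κ → M) (μ : ℝ)
    (h : ∀ x : M, x ≠ 0 → (∀ γ ∈ Submodule.span ℤ (Set.range u),
      2 * ⟪(x : E), (γ : E)⟫_ℝ ≤ ⟪(γ : E), (γ : E)⟫_ℝ) →
      ∀ v ∈ Submodule.span ℝ (Set.range fun y => (u y : E)), μ ≤ ‖(x : E) - v‖ ^ 2)
    (x : E) (hx : x ∈ M) : x ∈ Submodule.span ℤ (Set.range fun y => (u y : E)) ∨
      ∀ v ∈ Submodule.span ℝ (Set.range fun y => (u y : E)), μ ≤ ‖x - v‖ ^ 2 := by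
  obtain ⟨x', hx', hred⟩ := exists_reduced hM (Submodule.span ℤ (Set.range u)) ⟨x, hx⟩
  by_cases h0 : x' = 0
  · left
    rw [h0, sub_zero] at hx'
    exact coe_mem_span_int.2 hx'
  · right
    intro v hv
    have hd : x - x' ∈ Submodule.span ℝ (Set.range fun y => (u y : E)) :=
      Submodule.span_le_restrictScalars ℤ ℝ _ (coe_mem_span_int.2 hx')
    have := h x' h0 hred _ (Submodule.sub_mem _ hv hd)
    rwa [show (x' : E) - (v - (x - x')) = x - v by abel] at this

theorem IsEvenLattice.norm_eq_two_or_four_or_le (hM : IsEvenLattice M) {x : M} (hx : x ≠ 0) :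
    ⟪(x : E), (x : E)⟫_ℝ = 2 ∨ ⟪(x : E), (x : E)⟫_ℝ = 4 ∨ 6 ≤ ⟪(x : E), (x : E)⟫_ℝ := by
  have h2 := hM.two_le_norm hx
  obtain ⟨m, hm⟩ := hM.even _ x.2
  rw [hm] at h2 ⊢
  have h2' : 1 ≤ m := by
    have : (1 : ℝ) ≤ m := by linarith
    exact_mod_cast this
  obtain rfl | rfl | h : m = 1 ∨ m = 2 ∨ 3 ≤ m := by omega
  · left; norm_num
  · right; left; norm_num
  · right; right
    have : (3 : ℝ) ≤ m := by exact_mod_cast h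
    linarith

/-- An even lattice of rank `8` and determinant `25` has roots. -/
theorem exists_root_of_card_res [FiniteDimensional ℝ E] (hM : IsEvenLattice M)
    (hN : Module.finrank ℝ E = 8) (hd : Nat.card (Res M) = 25) : ∃ x : M, IsRoot x := by
  by_contra! hno
  -- Hermite's inequality with minimum `4` alone is not enough, since `4^8 (3/4)^28 < 25`. A
  -- sublattice is therefore enlarged to rank one and then two, and the relative inequality gives a
  -- contradiction wherever this cannot continue, and at rank two.
  have hnorm {x : M} (hx : x ≠ 0) :
      ⟪(x : E), (x : E)⟫_ℝ = 4 ∨ 6 ≤ ⟪(x : E), (x : E)⟫_ℝ :=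
    (hM.norm_eq_two_or_four_or_le hx).resolve_left (hno x)
  -- a vector of norm 4
  obtain ⟨w, hw⟩ : ∃ w : M, ⟪(w : E), (w : E)⟫_ℝ = 4 := by
    by_contra! hcon
    have := det_gram_mul_le_card_res hM 8 (fun i : Fin 0 => ((i.elim0 : M) : E))
      (fun i => i.elim0) (linearIndependent_empty_type) (by simp [hN]) 6 (by norm_num)
      (separation_of_reduced hM (fun i : Fin 0 => (i.elim0 : M)) 6 (by
        intro x hx _ v hv
        have hv0 : v = 0 := by simpa using hv
        rw [hv0, sub_zero, ← real_inner_self_eq_norm_sq]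
        exact (hnorm hx).resolve_left (hcon x)))
    rw [hd, Matrix.det_isEmpty, show Nat.choose 8 2 = 28 by rfl] at this
    norm_num at this
  have hw0 : (w : E) ≠ 0 := by
    intro h
    rw [h, inner_zero_left] at hw
    norm_num at hw
  -- a second one having inner product 2 with it
  obtain ⟨y, hy, hwy⟩ : ∃ y : M, ⟪(y : E), (y : E)⟫_ℝ = 4 ∧ ⟪(w : E), (y : E)⟫_ℝ = 2 := by
    by_contra! hcon
    have := det_gram_mul_le_card_res hM 7 (fun _ : Fin 1 => (w : E)) (fun _ => w.2)
      (by simpa using hw0)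
      (by simp [hN]) (15 / 4) (by norm_num)
      (separation_of_reduced hM (fun _ : Fin 1 => w) (15 / 4) (by
        intro x hx hred v hv
        have hwmem : w ∈ Submodule.span ℤ (Set.range fun _ : Fin 1 => w) :=
          Submodule.subset_span ⟨0, rfl⟩
        have h1 := hred w hwmem
        have h2 := hred (-w) (Submodule.neg_mem _ hwmem)
        simp only [Submodule.coe_neg, inner_neg_left, inner_neg_right, neg_neg, hw] at h1 h2
        obtain ⟨a, ha⟩ := hM.exists_inner_eq x.2 w.2
        have hle := norm_sq_sub_inner_le (x := (x : E)) (y := ((a : ℝ) / 4) • (w : E))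
          (s := Set.range fun _ : Fin 1 => (w : E))
          (Submodule.smul_mem _ _ (Submodule.subset_span ⟨0, rfl⟩)) (by
            rintro _ ⟨i, rfl⟩
            rw [inner_smul_left, hw, ha]
            simp) hv
        rw [inner_smul_right, ha] at hle
        rw [ha] at h1 h2
        have h1' : a ≤ 2 := by
          have : (a : ℝ) ≤ 2 := by linarith
          exact_mod_cast this
        have h2' : -2 ≤ a := by
          have : (-2 : ℝ) ≤ a := by linarith
          exact_mod_cast this
        rcases hnorm hx with h4 | h6
        · have hne2 : a ≠ 2 := by
            rintro rfl
            refine hcon x h4 ?_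
            rw [real_inner_comm, ha]; norm_num
          have hnem2 : a ≠ -2 := by
            rintro rfl
            refine hcon (-x) (by simpa using h4) ?_
            rw [Submodule.coe_neg, inner_neg_right, real_inner_comm, ha]; norm_num
          have hsq : a * a ≤ 1 := by
            have h3 : a ≤ 1 := by omega
            have h4 : -1 ≤ a := by omega
            nlinarith
          have hsq' : (a : ℝ) * a ≤ 1 := by exact_mod_cast hsq
          rw [h4] at hle
          linarith
        · have hsq : a * a ≤ 4 := by nlinarith
          have hsq' : (a : ℝ) * a ≤ 4 := by exact_mod_cast hsq
          linarith))
    rw [hd, Matrix.det_unique, Matrix.gram_apply, hw, show Nat.choose 7 2 = 21 by rfl] at this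
    norm_num at this
  -- both span a copy of `√2 A₂`
  have hdet : (Matrix.gram ℝ fun i => (![w, y] i : E)).det = 12 := by
    rw [Matrix.det_fin_two]
    simp only [Matrix.gram_apply, Matrix.cons_val_zero, Matrix.cons_val_one]
    rw [hw, hy, real_inner_comm (w : E) (y : E), hwy]
    norm_num
  have := det_gram_mul_le_card_res hM 6 (fun i => (![w, y] i : E)) (fun i => (![w, y] i).2)
    (Matrix.det_gram_ne_zero_iff_linearIndependent.1 (by rw [hdet]; norm_num))
    (by simp [hN]) (8 / 3) (by norm_num)
    (separation_of_reduced hM ![w, y] (8 / 3) (by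
      intro x hx hred v hv
      have hwmem : w ∈ Submodule.span ℤ (Set.range ![w, y]) := Submodule.subset_span ⟨0, rfl⟩
      have hymem : y ∈ Submodule.span ℤ (Set.range ![w, y]) := Submodule.subset_span ⟨1, rfl⟩
      have h1 := hred w hwmem
      have h2 := hred (-w) (Submodule.neg_mem _ hwmem)
      have h3 := hred y hymem
      have h4 := hred (-y) (Submodule.neg_mem _ hymem)
      have h5 := hred (w - y) (Submodule.sub_mem _ hwmem hymem)
      have h6 := hred (y - w) (Submodule.sub_mem _ hymem hwmem)
      have hyw := real_inner_comm (w : E) (y : E)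
      rw [hwy] at hyw
      simp only [Submodule.coe_neg, Submodule.coe_sub, inner_sub_left, inner_sub_right,
        inner_neg_left, inner_neg_right, neg_neg, hw, hy, hwy, hyw] at h1 h2 h3 h4 h5 h6
      set a := ⟪(x : E), (w : E)⟫_ℝ with ha
      set b := ⟪(x : E), (y : E)⟫_ℝ with hb
      -- The coefficients invert the Gram matrix with diagonal `4` and off-diagonal `2`; the
      -- projection of `x` has squared norm `(a^2 - a b + b^2) / 3`.
      have hle := norm_sq_sub_inner_le (x := (x : E))
        (y := ((2 * a - b) / 6) • (w : E) + ((2 * b - a) / 6) • (y : E))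
        (s := Set.range fun i => (![w, y] i : E))
        (Submodule.add_mem _ (Submodule.smul_mem _ _ (Submodule.subset_span ⟨0, rfl⟩))
          (Submodule.smul_mem _ _ (Submodule.subset_span ⟨1, rfl⟩))) (by
          rintro _ ⟨i, rfl⟩
          fin_cases i
          · simp only [Fin.zero_eta, Matrix.cons_val_zero, inner_add_left, inner_smul_left, hw, hyw,
              RCLike.conj_to_real, ← ha]
            ring
          · change ⟪(x : E), (y : E)⟫_ℝ = ⟪_, (y : E)⟫_ℝ
            simp only [inner_add_left, inner_smul_left, hy, hwy, RCLike.conj_to_real, ← hb]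
            ring) hv
      rw [inner_add_right, inner_smul_right, inner_smul_right, ← ha, ← hb] at hle
      -- Reducedness says `|a|, |b|, |a - b| ≤ 2`. On this hexagon the form is at most `4`, which
      -- leaves the distance `4 - 4/3 = 8/3`.
      have hq : a ^ 2 - a * b + b ^ 2 ≤ 4 := by
        rcases le_total 0 (a * b) with hab | hab
        · rcases le_or_gt 0 (b * (a - b)) with h | h
          · nlinarith
          · have hb2 : 0 < b ^ 2 := by nlinarith
            have h7 : 0 ≤ (a * (b - a)) * b ^ 2 := by
              have := mul_nonneg hab (neg_nonneg.2 h.le)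
              linarith
            have h8 : 0 ≤ a * (b - a) := nonneg_of_mul_nonneg_left h7 hb2
            nlinarith
        · nlinarith
      have hx4 : 4 ≤ ⟪(x : E), (x : E)⟫_ℝ := by
        rcases hnorm hx with h | h <;> linarith
      nlinarith))
  rw [hd, hdet, show Nat.choose 6 2 = 15 by rfl] at this
  norm_num at this

/-- Replaces the product by a bound depending only on the number of blocks and on the excess `∑ (n i
- 1)`, so that Hermite's inequality need only be tested on pairs of small integers. -/
theorem prod_succ_ge {κ : Type} [Fintype κ] (n : κ → ℕ) (c : ℝ) (hc : 0 < c)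
    (h : ∀ i, 2 * c ^ (n i - 1) ≤ (n i : ℝ) + 1) :
    2 ^ Fintype.card κ * c ^ (∑ i, (n i - 1)) ≤ ∏ i, ((n i : ℝ) + 1) := by
  calc 2 ^ Fintype.card κ * c ^ (∑ i, (n i - 1)) = ∏ i, 2 * c ^ (n i - 1) := by
        rw [Finset.prod_mul_distrib, Finset.prod_pow_eq_pow_sum, Finset.prod_const,
          Finset.card_univ]
    _ ≤ _ := Finset.prod_le_prod (fun i _ => by positivity) fun i _ => h i

/-- Here `t` is the number of blocks and `e` the excess; `19/14` lies just below the cube root of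
`5/2`, so that `2 c^(n-1) ≤ n + 1` for `1 ≤ n ≤ 4`. The inequality fails for `t = 0`, which is why
`exists_root_of_card_res` is needed. -/
theorem hermite_numeric_five (t e : ℕ) (het : e ≤ 3 * t) (ht : 0 < t) (hlt : e + t < 8) :
    (25 : ℝ) < 2 ^ t * (19 / 14) ^ e * (4 - ((e : ℝ) + 2 * t) / 4) ^ (8 - (e + t)) *
      (3 / 4) ^ ((8 - (e + t)).choose 2) := by
  have h1 : t ≤ 7 := by omega
  have h2 : e ≤ 6 := by omega
  interval_cases t <;> interval_cases e <;> first | omega | norm_num [Nat.choose]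

/-- The constant `3/2` is exact for blocks of length `1` and `2`. Here `t = 0` causes no trouble. -/
theorem hermite_numeric_three (t e : ℕ) (het : e ≤ t) (hlt : e + t < 6) :
    (27 : ℝ) < 2 ^ t * (3 / 2) ^ e * (4 - ((e : ℝ) + 2 * t) / 4) ^ (6 - (e + t)) *
      (3 / 4) ^ ((6 - (e + t)).choose 2) := by
  have h1 : t ≤ 5 := by omega
  have h2 : e ≤ 5 := by omega
  interval_cases t <;> interval_cases e <;> first | omega | norm_num [Nat.choose]

theorem hermite_numeric {p k : ℕ} (hpk : (p = 5 ∧ k = 2) ∨ (p = 3 ∧ k = 3)) {κ : Type} [Fintype κ]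
    (n : κ → ℕ) (hpos : ∀ i, 0 < n i) (hlt : ∀ i, n i < p) (hne : p = 5 → Nonempty κ)
    (hr : ∑ i, n i < k * (p - 1)) :
    0 < 4 - ∑ i, ((n i : ℝ) + 1) / 4 ∧
    (p : ℝ) ^ k < (∏ i, ((n i : ℝ) + 1)) * (4 - ∑ i, ((n i : ℝ) + 1) / 4) ^ (k * (p - 1) - ∑ i, n i) *
      (3 / 4) ^ ((k * (p - 1) - ∑ i, n i).choose 2) := by
  set t := Fintype.card κ with ht
  set e := ∑ i, (n i - 1) with he
  have hsum : ∑ i, n i = e + t := by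
    rw [he, ht, ← Finset.card_univ, Finset.card_eq_sum_ones, ← Finset.sum_add_distrib]
    exact Finset.sum_congr rfl fun i _ => by have := hpos i; omega
  have hmu : ∑ i, ((n i : ℝ) + 1) / 4 = ((e : ℝ) + 2 * t) / 4 := by
    rw [← Finset.sum_div, Finset.sum_add_distrib, ← Nat.cast_sum, hsum]
    simp
    ring
  have hbound (m : ℕ) (hm : ∀ i, n i - 1 ≤ m) : e ≤ m * t := by
    rw [mul_comm, he, ht, ← Finset.card_univ, ← smul_eq_mul]
    exact Finset.sum_le_card_nsmul _ _ _ fun i _ => hm i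
  rw [hsum] at hr ⊢
  rw [hmu]
  have hcast : (e : ℝ) + t + 1 ≤ (k * (p - 1) : ℕ) := by exact_mod_cast hr
  rcases hpk with ⟨rfl, rfl⟩ | ⟨rfl, rfl⟩
  · have het : e ≤ 3 * t := hbound 3 fun i => by have := hlt i; omega
    have ht0 : 0 < t := Fintype.card_pos_iff.2 (hne rfl)
    have hμ : 0 < 4 - ((e : ℝ) + 2 * t) / 4 := by
      norm_num at hcast
      have : (0 : ℝ) ≤ e := by positivity
      linarith
    refine ⟨hμ, lt_of_lt_of_le ?_ (mul_le_mul_of_nonneg_right (mul_le_mul_of_nonneg_right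
      (prod_succ_ge n (19 / 14) (by norm_num) fun i => ?_) (by positivity)) (by positivity))⟩
    · have := hermite_numeric_five t e het ht0 hr
      norm_num at this ⊢
      exact this
    · have h1 := hpos i
      have h2 := hlt i
      interval_cases n i <;> norm_num
  · have het : e ≤ 1 * t := hbound 1 fun i => by have := hlt i; omega
    have hμ : 0 < 4 - ((e : ℝ) + 2 * t) / 4 := by
      norm_num at hcast
      have : (0 : ℝ) ≤ e := by positivity
      linarith
    refine ⟨hμ, lt_of_lt_of_le ?_ (mul_le_mul_of_nonneg_right (mul_le_mul_of_nonneg_right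
      (prod_succ_ge n (3 / 2) (by norm_num) fun i => ?_) (by positivity)) (by positivity))⟩
    · have := hermite_numeric_three t e (by omega) hr
      norm_num at this ⊢
      exact this
    · have h1 := hpos i
      have h2 := hlt i
      interval_cases n i <;> norm_num

/-- A factor `n i + 1 ≤ p` is divisible by `p` only if it equals `p`. At least `k` factors are thus
equal to `p`, and these already use up the whole rank. -/
theorem eq_of_pow_dvd_prod {p k : ℕ} (hp : p.Prime) {κ : Type} [Fintype κ] (n : κ → ℕ)
    (hpos : ∀ i, 0 < n i) (hlt : ∀ i, n i < p) (hsum : ∑ i, n i = k * (p - 1))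
    (hdvd : p ^ k ∣ ∏ i, (n i + 1)) : (∀ i, n i = p - 1) ∧ Fintype.card κ = k := by
  classical
  have hp1 := hp.one_lt
  let S : Finset κ := Finset.univ.filter fun i => n i = p - 1
  let S' : Finset κ := Finset.univ.filter fun i => ¬ n i = p - 1
  have hprod : ∏ i, (n i + 1) = p ^ S.card * ∏ i ∈ S', (n i + 1) := by
    rw [← Finset.prod_filter_mul_prod_filter_not Finset.univ fun i => n i = p - 1]
    congr 1
    rw [← Finset.prod_const]
    refine Finset.prod_congr rfl fun i hi => ?_
    rw [(Finset.mem_filter.1 hi).2]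
    omega
  have hcop : Nat.Coprime (p ^ k) (∏ i ∈ S', (n i + 1)) := by
    refine Nat.Coprime.pow_left _ (Nat.Coprime.prod_right fun i hi => ?_)
    have h1 := (Finset.mem_filter.1 hi).2
    have h2 := hlt i
    exact hp.coprime_iff_not_dvd.2 (Nat.not_dvd_of_pos_of_lt (by omega) (by omega))
  rw [hprod] at hdvd
  have hk : k ≤ S.card :=
    (Nat.pow_dvd_pow_iff_le_right hp1).1 (hcop.dvd_of_dvd_mul_right hdvd)
  have hsplit : ∑ i, n i = S.card * (p - 1) + ∑ i ∈ S', n i := by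
    rw [← Finset.sum_filter_add_sum_filter_not Finset.univ fun i => n i = p - 1]
    congr 1
    rw [← smul_eq_mul, ← Finset.sum_const]
    exact Finset.sum_congr rfl fun i hi => (Finset.mem_filter.1 hi).2
  have hmul : k * (p - 1) ≤ S.card * (p - 1) := Nat.mul_le_mul_right _ hk
  have hS' : ∑ i ∈ S', n i = 0 := by omega
  have hall : ∀ i, n i = p - 1 := by
    intro i
    by_contra hi
    have := Finset.sum_eq_zero_iff.1 hS' i (Finset.mem_filter.2 ⟨Finset.mem_univ _, hi⟩)
    have := hpos i
    omega
  refine ⟨hall, ?_⟩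
  simp only [hall, Finset.sum_const, Finset.card_univ, smul_eq_mul] at hsum
  exact Nat.eq_of_mul_eq_mul_right (by omega) hsum

open Matrix in
/-- A labelled even lattice of the right determinant is a sum of root lattices `A_{p-1}`. -/
theorem exists_full_config [FiniteDimensional ℝ E] (hM : IsEvenLattice M) {p k : ℕ}
    (hpk : (p = 5 ∧ k = 2) ∨ (p = 3 ∧ k = 3)) (ℓ : M →+ ZMod p)
    (hℓ : ∀ x : M, IsRoot x → ℓ x ≠ 0) (hN : Module.finrank ℝ E = k * (p - 1))
    (hd : Nat.card (Res M) = p ^ k) :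
    ∃ u : Fin k → Fin (p - 1) → M, (∀ i, IsBlock (u i)) ∧
      (∀ i j, i ≠ j → ∀ a b, ⟪(u i a : E), (u j b : E)⟫_ℝ = 0) ∧
      Submodule.span ℤ (Set.range fun x : Fin k × Fin (p - 1) => u x.1 x.2) = ⊤ := by
  classical
  have hp : p = 3 ∨ p = 5 := by omega
  have hprime : p.Prime := by rcases hp with rfl | rfl <;> norm_num
  have : NeZero p := ⟨hprime.ne_zero⟩
  obtain ⟨κ, _, n, u, hu, hroots⟩ := exists_complete_config hM hp ℓ hℓ
  cases nonempty_fintype κ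
  have hlt (i : κ) : n i < p := (hu.isBlock i).lt_of_label ℓ hℓ
  have hcard : Fintype.card (Σ i, Fin (n i)) = ∑ i, n i := by simp
  have hle : ∑ i, n i ≤ k * (p - 1) := by
    rw [← hcard, ← hN]
    exact hu.linearIndependent.fintype_card_le_finrank
  -- Otherwise Hermite's inequality relative to the blocks makes the determinant of `M` larger than
  -- `p ^ k`.
  have hsum : ∑ i, n i = k * (p - 1) := by
    by_contra hne
    have hr : ∑ i, n i < k * (p - 1) := lt_of_le_of_ne hle hne
    obtain ⟨hμ, hnum⟩ := hermite_numeric hpk n hu.pos hlt (by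
      intro h5
      by_contra hκ
      rw [not_nonempty_iff] at hκ
      obtain ⟨rfl, rfl⟩ : p = 5 ∧ k = 2 := by omega
      obtain ⟨x, hx⟩ := exists_root_of_card_res hM hN hd
      have hmem := hroots x hx
      have hempty : Set.range (flat u) = ∅ := by
        rw [Set.range_eq_empty_iff]
        infer_instance
      rw [hempty, Submodule.span_empty, Submodule.mem_bot] at hmem
      rw [hmem] at hx
      simp [IsRoot] at hx) hr
    have := det_gram_mul_le_card_res hM (k * (p - 1) - ∑ i, n i) (fun x => (flat u x : E))
      (fun x => (flat u x).2) hu.linearIndependent (by rw [hcard, hN]; omega) _ hμ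
      (hu.separation hM hroots)
    rw [hu.det_gram, hd] at this
    push_cast at this
    linarith
  obtain ⟨b0, hb0⟩ := exists_latticeBasis hM
  let e : (Σ i, Fin (n i)) ≃ Fin (Module.finrank ℝ E) :=
    Fintype.equivFinOfCardEq (by rw [hcard, hsum, hN])
  have hb : IsLatticeBasis M (b0 ∘ e) := by
    refine ⟨hb0.linearIndependent.comp _ e.injective, ?_⟩
    rw [Set.range_comp, e.range_eq_univ, Set.image_univ]
    exact hb0.span_eq
  have hA : IsLatticeBasis (Submodule.span ℤ (Set.range fun x => (flat u x : E)))
      (fun x => (flat u x : E)) := ⟨hu.linearIndependent, rfl⟩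
  have hAM : Submodule.span ℤ (Set.range fun x => (flat u x : E)) ≤ M := by
    refine Submodule.span_le.2 ?_
    rintro _ ⟨x, rfl⟩
    exact (flat u x).2
  -- This reads `∏ (n i + 1) = r ^ 2 * p ^ k` with `r` the index of the root blocks in `M`; once all
  -- `n i = p - 1`, it gives `r = 1`.
  have hdet := det_gram_sublattice hAM hA hb
  set r := (Submodule.span ℤ (Set.range fun x => (flat u x : E))).toAddSubgroup.relIndex
    M.toAddSubgroup with hr
  rw [hu.det_gram, card_res_eq_det_gram hM hb, hd] at hdet
  have hdet' : ∏ i, (n i + 1) = r ^ 2 * p ^ k := by exact_mod_cast hdet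
  obtain ⟨hall, hκ⟩ := eq_of_pow_dvd_prod hprime n hu.pos hlt hsum
    (hdet' ▸ Dvd.intro_left _ rfl)
  have hr1 : r = 1 := by
    have h1 : ∏ i, (n i + 1) = p ^ k := by
      rw [← hκ, ← Finset.card_univ, ← Finset.prod_const]
      refine Finset.prod_congr rfl fun i _ => ?_
      rw [hall]
      have := hprime.one_lt
      omega
    rw [h1] at hdet'
    have hpp : 0 < p ^ k := pow_pos hprime.pos k
    have : r ^ 2 = 1 := Nat.eq_of_mul_eq_mul_right hpp (by rw [one_mul]; exact hdet'.symm)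
    simpa using this
  have hMA : M ≤ Submodule.span ℤ (Set.range fun x => (flat u x : E)) :=
    AddSubgroup.relIndex_eq_one.1 hr1
  obtain rfl : n = fun _ => p - 1 := funext hall
  let f : Fin k ≃ κ := (Fintype.equivFinOfCardEq hκ).symm
  refine ⟨fun i => u (f i), fun i => hu.isBlock _,
    fun i j hij => hu.orth _ _ (f.injective.ne hij), ?_⟩
  rw [eq_top_iff]
  rintro x -
  have hx := coe_mem_span_int.1 (hMA x.2)
  refine Submodule.span_mono ?_ hx
  rintro _ ⟨⟨i, a⟩, rfl⟩
  obtain ⟨j, rfl⟩ := f.surjective i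
  exact ⟨(j, a), rfl⟩

end FullRank

/-! ### The lattice `A_q^k` in coordinates, its roots and its Weyl vectors -/

section RootLatticeA

variable {k p : ℕ}

/-- The root `e_a - e_b` in the `i`-th summand of `A_{p-1}^k`. -/
noncomputable def rootA (i : Fin k) (a b : Fin p) : spaceA k p :=
  ⟨EuclideanSpace.single (i, a) 1 - EuclideanSpace.single (i, b) 1, fun j => by
    by_cases hj : j = i
    · subst hj
      simp [Finset.sum_sub_distrib]
    · simp [hj]⟩

theorem rootA_apply (i : Fin k) (a b : Fin p) (j : Fin k) (c : Fin p) :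
    (rootA i a b : EuclideanSpace ℝ (Fin k × Fin p)) (j, c) =
      if j = i then (if c = a then 1 else 0) - (if c = b then 1 else 0) else 0 := by
  by_cases hj : j = i
  · subst hj
    simp [rootA]
  · simp [rootA, hj]

theorem inner_spaceA (x y : spaceA k p) :
    ⟪x, y⟫_ℝ = ∑ i, ∑ a, (x : EuclideanSpace ℝ (Fin k × Fin p)) (i, a) *
      (y : EuclideanSpace ℝ (Fin k × Fin p)) (i, a) := by
  rw [Submodule.coe_inner, PiLp.inner_apply, Fintype.sum_prod_type]
  simp [mul_comm]

theorem inner_rootA (x : spaceA k p) (i : Fin k) (a b : Fin p) :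
    ⟪x, rootA i a b⟫_ℝ = (x : EuclideanSpace ℝ (Fin k × Fin p)) (i, a) -
      (x : EuclideanSpace ℝ (Fin k × Fin p)) (i, b) := by
  rw [inner_spaceA, Finset.sum_eq_single i]
  · simp [rootA_apply, mul_sub, Finset.sum_sub_distrib]
  · intro j _ hj
    simp [rootA_apply, hj]
  · simp

theorem sum_spaceA (x : spaceA k p) (i : Fin k) :
    ∑ a, (x : EuclideanSpace ℝ (Fin k × Fin p)) (i, a) = 0 := x.2 i

theorem rootA_mem (i : Fin k) (a b : Fin p) : rootA i a b ∈ latticeA k p := by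
  rintro ⟨j, c⟩
  refine ⟨if j = i then (if c = a then 1 else 0) - (if c = b then 1 else 0) else 0, ?_⟩
  rw [rootA_apply]
  push_cast
  rfl

theorem spaceA_ext {x y : spaceA k p} (h : ∀ i a, (x : EuclideanSpace ℝ (Fin k × Fin p)) (i, a) =
    (y : EuclideanSpace ℝ (Fin k × Fin p)) (i, a)) : x = y := by
  ext ⟨i, a⟩
  exact h i a

theorem sum_apply_spaceA {ι : Type*} (s : Finset ι) (f : ι → spaceA k p) (x : Fin k × Fin p) :
    ((∑ i ∈ s, f i : spaceA k p) : EuclideanSpace ℝ (Fin k × Fin p)) x =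
      ∑ i ∈ s, (f i : EuclideanSpace ℝ (Fin k × Fin p)) x := by
  rw [Submodule.coe_sum, WithLp.ofLp_sum, Finset.sum_apply]

/-- Discreteness is automatic: a nonzero vector has squared norm at least `2`. -/
theorem isEvenLattice_of_even {F : Type*} [NormedAddCommGroup F] [InnerProductSpace ℝ F]
    {L : Submodule ℤ F} (hspan : Submodule.span ℝ (L : Set F) = ⊤)
    (heven : ∀ x ∈ L, ∃ n : ℤ, ⟪x, x⟫_ℝ = 2 * n) : IsEvenLattice L := by
  refine ⟨?_, hspan, heven⟩
  have h0 : ∀ x : L, ‖x‖ < 1 → x = 0 := by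
    intro x hx
    by_contra hne
    obtain ⟨n, hn⟩ := heven _ x.2
    have hpos : 0 < ⟪(x : F), (x : F)⟫_ℝ := real_inner_self_pos.2 (by simpa using hne)
    have h1 : 0 < n := by
      have : (0 : ℝ) < n := by rw [hn] at hpos; linarith
      exact_mod_cast this
    have h2 : (1 : ℝ) ≤ n := by exact_mod_cast h1
    have h3 : ‖(x : F)‖ < 1 := hx
    rw [real_inner_self_eq_norm_sq] at hn
    nlinarith [norm_nonneg (x : F)]
  refine discreteTopology_of_isOpen_singleton_zero ?_
  rw [Metric.isOpen_singleton_iff]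
  refine ⟨1, one_pos, fun y hy => h0 y ?_⟩
  simpa using hy

variable {q : ℕ}

/-- A basis of `A_q^k`, depending on a choice of orderings of the coordinates. -/
noncomputable def stdA (σ : Fin k → Equiv.Perm (Fin (q + 1))) (x : Fin k × Fin q) :
    spaceA k (q + 1) :=
  rootA x.1 (σ x.1 x.2.succ) (σ x.1 0)

/-- The coordinates other than the one at `σ j 0` are the coefficients in the basis; that last one
is determined by the zero sum in each summand. -/
theorem stdA_apply_succ (σ : Fin k → Equiv.Perm (Fin (q + 1))) (i : Fin k) (a : Fin q) (j : Fin k)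
    (c : Fin q) : (stdA σ (i, a) : EuclideanSpace ℝ (Fin k × Fin (q + 1))) (j, σ j c.succ) =
      if (i, a) = (j, c) then 1 else 0 := by
  rw [stdA, rootA_apply]
  by_cases hj : j = i
  · subst hj
    simp [eq_comm]
  · simp [hj, Ne.symm hj]

theorem spaceA_eq_of_succ (σ : Fin k → Equiv.Perm (Fin (q + 1))) {x y : spaceA k (q + 1)}
    (h : ∀ i (a : Fin q), (x : EuclideanSpace ℝ (Fin k × Fin (q + 1))) (i, σ i a.succ) =
      (y : EuclideanSpace ℝ (Fin k × Fin (q + 1))) (i, σ i a.succ)) : x = y := by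
  refine spaceA_ext fun i a => ?_
  obtain ⟨b, rfl⟩ := (σ i).surjective a
  induction b using Fin.cases with
  | zero =>
    have hx := sum_spaceA x i
    have hy := sum_spaceA y i
    rw [← Equiv.sum_comp (σ i), Fin.sum_univ_succ] at hx hy
    simp_rw [h] at hx
    linarith
  | succ b => exact h i b

theorem spaceA_eq_sum (σ : Fin k → Equiv.Perm (Fin (q + 1))) (x : spaceA k (q + 1)) :
    x = ∑ y : Fin k × Fin q, (x : EuclideanSpace ℝ (Fin k × Fin (q + 1))) (y.1, σ y.1 y.2.succ) •
      stdA σ y := by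
  refine spaceA_eq_of_succ σ fun i a => ?_
  rw [sum_apply_spaceA, Finset.sum_eq_single (i, a)]
  · simp [stdA_apply_succ]
  · rintro ⟨j, c⟩ _ hne
    rw [Submodule.coe_smul, PiLp.smul_apply, stdA_apply_succ, if_neg hne, smul_zero]
  · simp

theorem linearIndependent_stdA (σ : Fin k → Equiv.Perm (Fin (q + 1))) :
    LinearIndependent ℝ (stdA σ) := by
  rw [Fintype.linearIndependent_iff]
  rintro g hg ⟨i, a⟩
  have := congrArg (fun x : spaceA k (q + 1) =>
    (x : EuclideanSpace ℝ (Fin k × Fin (q + 1))) (i, σ i a.succ)) hg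
  simp only [sum_apply_spaceA] at this
  rw [Finset.sum_eq_single (i, a)] at this
  · simpa [stdA_apply_succ] using this
  · rintro ⟨j, c⟩ _ hne
    rw [Submodule.coe_smul, PiLp.smul_apply, stdA_apply_succ, if_neg hne, smul_zero]
  · simp

theorem span_real_stdA (σ : Fin k → Equiv.Perm (Fin (q + 1))) :
    Submodule.span ℝ (Set.range (stdA σ)) = ⊤ := by
  refine eq_top_iff.2 fun x _ => ?_
  rw [spaceA_eq_sum σ x]
  exact Submodule.sum_mem _ fun y _ => Submodule.smul_mem _ _ (Submodule.subset_span ⟨y, rfl⟩)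

theorem span_int_stdA (σ : Fin k → Equiv.Perm (Fin (q + 1))) :
    Submodule.span ℤ (Set.range (stdA σ)) = latticeA k (q + 1) := by
  refine le_antisymm (Submodule.span_le.2 ?_) fun x hx => ?_
  · rintro _ ⟨y, rfl⟩
    exact rootA_mem _ _ _
  · rw [spaceA_eq_sum σ x]
    refine Submodule.sum_mem _ fun y _ => ?_
    obtain ⟨n, hn⟩ := hx (y.1, σ y.1 y.2.succ)
    rw [hn, Int.cast_smul_eq_zsmul]
    exact Submodule.smul_mem _ _ (Submodule.subset_span ⟨y, rfl⟩)

theorem isLatticeBasis_stdA (σ : Fin k → Equiv.Perm (Fin (q + 1))) :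
    IsLatticeBasis (latticeA k (q + 1)) (stdA σ) :=
  ⟨linearIndependent_stdA σ, span_int_stdA σ⟩

theorem finrank_spaceA : Module.finrank ℝ (spaceA k (q + 1)) = k * q := by
  have h := finrank_span_eq_card (linearIndependent_stdA (k := k) (q := q) fun _ => 1)
  rw [span_real_stdA, finrank_top] at h
  simpa using h

theorem isEvenLattice_latticeA : IsEvenLattice (latticeA k (q + 1)) := by
  refine isEvenLattice_of_even ?_ fun x hx => ?_
  · rw [← span_int_stdA fun _ => 1, span_real_span_int, span_real_stdA]
  · choose n hn using hx
    have h0 : ∀ i, ∑ a, n (i, a) = 0 := by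
      intro i
      have := sum_spaceA x i
      simp only [hn] at this
      exact_mod_cast this
    have h1 : Even (∑ i, ∑ a, n (i, a) * n (i, a)) := by
      refine Finset.even_sum _ fun i _ => ?_
      have : ∑ a, n (i, a) * n (i, a) = ∑ a, (n (i, a) * n (i, a) - n (i, a)) := by
        rw [Finset.sum_sub_distrib, h0, sub_zero]
      rw [this]
      refine Finset.even_sum _ fun a _ => ?_
      rw [show n (i, a) * n (i, a) - n (i, a) = (n (i, a) - 1) * (n (i, a) - 1 + 1) by ring]
      exact Int.even_mul_succ_self _
    obtain ⟨m, hm⟩ := h1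
    refine ⟨m, ?_⟩
    rw [inner_spaceA]
    simp only [hn]
    rw [two_mul]
    exact_mod_cast hm

theorem inner_stdA (σ : Fin k → Equiv.Perm (Fin (q + 1))) (x y : Fin k × Fin q) :
    ⟪stdA σ x, stdA σ y⟫_ℝ = if x.1 = y.1 then (if x.2 = y.2 then 2 else 1) else 0 := by
  obtain ⟨i, a⟩ := x
  obtain ⟨j, b⟩ := y
  rw [stdA, stdA, inner_rootA, rootA_apply, rootA_apply]
  by_cases hij : i = j
  · subst hij
    by_cases hab : a = b
    · subst hab
      simp [(Fin.succ_ne_zero a).symm]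
      norm_num
    · simp [hab, Ne.symm hab, (Fin.succ_ne_zero _).symm]
  · simp [hij, Ne.symm hij]

open Matrix in
theorem card_res_latticeA : Nat.card (Res (latticeA k (q + 1))) = (q + 1) ^ k := by
  have h := card_res_eq_det_gram isEvenLattice_latticeA
    (isLatticeBasis_stdA (k := k) (q := q) fun _ => 1)
  rw [← det_submatrix_equiv_self (Equiv.prodComm (Fin q) (Fin k)),
    show (gram ℝ (stdA fun _ => 1)).submatrix (Equiv.prodComm (Fin q) (Fin k))
      (Equiv.prodComm (Fin q) (Fin k)) = blockDiagonal (fun _ : Fin k =>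
        (Matrix.of fun i j : Fin q => if i = j then (2 : ℝ) else 1)) by
      ext x y
      simp only [submatrix_apply, Equiv.prodComm_apply, gram_apply, inner_stdA, blockDiagonal_apply,
        Prod.fst_swap, Prod.snd_swap, of_apply],
    det_blockDiagonal] at h
  simp only [det_one_add_ones, Finset.prod_const, Finset.card_univ, Fintype.card_fin] at h
  exact_mod_cast h.symm

theorem rootA_isRoot {i : Fin k} {a b : Fin p} (hab : a ≠ b) :
    ⟪rootA i a b, rootA i a b⟫_ℝ = 2 := by
  rw [inner_rootA, rootA_apply, rootA_apply]
  simp [hab, hab.symm]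
  norm_num

/-- The zero sum gives a positive coordinate `a` and a negative coordinate `b` in one summand, so
`x` has product at least `2` with `e_a - e_b`; as both have norm `2`, their difference has norm at
most `0`. -/
theorem exists_rootA {x : spaceA k p} (hx : x ∈ latticeA k p) (h2 : ⟪x, x⟫_ℝ = 2) :
    ∃ i a b, a ≠ b ∧ x = rootA i a b := by
  choose n hn using hx
  have h0 : ∀ i, ∑ a, n (i, a) = 0 := by
    intro i
    have := sum_spaceA x i
    simp only [hn] at this
    exact_mod_cast this
  have hsq : ∑ i, ∑ a, n (i, a) * n (i, a) = 2 := by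
    rw [inner_spaceA] at h2
    simp only [hn] at h2
    exact_mod_cast h2
  have hne : ∃ y, 0 < n y := by
    by_contra! hcon
    have hz : ∀ i a, n (i, a) = 0 := fun i a => by
      have := (Finset.sum_eq_zero_iff_of_nonpos fun a _ => hcon (i, a)).1 (h0 i)
      exact this a (Finset.mem_univ _)
    simp [hz] at hsq
  obtain ⟨⟨i, a⟩, ha⟩ := hne
  have hneg : ∃ b, n (i, b) < 0 := by
    by_contra! hcon
    have := (Finset.sum_eq_zero_iff_of_nonneg fun a _ => hcon a).1 (h0 i) a (Finset.mem_univ _)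
    omega
  obtain ⟨b, hb⟩ := hneg
  have hab : a ≠ b := by rintro rfl; omega
  refine ⟨i, a, b, hab, ?_⟩
  have hi := inner_rootA x i a b
  rw [hn, hn] at hi
  have h3 : (1 : ℝ) ≤ n (i, a) := by exact_mod_cast ha
  have h4 : (n (i, b) : ℝ) ≤ -1 := by exact_mod_cast (by omega : n (i, b) ≤ -1)
  have h5 : ⟪x - rootA i a b, x - rootA i a b⟫_ℝ ≤ 0 := by
    rw [inner_sub_left, inner_sub_right, inner_sub_right, h2, rootA_isRoot hab,
      real_inner_comm x (rootA i a b), hi]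
    linarith
  have h6 := inner_self_eq_zero.1 (le_antisymm h5 real_inner_self_nonneg)
  exact sub_eq_zero.1 h6

/-- The coordinates of a Weyl vector of `A_q^k`. -/
theorem IsWeylVector.exists_perm {ρ : spaceA k (q + 1)}
    (hρ : IsWeylVector (latticeA k (q + 1)) ρ) :
    ∃ π : Fin k → Equiv.Perm (Fin (q + 1)), ∀ i a,
      (ρ : EuclideanSpace ℝ (Fin k × Fin (q + 1))) (i, a) = ((π i a : ℕ) : ℝ) - q / 2 := by
  classical
  obtain ⟨v, hreg, hρ⟩ := hρ
  set w : Fin k → Fin (q + 1) → ℝ := fun i a =>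
    (v : EuclideanSpace ℝ (Fin k × Fin (q + 1))) (i, a) with hw
  have hinner (i : Fin k) (a b : Fin (q + 1)) : ⟪rootA i a b, v⟫_ℝ = w i a - w i b := by
    rw [real_inner_comm, inner_rootA]
  have hinj (i : Fin k) : Function.Injective (w i) := by
    intro a b hab
    by_contra hne
    exact hreg _ ⟨rootA_mem i a b, rootA_isRoot hne⟩ (by rw [hinner, hab, sub_self])
  let T : Finset (Fin k × Fin (q + 1) × Fin (q + 1)) :=
    Finset.univ.filter fun t => w t.1 t.2.2 < w t.1 t.2.1
  have hset : {α | α ∈ latticeRoots (latticeA k (q + 1)) ∧ 0 < ⟪α, v⟫_ℝ} =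
      (fun t : Fin k × Fin (q + 1) × Fin (q + 1) => rootA t.1 t.2.1 t.2.2) '' (T : Set _) := by
    ext α
    constructor
    · rintro ⟨⟨hα, h2⟩, hpos⟩
      obtain ⟨i, a, b, hab, rfl⟩ := exists_rootA hα h2
      refine ⟨(i, a, b), ?_, rfl⟩
      rw [hinner] at hpos
      simpa [T] using hpos
    · rintro ⟨⟨i, a, b⟩, ht, rfl⟩
      have ht' : w i b < w i a := by simpa [T] using ht
      refine ⟨⟨rootA_mem i a b, rootA_isRoot ?_⟩, ?_⟩
      · intro h
        obtain rfl : a = b := h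
        exact lt_irrefl _ ht'
      · rw [hinner]; linarith
  have hTinj : Set.InjOn (fun t : Fin k × Fin (q + 1) × Fin (q + 1) => rootA t.1 t.2.1 t.2.2)
      (T : Set _) := by
    rintro ⟨i, a, b⟩ ht ⟨j, c, d⟩ ht' h
    have hab : a ≠ b := by
      rintro rfl
      simp [T] at ht
    have hcd : c ≠ d := by
      rintro rfl
      simp [T] at ht'
    have h1 := congrArg (fun x : spaceA k (q + 1) =>
      (x : EuclideanSpace ℝ (Fin k × Fin (q + 1))) (i, a)) h
    have h2 := congrArg (fun x : spaceA k (q + 1) =>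
      (x : EuclideanSpace ℝ (Fin k × Fin (q + 1))) (i, b)) h
    simp only [rootA_apply, if_true, if_neg hab, if_neg hab.symm] at h1 h2
    have hij : i = j := by
      by_contra hij
      simp [hij] at h1
    subst hij
    simp only [if_true] at h1 h2
    have hac : a = c := by
      by_contra hac
      rw [if_neg hac] at h1
      split_ifs at h1 <;> norm_num at h1
    have hbd : b = d := by
      by_contra hbd
      rw [if_neg hbd] at h2
      split_ifs at h2 <;> norm_num at h2
    rw [hac, hbd]
  rw [hset, finsum_mem_image hTinj, finsum_mem_coe_finset] at hρ
  -- The rank of a coordinate in the order defined by the regular vector: these ranks form the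
  -- permutation.
  let R : Fin k → Fin (q + 1) → ℕ := fun i a => (Finset.univ.filter fun b => w i b < w i a).card
  have hRlt (i : Fin k) (a : Fin (q + 1)) : R i a < q + 1 := by
    have : (Finset.univ.filter fun b => w i b < w i a) ⊂ Finset.univ := by
      rw [Finset.ssubset_univ_iff]
      intro h
      have : a ∈ Finset.univ.filter fun b => w i b < w i a := by
        rw [h]
        exact Finset.mem_univ a
      simp at this
    simpa using Finset.card_lt_card this
  have hRmono (i : Fin k) (a b : Fin (q + 1)) (hab : w i a < w i b) : R i a < R i b := by
    refine Finset.card_lt_card (Finset.ssubset_iff_of_subset ?_ |>.2 ⟨a, ?_, ?_⟩)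
    · intro c hc
      simp only [Finset.mem_filter, Finset.mem_univ, true_and] at hc ⊢
      exact hc.trans hab
    · simpa using hab
    · simp
  let f : Fin k → Fin (q + 1) → Fin (q + 1) := fun i a => ⟨R i a, hRlt i a⟩
  have hf (i : Fin k) : Function.Injective (f i) := by
    intro a b hab
    have hab' : R i a = R i b := congrArg Fin.val hab
    by_contra hne
    rcases lt_or_gt_of_ne ((hinj i).ne hne) with h | h
    · exact absurd hab' (hRmono i a b h).ne
    · exact absurd hab' (hRmono i b a h).ne'
  refine ⟨fun i => Equiv.ofBijective (f i) (Finite.injective_iff_bijective.1 (hf i)), fun i a => ?_⟩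
  change _ = (R i a : ℝ) - q / 2
  have hup : (R i a : ℝ) + ((Finset.univ.filter fun b => w i a < w i b).card : ℝ) = q := by
    have h1 := Finset.card_filter_add_card_filter_not (s := Finset.univ) fun b => w i b < w i a
    have h3 : (Finset.univ.filter fun b => ¬ w i b < w i a) =
        insert a (Finset.univ.filter fun b => w i a < w i b) := by
      ext b
      simp only [Finset.mem_filter, Finset.mem_univ, true_and, Finset.mem_insert, not_lt]
      rw [le_iff_eq_or_lt, (hinj i).eq_iff, eq_comm]
    rw [h3, Finset.card_insert_of_notMem (by simp), Finset.card_univ, Fintype.card_fin] at h1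
    have h2 : R i a + (Finset.univ.filter fun b => w i a < w i b).card = q := by
      simp only [R]
      omega
    exact_mod_cast h2
  rw [hρ, Submodule.coe_smul, PiLp.smul_apply, sum_apply_spaceA]
  -- Each coordinate smaller than the `a`-th contributes a positive root with entry `1` at `a`, each
  -- larger one a positive root with entry `-1`.
  have hsum : ∑ t ∈ T, (rootA t.1 t.2.1 t.2.2 : EuclideanSpace ℝ (Fin k × Fin (q + 1))) (i, a) =
      (R i a : ℝ) - ((Finset.univ.filter fun b => w i a < w i b).card : ℝ) := by
    rw [Finset.sum_filter, Fintype.sum_prod_type, Finset.sum_eq_single i]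
    · rw [Fintype.sum_prod_type]
      simp only [rootA_apply, if_true]
      have h1 (c d : Fin (q + 1)) : (if w i d < w i c then
          ((if a = c then (1 : ℝ) else 0) - if a = d then 1 else 0) else 0) =
          (if a = c then (if w i d < w i a then 1 else 0) else 0) -
          (if a = d then (if w i a < w i c then 1 else 0) else 0) := by
        by_cases hc : a = c <;> by_cases hd : a = d
        · subst hc; subst hd; simp
        · subst hc; simp [hd]
        · subst hd; simp only [if_neg hc, if_true]; split_ifs <;> simp
        · simp [hc, hd]
      simp_rw [h1, Finset.sum_sub_distrib]
      rw [Finset.sum_comm]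
      simp [R]
    · intro j _ hj
      refine Finset.sum_eq_zero fun t _ => ?_
      simp [rootA_apply, Ne.symm hj]
    · simp
  rw [hsum, smul_eq_mul]
  linarith

end RootLatticeA

/-! ### Overlattices of `L` inside its dual and subgroups of `res L` -/

section Residues

theorem nonempty_linearEquiv_of_card {G : Type*} [AddCommGroup G] {p m : ℕ} [Fact p.Prime]
    [Module (ZMod p) G] [Finite G] (hc : Nat.card G = p ^ m) :
    Nonempty (G ≃ₗ[ZMod p] (Fin m → ZMod p)) := by
  rw [← FiniteField.pow_finrank_eq_natCard p G] at hc
  have hrank : Module.finrank (ZMod p) G = m :=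
    Nat.pow_right_injective (Fact.out : p.Prime).two_le hc
  exact ⟨LinearEquiv.ofFinrankEq G (Fin m → ZMod p) (by rw [hrank]; simp)⟩

theorem nonempty_addEquiv_of_card {G : Type*} [AddCommGroup G] {p m : ℕ} (hp : p.Prime)
    (h : ∀ x : G, p • x = 0) (hc : Nat.card G = p ^ m) : Nonempty (G ≃+ (Fin m → ZMod p)) := by
  have : Fact p.Prime := ⟨hp⟩
  let _ : Module (ZMod p) G := AddCommGroup.zmodModule h
  have : Finite G := Nat.finite_of_card_ne_zero (by rw [hc]; exact pow_ne_zero _ hp.ne_zero)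
  obtain ⟨e⟩ := nonempty_linearEquiv_of_card hc
  exact ⟨e.toAddEquiv⟩

/-- A sublattice of prime index is the kernel of a linear form modulo `p`. -/
theorem exists_label {F : Type*} [AddCommGroup F] {L M : Submodule ℤ F} {p : ℕ} (hp : p.Prime)
    (hidx : L.toAddSubgroup.relIndex M.toAddSubgroup = p) :
    ∃ ℓ : M →+ ZMod p, ∀ x : M, ℓ x = 0 ↔ (x : F) ∈ L := by
  have hcard : Nat.card (M.toAddSubgroup ⧸ L.toAddSubgroup.addSubgroupOf M.toAddSubgroup) = p ^ 1 :=
    hidx.trans (pow_one p).symm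
  obtain ⟨e⟩ := nonempty_addEquiv_of_card hp (fun x => by
    have h := card_nsmul_eq_zero' (x := x)
    rwa [hcard, pow_one] at h) hcard
  let f : (M.toAddSubgroup ⧸ L.toAddSubgroup.addSubgroupOf M.toAddSubgroup) →+ ZMod p :=
    (Pi.evalAddMonoidHom (fun _ : Fin 1 => ZMod p) 0).comp e.toAddMonoidHom
  refine ⟨f.comp (QuotientAddGroup.mk' _), fun x => ?_⟩
  have h1 : f (QuotientAddGroup.mk' (L.toAddSubgroup.addSubgroupOf M.toAddSubgroup) x) = 0 ↔
      QuotientAddGroup.mk' (L.toAddSubgroup.addSubgroupOf M.toAddSubgroup) x = 0 := by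
    rw [← e.map_eq_zero_iff]
    constructor
    · intro h
      ext i
      rw [Subsingleton.elim i 0]
      exact h
    · intro h
      change e _ 0 = 0
      rw [h]
      rfl
  refine h1.trans ?_
  exact QuotientAddGroup.eq_zero_iff x

variable {E : Type*} [NormedAddCommGroup E] [InnerProductSpace ℝ E] {L : Submodule ℤ E}

theorem mem_resPreimage {D : Submodule ℤ (Res L)} {x : E} :
    x ∈ resPreimage L D ↔ ∃ hx : x ∈ dualLattice L,
      (L.submoduleOf (dualLattice L)).mkQ ⟨x, hx⟩ ∈ D := by
  constructor
  · rintro ⟨y, hy, rfl⟩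
    exact ⟨y.2, hy⟩
  · rintro ⟨hx, h⟩
    exact ⟨⟨x, hx⟩, h, rfl⟩

theorem mk_res_eq_zero {x : E} (hx : x ∈ dualLattice L) :
    (L.submoduleOf (dualLattice L)).mkQ ⟨x, hx⟩ = 0 ↔ x ∈ L := by
  rw [Submodule.mkQ_apply, Submodule.Quotient.mk_eq_zero]
  rfl

theorem mk_res_eq {x y : E} (hx : x ∈ dualLattice L) (hy : y ∈ dualLattice L) :
    (L.submoduleOf (dualLattice L)).mkQ ⟨x, hx⟩ = (L.submoduleOf (dualLattice L)).mkQ ⟨y, hy⟩ ↔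
      x - y ∈ L :=
  Submodule.Quotient.eq _

theorem le_resPreimage (hL : IsEvenLattice L) (D : Submodule ℤ (Res L)) : L ≤ resPreimage L D :=
  fun x hx => mem_resPreimage.2 ⟨hL.le_dual hx, by
    rw [(mk_res_eq_zero _).2 hx]
    exact D.zero_mem⟩

theorem resPreimage_le_dual (D : Submodule ℤ (Res L)) : resPreimage L D ≤ dualLattice L :=
  fun _ hx => (mem_resPreimage.1 hx).1

theorem resPreimage_mono {D D' : Submodule ℤ (Res L)} (h : D ≤ D') :
    resPreimage L D ≤ resPreimage L D' := fun _ hx => by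
  obtain ⟨hx', h'⟩ := mem_resPreimage.1 hx
  exact mem_resPreimage.2 ⟨hx', h h'⟩

theorem le_of_resPreimage_le {D D' : Submodule ℤ (Res L)}
    (h : resPreimage L D ≤ resPreimage L D') : D ≤ D' := by
  intro y hy
  obtain ⟨⟨x, hx⟩, rfl⟩ := Submodule.mkQ_surjective _ y
  exact (mem_resPreimage.1 (h (mem_resPreimage.2 ⟨hx, hy⟩))).2

theorem resPreimage_injective : Function.Injective (resPreimage L) := fun _ _ h =>
  le_antisymm (le_of_resPreimage_le h.le) (le_of_resPreimage_le h.ge)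

/-- The projection of the inverse image of `D` to `res L`. -/
noncomputable def resProj (D : Submodule ℤ (Res L)) : resPreimage L D →ₗ[ℤ] Res L :=
  (L.submoduleOf (dualLattice L)).mkQ ∘ₗ Submodule.inclusion (resPreimage_le_dual D)

theorem resProj_ker (D : Submodule ℤ (Res L)) (x : resPreimage L D) :
    resProj D x = 0 ↔ (x : E) ∈ L :=
  mk_res_eq_zero _

theorem resProj_range (D : Submodule ℤ (Res L)) : LinearMap.range (resProj D) = D := by
  ext y
  constructor
  · rintro ⟨x, rfl⟩
    exact (mem_resPreimage.1 x.2).2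
  · intro hy
    obtain ⟨⟨x, hx⟩, rfl⟩ := Submodule.mkQ_surjective _ y
    exact ⟨⟨x, mem_resPreimage.2 ⟨hx, hy⟩⟩, rfl⟩

theorem relIndex_resPreimage (D : Submodule ℤ (Res L)) :
    L.toAddSubgroup.relIndex (resPreimage L D).toAddSubgroup = Nat.card D := by
  have h1 : L.toAddSubgroup.addSubgroupOf (resPreimage L D).toAddSubgroup =
      (resProj D).toAddMonoidHom.ker := by
    ext x
    exact (resProj_ker D x).symm
  rw [AddSubgroup.relIndex, h1, AddSubgroup.index_ker]
  have h2 : (resProj D).toAddMonoidHom.range = D.toAddSubgroup := by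
    ext y
    exact (SetLike.ext_iff.1 (resProj_range D) y)
  rw [h2]
  rfl

theorem resForm_mk (hL : IsEvenLattice L) {x : E} (hx : x ∈ dualLattice L) :
    resForm hL ((L.submoduleOf (dualLattice L)).mkQ ⟨x, hx⟩) = 0 ↔
      ∃ n : ℤ, ⟪x, x⟫_ℝ = 2 * n := by
  change ((⟪x, x⟫_ℝ / 2 : ℝ) : AddCircle (1 : ℝ)) = 0 ↔ _
  rw [AddCircle.coe_eq_zero_iff]
  refine exists_congr fun n => ?_
  rw [zsmul_eq_mul, mul_one]
  constructor <;> intro h <;> linarith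

theorem isEvenLattice_of_le {M : Submodule ℤ E} (hL : IsEvenLattice L) (hLM : L ≤ M)
    (heven : ∀ x ∈ M, ∃ n : ℤ, ⟪x, x⟫_ℝ = 2 * n) : IsEvenLattice M :=
  isEvenLattice_of_even (top_le_iff.1 (hL.span_eq_top ▸ Submodule.span_mono hLM)) heven

theorem isEvenLattice_resPreimage (hL : IsEvenLattice L) {D : Submodule ℤ (Res L)}
    (hD : ∀ x ∈ D, resForm hL x = 0) : IsEvenLattice (resPreimage L D) := by
  refine isEvenLattice_of_le hL (le_resPreimage hL D) fun x hx => ?_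
  obtain ⟨hx', h⟩ := mem_resPreimage.1 hx
  exact (resForm_mk hL hx').1 (hD _ h)

/-- Turns the action of `O(L)` on subgroups of `res L` into its action on overlattices, where
isometries can be constructed. -/
theorem mapLattice_resPreimage (hL : IsEvenLattice L) (γ : latticeO L) (D : Submodule ℤ (Res L)) :
    mapLattice (γ : E ≃ₗᵢ[ℝ] E) (resPreimage L D) = resPreimage L (D.map (resMap γ)) := by
  ext y
  rw [mem_mapLattice]
  constructor
  · rintro ⟨x, hx, rfl⟩
    obtain ⟨hx', h⟩ := mem_resPreimage.1 hx
    exact mem_resPreimage.2 ⟨latticeO_apply_mem_dual γ hx', _, h, rfl⟩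
  · intro hy
    obtain ⟨hy', z, hz, hzy⟩ := mem_resPreimage.1 hy
    obtain ⟨⟨x, hx⟩, rfl⟩ := Submodule.mkQ_surjective _ z
    have h1 : y - (γ : E ≃ₗᵢ[ℝ] E) x ∈ L := (mk_res_eq hy' (latticeO_apply_mem_dual γ hx)).1 hzy.symm
    have h2 : mapLattice (γ : E ≃ₗᵢ[ℝ] E) L = L := γ.2
    obtain ⟨w, hw, hwy⟩ := (mem_mapLattice _ _ _).1 (h2.ge h1)
    refine ⟨w + x, ?_, by rw [map_add, hwy]; abel⟩
    have hwd : w ∈ dualLattice L := hL.le_dual hw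
    refine mem_resPreimage.2 ⟨(dualLattice L).add_mem hwd hx, ?_⟩
    have h5 : (L.submoduleOf (dualLattice L)).mkQ ⟨w + x, (dualLattice L).add_mem hwd hx⟩ =
        (L.submoduleOf (dualLattice L)).mkQ ⟨w, hwd⟩ +
        (L.submoduleOf (dualLattice L)).mkQ ⟨x, hx⟩ := rfl
    rw [h5, (mk_res_eq_zero hwd).2 hw, zero_add]
    exact hz

/-- The image in `res L` of a subgroup of `L^♯`. -/
noncomputable def resImage (L M : Submodule ℤ E) : Submodule ℤ (Res L) :=
  (M.submoduleOf (dualLattice L)).map (L.submoduleOf (dualLattice L)).mkQ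

theorem resPreimage_resImage {M : Submodule ℤ E} (hLM : L ≤ M) (hM : M ≤ dualLattice L) :
    resPreimage L (resImage L M) = M := by
  ext x
  rw [mem_resPreimage]
  constructor
  · rintro ⟨hx, ⟨y, hyd⟩, hy, hyx⟩
    have h0 : y - x ∈ L := (mk_res_eq hyd hx).1 hyx
    have hy' : y ∈ M := hy
    have := M.sub_mem hy' (hLM h0)
    rwa [sub_sub_cancel] at this
  · intro hx
    exact ⟨hM hx, ⟨x, hM hx⟩, hx, rfl⟩

theorem le_dual_of_even {M : Submodule ℤ E} (hM : IsEvenLattice M) (hLM : L ≤ M) :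
    M ≤ dualLattice L := fun _ hx => mem_dualLattice.2 fun _ hy => hM.exists_inner_eq hx (hLM hy)

theorem isTotIsotropic_resImage (hL : IsEvenLattice L) {M : Submodule ℤ E} {p i : ℕ}
    (hp : p.Prime) (hM : IsEvenLattice M) (hLM : L ≤ M)
    (hkill : ∀ x ∈ dualLattice L, (p : ℤ) • x ∈ L)
    (hcard : L.toAddSubgroup.relIndex M.toAddSubgroup = p ^ i) :
    IsTotIsotropic hL p i (resImage L M) := by
  have hpre := resPreimage_resImage hLM (le_dual_of_even hM hLM)
  refine ⟨nonempty_addEquiv_of_card hp (fun x => ?_) ?_, fun x hx => ?_⟩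
  · ext
    obtain ⟨⟨y, hy⟩, hyx⟩ := Submodule.mkQ_surjective _ (x : Res L)
    rw [Submodule.coe_smul_of_tower, ← hyx, ← map_nsmul]
    have : p • (⟨y, hy⟩ : dualLattice L) =
        ⟨(p : ℤ) • y, (dualLattice L).smul_mem _ hy⟩ := by
      ext
      simp
    rw [this]
    exact (mk_res_eq_zero _).2 (hkill y hy)
  · rw [← relIndex_resPreimage, hpre, hcard]
  · obtain ⟨⟨y, hy⟩, rfl⟩ := Submodule.mkQ_surjective _ x
    have : y ∈ resPreimage L (resImage L M) := mem_resPreimage.2 ⟨hy, hx⟩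
    rw [hpre] at this
    exact (resForm_mk hL hy).2 (hM.even y this)

theorem IsTotIsotropic.card {hL : IsEvenLattice L} {p i : ℕ} [NeZero p] {D : Submodule ℤ (Res L)}
    (hD : IsTotIsotropic hL p i D) : Nat.card D = p ^ i := by
  obtain ⟨⟨e⟩, -⟩ := hD
  rw [Nat.card_congr e.toEquiv]
  simp

/-- Both orders are Gram determinants, which differ by the square of the index. -/
theorem card_res_sublattice [FiniteDimensional ℝ E] {M : Submodule ℤ E} (hL : IsEvenLattice L)
    (hM : IsEvenLattice M) (hLM : L ≤ M) :
    Nat.card (Res L) = L.toAddSubgroup.relIndex M.toAddSubgroup ^ 2 * Nat.card (Res M) := by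
  obtain ⟨u, hu⟩ := exists_latticeBasis hL
  obtain ⟨b, hb⟩ := exists_latticeBasis hM
  have := det_gram_sublattice hLM hu hb
  rw [card_res_eq_det_gram hL hu, card_res_eq_det_gram hM hb] at this
  exact_mod_cast this

end Residues

/-! ### Recognising the pair `(A_q^k, Q_g)`, and existence of isotropic vectors -/

section Isometries

variable {E : Type*} [NormedAddCommGroup E] [InnerProductSpace ℝ E]

theorem exists_isometry_of_gram_eq {F : Type*} [NormedAddCommGroup F] [InnerProductSpace ℝ F]
    {ι : Type*} {b : ι → E} {c : ι → F} (hb : LinearIndependent ℝ b)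
    (hb' : Submodule.span ℝ (Set.range b) = ⊤) (hc : LinearIndependent ℝ c)
    (hc' : Submodule.span ℝ (Set.range c) = ⊤) (h : ∀ i j, ⟪b i, b j⟫_ℝ = ⟪c i, c j⟫_ℝ) :
    ∃ φ : E ≃ₗᵢ[ℝ] F, ∀ i, φ (b i) = c i := by
  let B := Module.Basis.mk hb hb'.ge
  let C := Module.Basis.mk hc hc'.ge
  let f : E ≃ₗ[ℝ] F := B.equiv C (Equiv.refl ι)
  have hf (i : ι) : f (B i) = C i := by simp [f]
  have hBf : (innerₗ F).compl₁₂ f.toLinearMap f.toLinearMap = innerₗ E := by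
    refine B.ext fun i => B.ext fun j => ?_
    change ⟪f (B i), f (B j)⟫_ℝ = ⟪B i, B j⟫_ℝ
    rw [hf, hf]
    simp only [B, C, Module.Basis.mk_apply, h]
  refine ⟨f.isometryOfInner fun x y => congrArg (fun g => g x y) hBf, fun i => ?_⟩
  have := hf i
  simp only [B, C, Module.Basis.mk_apply] at this
  exact this

theorem mapLattice_span {F : Type*} [NormedAddCommGroup F] [InnerProductSpace ℝ F] {ι : Type*}
    (φ : E ≃ₗᵢ[ℝ] F) {b : ι → E} {c : ι → F} (h : ∀ i, φ (b i) = c i) :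
    mapLattice φ (Submodule.span ℤ (Set.range b)) = Submodule.span ℤ (Set.range c) := by
  rw [mapLattice, Submodule.map_span, ← Set.range_comp]
  congr 2
  ext1 i
  exact h i

theorem span_real_top_of_isLatticeBasis {ι : Type*} {M : Submodule ℤ E} {b : ι → E}
    (hb : IsLatticeBasis M b) (hM : IsEvenLattice M) : Submodule.span ℝ (Set.range b) = ⊤ := by
  rw [← span_real_span_int, hb.span_eq, hM.span_eq_top]

variable {k q : ℕ}

/-- A labelled even lattice of the right determinant is isometric to `A_q^k`, in a way compatible
with the labels defined by a Weyl vector. -/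
theorem exists_isometry_latticeA [FiniteDimensional ℝ E] {L M : Submodule ℤ E}
    (hM : IsEvenLattice M) (hLM : L ≤ M) (hL : latticeRoots L = ∅)
    (hqk : (q = 4 ∧ k = 2) ∨ (q = 2 ∧ k = 3)) (ℓ : M →+ ZMod (q + 1))
    (hker : ∀ x : M, ℓ x = 0 ↔ (x : E) ∈ L) (hN : Module.finrank ℝ E = k * q)
    (hd : Nat.card (Res M) = (q + 1) ^ k) {ρ : spaceA k (q + 1)}
    {π : Fin k → Equiv.Perm (Fin (q + 1))} (hπ : ∀ i a,
      (ρ : EuclideanSpace ℝ (Fin k × Fin (q + 1))) (i, a) = ((π i a : ℕ) : ℝ) - q / 2) :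
    ∃ φ : E ≃ₗᵢ[ℝ] spaceA k (q + 1), mapLattice φ M = latticeA k (q + 1) ∧
      mapLattice φ L = latticeQ k (q + 1) ρ := by
  have hℓ : ∀ x : M, IsRoot x → ℓ x ≠ 0 := fun x hx h0 => by
    have : (x : E) ∈ latticeRoots L := ⟨(hker x).1 h0, hx⟩
    rw [hL] at this
    exact this
  obtain ⟨u, hu, horth, hspan⟩ : ∃ u : Fin k → Fin q → M, (∀ i, IsBlock (u i)) ∧
      (∀ i j, i ≠ j → ∀ a b, ⟪(u i a : E), (u j b : E)⟫_ℝ = 0) ∧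
      Submodule.span ℤ (Set.range fun x : Fin k × Fin q => u x.1 x.2) = ⊤ :=
    exists_full_config hM (p := q + 1) (k := k) (by omega) ℓ hℓ (by simpa using hN) hd
  -- the orderings of the coordinates
  have hcinj (i : Fin k) :
      Function.Injective (Fin.cons 0 fun a => ℓ (u i a) : Fin (q + 1) → ZMod (q + 1)) :=
    Fin.cons_injective_iff.2 ⟨by
      rintro ⟨a, ha⟩
      exact hℓ _ ((hu i).isRoot a) ha, (hu i).label_injective ℓ hℓ⟩
  let C (i : Fin k) : Fin (q + 1) ≃ ZMod (q + 1) := Equiv.ofBijective _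
    ((Fintype.bijective_iff_injective_and_card _).2 ⟨hcinj i, by simp [ZMod.card]⟩)
  -- The order is chosen so that `π` takes the value `0` on the base coordinate and the label of `u
  -- i a` on the coordinate matched with `a`; this uses that `ZMod (q + 1)` is `Fin (q + 1)`.
  let σ : Fin k → Equiv.Perm (Fin (q + 1)) := fun i => (C i).trans (π i).symm
  have hσ0 (i : Fin k) : ((π i (σ i 0) : ℕ) : ZMod (q + 1)) = 0 := by
    have : π i (σ i 0) = (0 : Fin (q + 1)) := (π i).apply_symm_apply (C i 0)
    rw [this]
    simp
  have hσ (i : Fin k) (a : Fin q) : ((π i (σ i a.succ) : ℕ) : ZMod (q + 1)) = ℓ (u i a) := by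
    have : π i (σ i a.succ) = (ℓ (u i a) : ZMod (q + 1)) :=
      (π i).apply_symm_apply (C i a.succ)
    rw [this]
    exact ZMod.natCast_zmod_val (ℓ (u i a))
  -- the isometry
  have hgram (x y : Fin k × Fin q) :
      ⟪(u x.1 x.2 : E), (u y.1 y.2 : E)⟫_ℝ = ⟪stdA σ x, stdA σ y⟫_ℝ := by
    obtain ⟨i, a⟩ := x
    obtain ⟨j, b⟩ := y
    rw [inner_stdA]
    by_cases hij : i = j
    · subst hij
      simpa using hu i a b
    · simpa [hij] using horth i j hij a b
  have hspan' : Submodule.span ℤ (Set.range fun x : Fin k × Fin q => (u x.1 x.2 : E)) = M := by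
    ext x
    constructor
    · intro hx
      refine Submodule.span_le.2 ?_ hx
      rintro _ ⟨y, rfl⟩
      exact (u y.1 y.2).2
    · intro hx
      exact (coe_mem_span_int (x := (⟨x, hx⟩ : M))).2 (hspan ▸ Submodule.mem_top)
  have hlb : IsLatticeBasis M fun x : Fin k × Fin q => (u x.1 x.2 : E) := by
    refine ⟨?_, hspan'⟩
    rw [← Matrix.det_gram_ne_zero_iff_linearIndependent,
      show (Matrix.gram ℝ fun x : Fin k × Fin q => (u x.1 x.2 : E)) = Matrix.gram ℝ (stdA σ) by
        ext x y; exact hgram x y, Matrix.det_gram_ne_zero_iff_linearIndependent]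
    exact linearIndependent_stdA σ
  obtain ⟨φ, hφ⟩ := exists_isometry_of_gram_eq hlb.linearIndependent
    (span_real_top_of_isLatticeBasis hlb hM) (linearIndependent_stdA σ) (span_real_stdA σ) hgram
  have hφM : mapLattice φ M = latticeA k (q + 1) := by
    rw [← hspan', mapLattice_span φ hφ, span_int_stdA]
  -- Enough on generators: the image of `u i a` is a root `e_b - e_c`, whose product with `ρ` is a
  -- difference of two values of `π`, congruent to the label by the choice of `σ`.
  have hlabel (x : M) : ∃ n : ℤ, ⟪φ x, ρ⟫_ℝ = n ∧ (n : ZMod (q + 1)) = ℓ x := by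
    have hx : x ∈ Submodule.span ℤ (Set.range fun x : Fin k × Fin q => u x.1 x.2) :=
      hspan ▸ Submodule.mem_top
    induction hx using Submodule.span_induction with
    | mem x hx =>
      obtain ⟨⟨i, a⟩, rfl⟩ := hx
      refine ⟨(π i (σ i a.succ) : ℕ) - (π i (σ i 0) : ℕ), ?_, ?_⟩
      · rw [hφ (i, a), real_inner_comm, stdA, inner_rootA, hπ, hπ]
        push_cast
        ring
      · push_cast
        rw [hσ, hσ0, sub_zero]
    | zero => exact ⟨0, by simp⟩
    | add x y _ _ hx hy =>
      obtain ⟨m, hm, hm'⟩ := hx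
      obtain ⟨n, hn, hn'⟩ := hy
      refine ⟨m + n, ?_, by rw [map_add, ← hm', ← hn']; push_cast; rfl⟩
      rw [Submodule.coe_add, map_add, inner_add_left, hm, hn]
      push_cast
      rfl
    | smul c x _ hx =>
      obtain ⟨m, hm, hm'⟩ := hx
      refine ⟨c * m, ?_, by rw [map_zsmul, ← hm']; simp⟩
      rw [Submodule.coe_smul, map_zsmul, ← Int.cast_smul_eq_zsmul ℝ, inner_smul_left, hm]
      simp
  refine ⟨φ, hφM, ?_⟩
  have hiff (x : M) : (∃ n : ℤ, ⟪φ x, ρ⟫_ℝ = ((q + 1 : ℕ) : ℝ) * n) ↔ (x : E) ∈ L := by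
    obtain ⟨m, hm, hm'⟩ := hlabel x
    rw [← hker, ← hm', ZMod.intCast_zmod_eq_zero_iff_dvd, hm]
    refine exists_congr fun n => ?_
    constructor <;> intro h <;> exact_mod_cast h
  ext y
  rw [mem_mapLattice]
  constructor
  · rintro ⟨x, hx, rfl⟩
    exact ⟨hφM.le ⟨x, hLM hx, rfl⟩, (hiff ⟨x, hLM hx⟩).2 hx⟩
  · rintro ⟨hyA, hy⟩
    obtain ⟨x, hx, rfl⟩ := (mem_mapLattice _ _ _).1 (hφM.ge hyA)
    exact ⟨x, (hiff ⟨x, hx⟩).1 hy, rfl⟩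

theorem zsmul_mem_of_res {L : Submodule ℤ E} {p m : ℕ} (e : Res L ≃+ (Fin m → ZMod p)) {x : E}
    (hx : x ∈ dualLattice L) : (p : ℤ) • x ∈ L := by
  rw [← mk_res_eq_zero ((dualLattice L).smul_mem _ hx)]
  have h1 : (L.submoduleOf (dualLattice L)).mkQ ⟨(p : ℤ) • x, (dualLattice L).smul_mem _ hx⟩ =
    (p : ℤ) • (L.submoduleOf (dualLattice L)).mkQ ⟨x, hx⟩ := rfl
  rw [h1, ← e.map_eq_zero_iff, map_zsmul]
  ext i
  simp

open MvPolynomial in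
/-- The discriminant group contains isotropic vectors as soon as it has rank at least three. -/
theorem exists_isotropic {L : Submodule ℤ E} (hL : IsEvenLattice L) {p m : ℕ} (hp : p.Prime)
    (hp2 : p ≠ 2) (hm : 3 ≤ m) (e : Res L ≃+ (Fin m → ZMod p)) :
    ∃ x ∈ dualLattice L, x ∉ L ∧ ∃ n : ℤ, ⟪x, x⟫_ℝ = 2 * n := by
  classical
  have : Fact p.Prime := ⟨hp⟩
  have hp0 : (p : ℝ) ≠ 0 := by exact_mod_cast hp.ne_zero
  have hlift (i : Fin 3) : ∃ y : dualLattice L, (L.submoduleOf (dualLattice L)).mkQ y =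
      e.symm (Pi.single (Fin.castLE hm i) 1) := Submodule.mkQ_surjective _ _
  choose y hy using hlift
  have hB (i j : Fin 3) : ∃ n : ℤ, (p : ℝ) * ⟪(y i : E), (y j : E)⟫_ℝ = n := by
    obtain ⟨n, hn⟩ := mem_dualLattice.1 (y i).2 _ (zsmul_mem_of_res e (y j).2)
    refine ⟨n, ?_⟩
    rw [← hn, ← Int.cast_smul_eq_zsmul ℝ, inner_smul_right]
    simp
  choose B hB using hB
  -- The norm of `p y i ∈ L` is `p * B i i`; it is even and `p` is odd.
  have heven (i : Fin 3) : ∃ n : ℤ, B i i = 2 * n := by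
    obtain ⟨n, hn⟩ := hL.even _ (zsmul_mem_of_res e (y i).2)
    rw [← Int.cast_smul_eq_zsmul ℝ, inner_smul_right, inner_smul_left, RCLike.conj_to_real] at hn
    push_cast at hn
    rw [hB] at hn
    have h1 : (p : ℤ) * B i i = 2 * n := by exact_mod_cast hn
    have h2 : (2 : ℤ) ∣ p * B i i := ⟨n, h1⟩
    refine (Int.Prime.dvd_mul' Nat.prime_two h2).resolve_left fun h => hp2 ?_
    have h3 : 2 ∣ p := by exact_mod_cast h
    exact ((Nat.prime_dvd_prime_iff_eq Nat.prime_two hp).1 h3).symm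
  choose b hb using heven
  -- `p` times half the norm of `∑ Xᵢ yᵢ`, reduced modulo `p`.
  let f : MvPolynomial (Fin 3) (ZMod p) :=
    C (b 0 : ZMod p) * X 0 ^ 2 + C (b 1 : ZMod p) * X 1 ^ 2 + C (b 2 : ZMod p) * X 2 ^ 2 +
    C (B 0 1 : ZMod p) * (X 0 * X 1) + C (B 0 2 : ZMod p) * (X 0 * X 2) +
    C (B 1 2 : ZMod p) * (X 1 * X 2)
  have hsq (c : ZMod p) (i : Fin 3) : (C c * X i ^ 2 : MvPolynomial (Fin 3) (ZMod p)).totalDegree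
      ≤ 2 := by
    refine (totalDegree_mul _ _).trans ?_
    have := totalDegree_X_pow (R := ZMod p) i 2
    rw [totalDegree_C]
    omega
  have hmul (c : ZMod p) (i j : Fin 3) :
      (C c * (X i * X j) : MvPolynomial (Fin 3) (ZMod p)).totalDegree ≤ 2 := by
    refine (totalDegree_mul _ _).trans ?_
    have h1 := totalDegree_mul (X i : MvPolynomial (Fin 3) (ZMod p)) (X j)
    rw [totalDegree_X, totalDegree_X] at h1
    rw [totalDegree_C]
    omega
  have hdeg : f.totalDegree < Fintype.card (Fin 3) := by
    have : f.totalDegree ≤ 2 := by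
      refine (totalDegree_add _ _).trans (max_le ?_ (hmul _ _ _))
      refine (totalDegree_add _ _).trans (max_le ?_ (hmul _ _ _))
      refine (totalDegree_add _ _).trans (max_le ?_ (hmul _ _ _))
      refine (totalDegree_add _ _).trans (max_le ?_ (hsq _ _))
      exact (totalDegree_add _ _).trans (max_le (hsq _ _) (hsq _ _))
    simpa using lt_of_le_of_lt this (by norm_num)
  -- Chevalley–Warning: degree two in three variables, so the number of zeros is divisible by `p`
  -- and the trivial zero is not the only one.
  have hcw := char_dvd_card_solutions p hdeg
  obtain ⟨t, ht0, ht⟩ : ∃ t : Fin 3 → ZMod p, t ≠ 0 ∧ eval t f = 0 := by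
    by_contra! hcon
    have : Fintype.card { x : Fin 3 → ZMod p // eval x f = 0 } = 1 := by
      rw [Fintype.card_eq_one_iff]
      refine ⟨⟨0, by simp [f]⟩, fun z => ?_⟩
      ext1
      by_contra hz
      exact hcon z hz z.2
    rw [this] at hcw
    exact hp.one_lt.ne' (Nat.dvd_one.1 hcw)
  let n : Fin 3 → ℤ := fun i => (t i).val
  have hn (i : Fin 3) : (n i : ZMod p) = t i := by simp [n]
  have hF : (p : ℤ) ∣ b 0 * n 0 ^ 2 + b 1 * n 1 ^ 2 + b 2 * n 2 ^ 2 + B 0 1 * (n 0 * n 1) +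
      B 0 2 * (n 0 * n 2) + B 1 2 * (n 1 * n 2) := by
    rw [← ZMod.intCast_zmod_eq_zero_iff_dvd]
    push_cast
    simp only [hn]
    simpa [f] using ht
  obtain ⟨c, hc⟩ := hF
  let x : dualLattice L := n 0 • y 0 + n 1 • y 1 + n 2 • y 2
  refine ⟨x, x.2, fun hxL => ht0 ?_, c, ?_⟩
  · rw [← mk_res_eq_zero x.2] at hxL
    have h1 : (L.submoduleOf (dualLattice L)).mkQ x = 0 := hxL
    simp only [x, map_add, map_zsmul, hy] at h1
    have h2 := congrArg e h1
    simp only [map_add, map_zsmul, e.apply_symm_apply, map_zero] at h2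
    ext i
    have h3 := congrFun h2 (Fin.castLE hm i)
    fin_cases i <;> simpa [Pi.single_apply, hn] using h3
  · have hc' : (b 0 * n 0 ^ 2 + b 1 * n 1 ^ 2 + b 2 * n 2 ^ 2 + B 0 1 * (n 0 * n 1) +
      B 0 2 * (n 0 * n 2) + B 1 2 * (n 1 * n 2) : ℝ) = p * c := by exact_mod_cast hc
    have hbr (i : Fin 3) : (p : ℝ) * ⟪(y i : E), (y i : E)⟫_ℝ = 2 * b i := by
      rw [hB, hb]; push_cast; rfl
    have hsym := fun i j => real_inner_comm (y i : E) (y j : E)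
    have key : (p : ℝ) * ⟪(x : E), (x : E)⟫_ℝ = p * (2 * c) := by
      have hx : (x : E) = (n 0 : ℝ) • (y 0 : E) + (n 1 : ℝ) • (y 1 : E) + (n 2 : ℝ) • (y 2 : E) := by
        simp [x, Int.cast_smul_eq_zsmul]
      rw [hx]
      simp only [inner_add_left, inner_add_right, inner_smul_left, inner_smul_right,
        RCLike.conj_to_real]
      rw [hsym 0 1, hsym 0 2, hsym 1 2]
      linear_combination 2 * hc' + (n 0 : ℝ) ^ 2 * hbr 0 + (n 1 : ℝ) ^ 2 * hbr 1 +
        (n 2 : ℝ) ^ 2 * hbr 2 + 2 * (n 0 : ℝ) * n 1 * hB 0 1 + 2 * (n 0 : ℝ) * n 2 * hB 0 2 +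
        2 * (n 1 : ℝ) * n 2 * hB 1 2
    exact mul_left_cancel₀ hp0 key

end Isometries

/-! ### The lattice `Q_g`: rootlessness and discriminant group -/

section WeylSublattice

variable {E : Type*} [NormedAddCommGroup E] [InnerProductSpace ℝ E] {k q : ℕ}

theorem exists_int_hom {M : Submodule ℤ E} (ρ : E) (h : ∀ x ∈ M, ∃ n : ℤ, ⟪x, ρ⟫_ℝ = n) :
    ∃ f : M →+ ℤ, ∀ x : M, ⟪(x : E), ρ⟫_ℝ = f x := by
  choose f hf using fun x : M => h x x.2
  refine ⟨AddMonoidHom.mk' f fun x y => ?_, hf⟩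
  have : ((f (x + y) : ℤ) : ℝ) = ((f x + f y : ℤ) : ℝ) := by
    rw [← hf, Submodule.coe_add, inner_add_left, hf, hf]
    push_cast
    rfl
  exact_mod_cast this

/-- `L` has index `q + 1` in the inverse image of `D`, which cuts the determinant from `(q + 1) ^ (k
+ 2)` to `(q + 1) ^ k` and makes `L` the kernel of a label, as `exists_isometry_latticeA` requires.
-/
theorem exists_isometry_of_line [FiniteDimensional ℝ E] {L : Submodule ℤ E}
    (hqk : (q = 4 ∧ k = 2) ∨ (q = 2 ∧ k = 3)) (hL : IsEvenRootless (k * q) (q + 1) (k + 2) L)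
    {D : Submodule ℤ (Res L)} (hD : ∀ x ∈ D, resForm hL.1 x = 0) (hcard : Nat.card D = q + 1)
    {ρ : spaceA k (q + 1)} {π : Fin k → Equiv.Perm (Fin (q + 1))} (hπ : ∀ i a,
      (ρ : EuclideanSpace ℝ (Fin k × Fin (q + 1))) (i, a) = ((π i a : ℕ) : ℝ) - q / 2) :
    ∃ φ : E ≃ₗᵢ[ℝ] spaceA k (q + 1), mapLattice φ (resPreimage L D) = latticeA k (q + 1) ∧
      mapLattice φ L = latticeQ k (q + 1) ρ := by
  have hprime : (q + 1).Prime := by rcases hqk with ⟨rfl, -⟩ | ⟨rfl, -⟩ <;> norm_num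
  obtain ⟨hLe, hN, hroots, ⟨e⟩⟩ := hL
  have hM := isEvenLattice_resPreimage hLe hD
  have hidx : L.toAddSubgroup.relIndex (resPreimage L D).toAddSubgroup = q + 1 := by
    rw [relIndex_resPreimage, hcard]
  obtain ⟨ℓ, hℓ⟩ := exists_label hprime hidx
  refine exists_isometry_latticeA hM (le_resPreimage hLe D) hroots hqk ℓ hℓ hN ?_ hπ
  have h1 := card_res_sublattice hLe hM (le_resPreimage hLe D)
  have h2 : Nat.card (Res L) = (q + 1) ^ (k + 2) := by
    rw [Nat.card_congr e.toEquiv]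
    simp
  rw [h2, hidx, pow_add, mul_comm] at h1
  exact (Nat.eq_of_mul_eq_mul_left (pow_pos (Nat.succ_pos q) 2) h1).symm

theorem card_span_singleton_of_prime {G : Type*} [AddCommGroup G] {p : ℕ} (hp : p.Prime) {y : G}
    (hy : p • y = 0) (hy0 : y ≠ 0) : Nat.card (Submodule.span ℤ {y}) = p := by
  have : Fact p.Prime := ⟨hp⟩
  rw [← addOrderOf_eq_prime hy hy0, ← Nat.card_zmultiples]
  refine Nat.card_congr (Equiv.subtypeEquivRight fun z => ?_)
  rw [Submodule.mem_span_singleton, AddSubgroup.mem_zmultiples_iff]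

theorem latticeIsometric_latticeQ [FiniteDimensional ℝ E] {L : Submodule ℤ E}
    (hqk : (q = 4 ∧ k = 2) ∨ (q = 2 ∧ k = 3)) (hL : IsEvenRootless (k * q) (q + 1) (k + 2) L)
    {ρ : spaceA k (q + 1)} {π : Fin k → Equiv.Perm (Fin (q + 1))} (hπ : ∀ i a,
      (ρ : EuclideanSpace ℝ (Fin k × Fin (q + 1))) (i, a) = ((π i a : ℕ) : ℝ) - q / 2) :
    LatticeIsometric L (latticeQ k (q + 1) ρ) := by
  have hprime : (q + 1).Prime := by rcases hqk with ⟨rfl, -⟩ | ⟨rfl, -⟩ <;> norm_num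
  obtain ⟨e⟩ := hL.2.2.2
  obtain ⟨x, hx, hxL, n, hn⟩ := exists_isotropic hL.1 hprime (by omega) (by omega) e
  set y := (L.submoduleOf (dualLattice L)).mkQ ⟨x, hx⟩ with hy
  have hy0 : y ≠ 0 := fun h => hxL ((mk_res_eq_zero hx).1 h)
  have hq : resForm hL.1 y = 0 := (resForm_mk hL.1 hx).2 ⟨n, hn⟩
  obtain ⟨φ, -, hφ⟩ := exists_isometry_of_line hqk hL (D := Submodule.span ℤ {y}) (by
      intro z hz
      obtain ⟨c, rfl⟩ := Submodule.mem_span_singleton.1 hz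
      rw [QuadraticMap.map_smul, hq, smul_zero])
    (card_span_singleton_of_prime hprime (by
      have h1 := (mk_res_eq_zero ((dualLattice L).smul_mem _ hx)).2 (zsmul_mem_of_res e hx)
      rw [← natCast_zsmul]
      exact h1) hy0) hπ
  exact ⟨φ, hφ⟩

variable {ρ : spaceA k (q + 1)} {π : Fin k → Equiv.Perm (Fin (q + 1))}

theorem latticeQ_le : latticeQ k (q + 1) ρ ≤ latticeA k (q + 1) := fun _ hx => hx.1

theorem inner_rootA_weyl (hπ : ∀ i a,
      (ρ : EuclideanSpace ℝ (Fin k × Fin (q + 1))) (i, a) = ((π i a : ℕ) : ℝ) - q / 2)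
    (i : Fin k) (a b : Fin (q + 1)) :
    ⟪rootA i a b, ρ⟫_ℝ = (((π i a : ℕ) - (π i b : ℕ) : ℤ) : ℝ) := by
  rw [real_inner_comm, inner_rootA, hπ, hπ]
  push_cast
  ring

theorem exists_inner_weyl (hπ : ∀ i a,
      (ρ : EuclideanSpace ℝ (Fin k × Fin (q + 1))) (i, a) = ((π i a : ℕ) : ℝ) - q / 2)
    {x : spaceA k (q + 1)} (hx : x ∈ latticeA k (q + 1)) : ∃ n : ℤ, ⟪x, ρ⟫_ℝ = n := by
  rw [← span_int_stdA fun _ => 1] at hx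
  induction hx using Submodule.span_induction with
  | mem x hx =>
    obtain ⟨y, rfl⟩ := hx
    exact ⟨_, inner_rootA_weyl hπ _ _ _⟩
  | zero => exact ⟨0, by simp⟩
  | add x y _ _ hx hy =>
    obtain ⟨m, hm⟩ := hx
    obtain ⟨n, hn⟩ := hy
    exact ⟨m + n, by rw [inner_add_left, hm, hn]; push_cast; rfl⟩
  | smul c x _ hx =>
    obtain ⟨m, hm⟩ := hx
    exact ⟨c * m, by rw [← Int.cast_smul_eq_zsmul ℝ, inner_smul_left, hm]; simp⟩

theorem smul_mem_latticeQ (hπ : ∀ i a,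
      (ρ : EuclideanSpace ℝ (Fin k × Fin (q + 1))) (i, a) = ((π i a : ℕ) : ℝ) - q / 2)
    {x : spaceA k (q + 1)} (hx : x ∈ latticeA k (q + 1)) :
    ((q + 1 : ℕ) : ℤ) • x ∈ latticeQ k (q + 1) ρ := by
  obtain ⟨n, hn⟩ := exists_inner_weyl hπ hx
  refine ⟨(latticeA k (q + 1)).smul_mem _ hx, n, ?_⟩
  rw [← Int.cast_smul_eq_zsmul ℝ, inner_smul_left, hn]
  simp

theorem isEvenLattice_latticeQ (hπ : ∀ i a,
      (ρ : EuclideanSpace ℝ (Fin k × Fin (q + 1))) (i, a) = ((π i a : ℕ) : ℝ) - q / 2) :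
    IsEvenLattice (latticeQ k (q + 1) ρ) := by
  refine isEvenLattice_of_even ?_ fun x hx => isEvenLattice_latticeA.even x hx.1
  rw [eq_top_iff, ← (isEvenLattice_latticeA (k := k) (q := q)).span_eq_top]
  refine Submodule.span_le.2 fun x hx => ?_
  have h1 := Submodule.subset_span (R := ℝ) (s := (latticeQ k (q + 1) ρ : Set (spaceA k (q + 1))))
    (smul_mem_latticeQ hπ hx)
  rw [← Int.cast_smul_eq_zsmul ℝ] at h1
  have h2 := Submodule.smul_mem _ (((((q + 1 : ℕ) : ℤ) : ℝ))⁻¹) h1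
  rwa [inv_smul_smul₀ (by push_cast; positivity)] at h2

/-- The product of a root with `ρ` is a difference of two distinct integers between `0` and `q`, so
`q + 1` does not divide it. -/
theorem latticeRoots_latticeQ (hπ : ∀ i a,
      (ρ : EuclideanSpace ℝ (Fin k × Fin (q + 1))) (i, a) = ((π i a : ℕ) : ℝ) - q / 2) :
    latticeRoots (latticeQ k (q + 1) ρ) = ∅ := by
  rw [Set.eq_empty_iff_forall_notMem]
  rintro x ⟨⟨hx, n, hn⟩, h2⟩
  obtain ⟨i, a, b, hab, rfl⟩ := exists_rootA hx h2
  rw [inner_rootA_weyl hπ] at hn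
  have h3 : ((π i a : ℕ) - (π i b : ℕ) : ℤ) = ((q + 1 : ℕ) : ℤ) * n := by exact_mod_cast hn
  have h4 := (π i a).isLt
  have h5 := (π i b).isLt
  have hne : (π i a : ℕ) ≠ (π i b : ℕ) := fun h => hab ((π i).injective (Fin.ext h))
  have hn0 : n = 0 := by
    by_contra h0
    rcases lt_or_gt_of_ne h0 with h | h
    · have : ((q + 1 : ℕ) : ℤ) * n ≤ ((q + 1 : ℕ) : ℤ) * (-1) := by
        refine mul_le_mul_of_nonneg_left (by omega) (by positivity)
      omega
    · have : ((q + 1 : ℕ) : ℤ) * 1 ≤ ((q + 1 : ℕ) : ℤ) * n := by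
        refine mul_le_mul_of_nonneg_left (by omega) (by positivity)
      omega
  rw [hn0, mul_zero] at h3
  omega

theorem relIndex_latticeQ (hk : 0 < k) (hq : 0 < q) (hπ : ∀ i a,
      (ρ : EuclideanSpace ℝ (Fin k × Fin (q + 1))) (i, a) = ((π i a : ℕ) : ℝ) - q / 2) :
    (latticeQ k (q + 1) ρ).toAddSubgroup.relIndex (latticeA k (q + 1)).toAddSubgroup = q + 1 := by
  obtain ⟨f, hf⟩ := exists_int_hom ρ fun x hx => exists_inner_weyl hπ hx
  let g : latticeA k (q + 1) →+ ZMod (q + 1) := (Int.castAddHom (ZMod (q + 1))).comp f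
  have hker : (latticeQ k (q + 1) ρ).toAddSubgroup.addSubgroupOf
      (latticeA k (q + 1)).toAddSubgroup = g.ker := by
    ext x
    rw [AddMonoidHom.mem_ker]
    change (x : spaceA k (q + 1)) ∈ latticeQ k (q + 1) ρ ↔ ((f x : ℤ) : ZMod (q + 1)) = 0
    rw [ZMod.intCast_zmod_eq_zero_iff_dvd]
    constructor
    · rintro ⟨-, n, hn⟩
      have h := hf x
      rw [hn] at h
      exact ⟨n, by exact_mod_cast h.symm⟩
    · rintro ⟨n, hn⟩
      refine ⟨x.2, n, ?_⟩
      rw [hf, hn]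
      push_cast
      rfl
  rw [AddSubgroup.relIndex, hker, AddSubgroup.index_ker]
  -- A root joining two coordinates consecutive in the order of `ρ` has label `1`.
  have hsurj : Function.Surjective g := by
    let i : Fin k := ⟨0, hk⟩
    let x : latticeA k (q + 1) := ⟨rootA i ((π i).symm ⟨1, by omega⟩) ((π i).symm 0), rootA_mem _ _ _⟩
    have hx : g x = 1 := by
      have h := hf x
      rw [inner_rootA_weyl hπ] at h
      simp only [Equiv.apply_symm_apply] at h
      have h1 : f x = 1 := by
        have : ((f x : ℤ) : ℝ) = 1 := by rw [← h]; simp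
        exact_mod_cast this
      change ((f x : ℤ) : ZMod (q + 1)) = 1
      rw [h1]
      simp
    intro c
    refine ⟨c.val • x, ?_⟩
    rw [map_nsmul, hx]
    simp
  rw [AddMonoidHom.range_eq_top.2 hsurj]
  simp

/-- Since `q` is even, `ρ` is integral; its norm is `2 * 10 = 5 * 4` or `3 * 2 = 3 * 2`, divisible
by `q + 1` in each case. -/
theorem weyl_mem_latticeQ (hqk : (q = 4 ∧ k = 2) ∨ (q = 2 ∧ k = 3)) (hπ : ∀ i a,
      (ρ : EuclideanSpace ℝ (Fin k × Fin (q + 1))) (i, a) = ((π i a : ℕ) : ℝ) - q / 2) :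
    ρ ∈ latticeQ k (q + 1) ρ := by
  have hint : ρ ∈ latticeA k (q + 1) := by
    rintro ⟨i, a⟩
    rw [hπ]
    rcases hqk with ⟨rfl, -⟩ | ⟨rfl, -⟩
    · exact ⟨(π i a : ℕ) - 2, by push_cast; norm_num⟩
    · exact ⟨(π i a : ℕ) - 1, by push_cast; norm_num⟩
  have hsum (i : Fin k) : ∑ a, (((π i a : ℕ) : ℝ) - q / 2) * (((π i a : ℕ) : ℝ) - q / 2) =
      ∑ a : Fin (q + 1), (((a : ℕ) : ℝ) - q / 2) * (((a : ℕ) : ℝ) - q / 2) :=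
    Equiv.sum_comp (π i) fun a => (((a : ℕ) : ℝ) - q / 2) * (((a : ℕ) : ℝ) - q / 2)
  have hnorm : ⟪ρ, ρ⟫_ℝ = k * ∑ a : Fin (q + 1), (((a : ℕ) : ℝ) - q / 2) * (((a : ℕ) : ℝ) - q / 2) := by
    rw [inner_spaceA]
    simp only [hπ, hsum]
    simp
  rcases hqk with ⟨rfl, rfl⟩ | ⟨rfl, rfl⟩
  · exact ⟨hint, 4, by rw [hnorm]; simp [Fin.sum_univ_succ]; norm_num⟩
  · exact ⟨hint, 2, by rw [hnorm]; simp [Fin.sum_univ_succ]; norm_num⟩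

/-- The vector `(q + 1) e_a - ∑ e_b` of the `i`-th summand. -/
noncomputable def projA (i : Fin k) (a : Fin (q + 1)) : spaceA k (q + 1) :=
  ∑ b, rootA i a b

theorem inner_projA (x : spaceA k (q + 1)) (i : Fin k) (a : Fin (q + 1)) :
    ⟪x, projA i a⟫_ℝ = (q + 1) * (x : EuclideanSpace ℝ (Fin k × Fin (q + 1))) (i, a) := by
  rw [projA, inner_sum]
  simp only [inner_rootA, Finset.sum_sub_distrib, sum_spaceA, sub_zero]
  simp

/-- Two kinds of vectors of `Q_g` suffice. Integrality against `projA i a` says that `(q + 1) x` has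
integral coordinates; integrality against `ρ`, itself in `Q_g`, gives the congruence for `(q + 1)
x`. -/
theorem zsmul_mem_latticeQ_of_dual (hqk : (q = 4 ∧ k = 2) ∨ (q = 2 ∧ k = 3)) (hπ : ∀ i a,
      (ρ : EuclideanSpace ℝ (Fin k × Fin (q + 1))) (i, a) = ((π i a : ℕ) : ℝ) - q / 2)
    {x : spaceA k (q + 1)} (hx : x ∈ dualLattice (latticeQ k (q + 1) ρ)) :
    ((q + 1 : ℕ) : ℤ) • x ∈ latticeQ k (q + 1) ρ := by
  have hρ := weyl_mem_latticeQ hqk hπ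
  rw [mem_dualLattice] at hx
  refine ⟨?_, ?_⟩
  · rintro ⟨i, a⟩
    obtain ⟨m, hm⟩ := hρ.1 (i, a)
    have hmem : projA i a ∈ latticeQ k (q + 1) ρ := by
      refine ⟨Submodule.sum_mem _ fun b _ => rootA_mem i a b, m, ?_⟩
      rw [real_inner_comm, inner_projA, hm]
      push_cast
      rfl
    obtain ⟨n, hn⟩ := hx _ hmem
    refine ⟨n, ?_⟩
    rw [← hn, inner_projA, ← Int.cast_smul_eq_zsmul ℝ, Submodule.coe_smul, PiLp.smul_apply,
      smul_eq_mul]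
    push_cast
    rfl
  · obtain ⟨n, hn⟩ := hx _ hρ
    refine ⟨n, ?_⟩
    rw [← Int.cast_smul_eq_zsmul ℝ, inner_smul_left, hn]
    simp

theorem isEvenRootless_latticeQ (hqk : (q = 4 ∧ k = 2) ∨ (q = 2 ∧ k = 3)) (hπ : ∀ i a,
      (ρ : EuclideanSpace ℝ (Fin k × Fin (q + 1))) (i, a) = ((π i a : ℕ) : ℝ) - q / 2) :
    IsEvenRootless (k * q) (q + 1) (k + 2) (latticeQ k (q + 1) ρ) := by
  have hprime : (q + 1).Prime := by rcases hqk with ⟨rfl, -⟩ | ⟨rfl, -⟩ <;> norm_num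
  refine ⟨isEvenLattice_latticeQ hπ, finrank_spaceA, latticeRoots_latticeQ hπ,
    nonempty_addEquiv_of_card hprime (fun y => ?_) ?_⟩
  · obtain ⟨⟨x, hx⟩, rfl⟩ := Submodule.mkQ_surjective _ y
    have h1 := (mk_res_eq_zero ((dualLattice _).smul_mem _ hx)).2
      (zsmul_mem_latticeQ_of_dual hqk hπ hx)
    rw [← natCast_zsmul]
    exact h1
  · rw [card_res_sublattice (isEvenLattice_latticeQ hπ) isEvenLattice_latticeA latticeQ_le,
      relIndex_latticeQ (by omega) (by omega) hπ, card_res_latticeA]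
    ring

end WeylSublattice

/-! ### Glue vectors and the even overlattices of `A_q^k` -/

section Glue

variable {k q : ℕ}

/-- The glue vectors `∑ tᵢ ωᵢ` of `A_q^k`, where `ωᵢ` generates the discriminant group of the
`i`-th summand. -/
noncomputable def glueA : (Fin k → ℤ) →ₗ[ℤ] spaceA k (q + 1) :=
  (AddMonoidHom.mk' (fun t : Fin k → ℤ => (⟨WithLp.toLp 2 fun y : Fin k × Fin (q + 1) =>
      (t y.1 : ℝ) / (q + 1) - if y.2 = 0 then (t y.1 : ℝ) else 0, fun i => by
    have : (q + 1 : ℝ) ≠ 0 := by positivity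
    simp only [Finset.sum_sub_distrib, Finset.sum_const, Finset.card_univ, Fintype.card_fin,
      nsmul_eq_mul, Finset.sum_ite_eq', Finset.mem_univ, if_true]
    push_cast
    field_simp
    ring⟩ : spaceA k (q + 1))) fun s t => spaceA_ext fun i a => by
    simp only [Pi.add_apply, Int.cast_add, Submodule.coe_add, PiLp.add_apply]
    split_ifs <;> ring).toIntLinearMap

theorem glueA_apply (t : Fin k → ℤ) (i : Fin k) (a : Fin (q + 1)) :
    ((glueA t : spaceA k (q + 1)) : EuclideanSpace ℝ (Fin k × Fin (q + 1))) (i, a) =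
      (t i : ℝ) / (q + 1) - if a = 0 then (t i : ℝ) else 0 := rfl

theorem inner_glueA (x : spaceA k (q + 1)) (t : Fin k → ℤ) :
    ⟪x, glueA t⟫_ℝ = -∑ i, (t i : ℝ) * (x : EuclideanSpace ℝ (Fin k × Fin (q + 1))) (i, 0) := by
  rw [inner_spaceA, ← Finset.sum_neg_distrib]
  refine Finset.sum_congr rfl fun i _ => ?_
  simp only [glueA_apply, mul_sub, Finset.sum_sub_distrib, ← Finset.sum_mul, sum_spaceA]
  simp [mul_comm]

theorem inner_glueA_glueA (s t : Fin k → ℤ) :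
    ⟪(glueA s : spaceA k (q + 1)), glueA t⟫_ℝ = q * ((∑ i, s i * t i : ℤ) : ℝ) / (q + 1) := by
  have : (q + 1 : ℝ) ≠ 0 := by positivity
  rw [inner_glueA, ← Finset.sum_neg_distrib]
  push_cast
  rw [Finset.mul_sum, Finset.sum_div]
  refine Finset.sum_congr rfl fun i _ => ?_
  rw [glueA_apply, if_pos rfl]
  field_simp
  ring

theorem inner_glueA_rootA (t : Fin k → ℤ) (i : Fin k) {a : Fin (q + 1)} (ha : a ≠ 0) :
    ⟪(glueA t : spaceA k (q + 1)), rootA i a 0⟫_ℝ = t i := by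
  rw [inner_rootA, glueA_apply, glueA_apply, if_neg ha, if_pos rfl]
  ring

theorem exists_inner_glueA {x : spaceA k (q + 1)} (hx : x ∈ latticeA k (q + 1)) (t : Fin k → ℤ) :
    ∃ n : ℤ, ⟪x, glueA t⟫_ℝ = n := by
  choose n hn using hx
  refine ⟨-∑ i, t i * n (i, 0), ?_⟩
  rw [inner_glueA]
  simp only [hn]
  push_cast
  rfl

theorem glueA_mem_dual (t : Fin k → ℤ) : glueA t ∈ dualLattice (latticeA k (q + 1)) :=
  mem_dualLattice.2 fun y hy => by
    rw [real_inner_comm]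
    exact exists_inner_glueA hy t

theorem glueA_mem_iff (t : Fin k → ℤ) :
    glueA t ∈ latticeA k (q + 1) ↔ ∀ i, ((q + 1 : ℕ) : ℤ) ∣ t i := by
  have hq : (q + 1 : ℝ) ≠ 0 := by positivity
  constructor
  · intro h i
    obtain ⟨n, hn⟩ := h (i, 0)
    rw [glueA_apply, if_pos rfl] at hn
    refine ⟨n + t i, ?_⟩
    field_simp at hn
    have : ((t i : ℤ) : ℝ) = (((q + 1 : ℕ) : ℤ) * (n + t i) : ℤ) := by
      push_cast
      linarith
    exact_mod_cast this
  · rintro h ⟨i, a⟩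
    obtain ⟨n, hn⟩ := h i
    refine ⟨n - if a = 0 then t i else 0, ?_⟩
    rw [glueA_apply]
    have : (t i : ℝ) / (q + 1) = n := by
      rw [hn]
      push_cast
      field_simp
    rw [this]
    push_cast
    rfl

theorem exists_sub_glueA_mem {x : spaceA k (q + 1)} (hx : x ∈ dualLattice (latticeA k (q + 1))) :
    ∃ t : Fin k → ℤ, x - glueA t ∈ latticeA k (q + 1) := by
  have hq : (q + 1 : ℝ) ≠ 0 := by positivity
  choose n hn using fun (i : Fin k) (a : Fin (q + 1)) =>
    mem_dualLattice.1 hx (rootA i a 0) (rootA_mem i a 0)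
  simp only [inner_rootA] at hn
  refine ⟨fun i => -∑ a, n i a, ?_⟩
  rintro ⟨i, a⟩
  refine ⟨n i a - if a = 0 then ∑ a, n i a else 0, ?_⟩
  have h0 : ((∑ a, n i a : ℤ) : ℝ) =
      -((q + 1) * (x : EuclideanSpace ℝ (Fin k × Fin (q + 1))) (i, 0)) := by
    push_cast
    simp only [← hn, Finset.sum_sub_distrib, sum_spaceA]
    simp
  rw [Submodule.coe_sub, PiLp.sub_apply, glueA_apply]
  push_cast at h0 ⊢
  rw [← hn, h0]
  split_ifs <;> field_simp <;> ring

/-- Glue vectors have product `q ∑ sᵢ tᵢ / (q + 1)`, and `q ≡ -1` modulo `q + 1`: up to sign, the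
discriminant group carries the standard form on `(ℤ/(q+1))^k`. -/
theorem inner_of_sub_glueA_mem {x y : spaceA k (q + 1)} {s t : Fin k → ℤ}
    (hx : x - glueA s ∈ latticeA k (q + 1)) (hy : y - glueA t ∈ latticeA k (q + 1)) :
    ∃ n : ℤ, ⟪x, y⟫_ℝ = n - ((∑ i, s i * t i : ℤ) : ℝ) / (q + 1) := by
  have hq : (q + 1 : ℝ) ≠ 0 := by positivity
  obtain ⟨a, ha⟩ := exists_inner_glueA hx t
  obtain ⟨b, hb⟩ := exists_inner_glueA hy s
  obtain ⟨c, hc⟩ := isEvenLattice_latticeA.exists_inner_eq hx hy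
  refine ⟨a + b + c + ∑ i, s i * t i, ?_⟩
  have h : ⟪x, y⟫_ℝ = ⟪x - glueA s, y - glueA t⟫_ℝ + ⟪x - glueA s, glueA t⟫_ℝ +
      ⟪y - glueA t, glueA s⟫_ℝ + ⟪(glueA s : spaceA k (q + 1)), glueA t⟫_ℝ := by
    rw [real_inner_comm (glueA s) (y - glueA t)]
    simp only [inner_sub_left, inner_sub_right]
    ring
  rw [h, ha, hb, hc, inner_glueA_glueA]
  push_cast
  field_simp
  ring

theorem inner_self_of_sub_glueA_mem {x : spaceA k (q + 1)} {t : Fin k → ℤ}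
    (hx : x - glueA t ∈ latticeA k (q + 1)) :
    ∃ n : ℤ, ⟪x, x⟫_ℝ = 2 * n + q * ((∑ i, t i * t i : ℤ) : ℝ) / (q + 1) := by
  obtain ⟨a, ha⟩ := exists_inner_glueA hx t
  obtain ⟨c, hc⟩ := isEvenLattice_latticeA.even _ hx
  refine ⟨a + c, ?_⟩
  have h : ⟪x, x⟫_ℝ = ⟪x - glueA t, x - glueA t⟫_ℝ + 2 * ⟪x - glueA t, glueA t⟫_ℝ +
      ⟪(glueA t : spaceA k (q + 1)), glueA t⟫_ℝ := by
    simp only [inner_sub_left, inner_sub_right, real_inner_comm x (glueA t)]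
    ring
  rw [h, ha, hc, inner_glueA_glueA]
  push_cast
  ring

theorem dvd_of_inner_int {x y : spaceA k (q + 1)} {s t : Fin k → ℤ}
    (hx : x - glueA s ∈ latticeA k (q + 1)) (hy : y - glueA t ∈ latticeA k (q + 1))
    (h : ∃ n : ℤ, ⟪x, y⟫_ℝ = n) : ∑ i, (s i : ZMod (q + 1)) * t i = 0 := by
  have hq : (q + 1 : ℝ) ≠ 0 := by positivity
  obtain ⟨m, hm⟩ := inner_of_sub_glueA_mem hx hy
  obtain ⟨n, hn⟩ := h
  have h1 : (∑ i, s i * t i : ℤ) = ((q + 1 : ℕ) : ℤ) * (m - n) := by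
    rw [hn] at hm
    field_simp at hm
    have : ((∑ i, s i * t i : ℤ) : ℝ) = (((q + 1 : ℕ) : ℤ) * (m - n) : ℤ) := by
      push_cast at hm ⊢
      linarith
    exact_mod_cast this
  have h2 : ((∑ i, s i * t i : ℤ) : ZMod (q + 1)) = 0 :=
    (ZMod.intCast_zmod_eq_zero_iff_dvd _ _).2 ⟨_, h1⟩
  simpa using h2

/-- The overlattice of `A_q^k` generated by a glue vector. -/
noncomputable def overA (s : Fin k → ℤ) : Submodule ℤ (spaceA k (q + 1)) :=
  resPreimage (latticeA k (q + 1))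
    (Submodule.span ℤ {((latticeA k (q + 1)).submoduleOf (dualLattice (latticeA k (q + 1)))).mkQ
      ⟨glueA s, glueA_mem_dual s⟩})

theorem mem_overA {s : Fin k → ℤ} {x : spaceA k (q + 1)} :
    x ∈ overA s ↔ ∃ c : ℤ, x - c • glueA s ∈ latticeA k (q + 1) := by
  rw [overA, mem_resPreimage]
  constructor
  · rintro ⟨hx, h⟩
    obtain ⟨c, hc⟩ := Submodule.mem_span_singleton.1 h
    exact ⟨c, (mk_res_eq hx ((dualLattice _).smul_mem c (glueA_mem_dual s))).1 hc.symm⟩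
  · rintro ⟨c, hc⟩
    have hx : x ∈ dualLattice (latticeA k (q + 1)) := by
      have := (dualLattice _).add_mem (isEvenLattice_latticeA.le_dual hc)
        ((dualLattice (latticeA k (q + 1))).smul_mem c (glueA_mem_dual s))
      rwa [sub_add_cancel] at this
    refine ⟨hx, Submodule.mem_span_singleton.2 ⟨c, ?_⟩⟩
    exact ((mk_res_eq hx ((dualLattice _).smul_mem c (glueA_mem_dual s))).2 hc).symm

theorem latticeA_le_overA (s : Fin k → ℤ) : latticeA k (q + 1) ≤ overA s :=
  le_resPreimage isEvenLattice_latticeA _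

/-- If `∑ tᵢ² = (q + 1) m`, the glue vector of `t` has norm `q m`, which is even because `q` is. -/
theorem isEvenLattice_overA (hq : Even q) {s : Fin k → ℤ}
    (hs : ∑ i, (s i : ZMod (q + 1)) * s i = 0) :
    IsEvenLattice (overA s : Submodule ℤ (spaceA k (q + 1))) := by
  refine isEvenLattice_of_le isEvenLattice_latticeA (latticeA_le_overA s) fun x hx => ?_
  obtain ⟨c, hc⟩ := mem_overA.1 hx
  rw [← map_smul] at hc
  obtain ⟨n, hn⟩ := inner_self_of_sub_glueA_mem hc
  have h1 : ((∑ i, (c • s) i * (c • s) i : ℤ) : ZMod (q + 1)) = 0 := by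
    push_cast
    simp only [Pi.smul_apply, smul_eq_mul, Int.cast_mul]
    have : ∀ i, ((c : ZMod (q + 1)) * s i) * (c * s i) = c * c * (s i * s i) := fun i => by ring
    simp only [this, ← Finset.mul_sum, hs, mul_zero]
  obtain ⟨m, hm⟩ := (ZMod.intCast_zmod_eq_zero_iff_dvd _ _).1 h1
  obtain ⟨r, hr⟩ := hq
  refine ⟨n + r * m, ?_⟩
  have hq : (q + 1 : ℝ) ≠ 0 := by positivity
  have hr' : (q : ℝ) = r + r := by exact_mod_cast hr
  have h2 : q * ((∑ i, (c • s) i * (c • s) i : ℤ) : ℝ) / (q + 1) = q * m := by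
    rw [hm]
    push_cast
    field_simp
  rw [hn, h2, hr']
  push_cast
  ring

theorem relIndex_overA (hp : (q + 1).Prime) {s : Fin k → ℤ}
    (hs : glueA s ∉ latticeA k (q + 1)) :
    (latticeA k (q + 1)).toAddSubgroup.relIndex (overA s).toAddSubgroup = q + 1 := by
  rw [overA, relIndex_resPreimage]
  refine card_span_singleton_of_prime hp ?_ fun h => hs ((mk_res_eq_zero _).1 h)
  have h1 : glueA (((q + 1 : ℕ) : ℤ) • s) ∈ latticeA k (q + 1) :=
    (glueA_mem_iff _).2 fun i => ⟨s i, rfl⟩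
  rw [map_smul] at h1
  have h2 := (mk_res_eq_zero ((dualLattice _).smul_mem _ (glueA_mem_dual s))).2 h1
  rw [← natCast_zsmul]
  exact h2

/-- The vector whose glue vector defines the reference even overlattice of `A_q^k`. -/
def seedA (k : ℕ) (i : Fin k) : ℤ := if k = 2 then (i : ℕ) + 1 else 1

/-- Change of signs of coordinates. -/
def signFlip (ε : Fin k → Bool) (s : Fin k → ℤ) (i : Fin k) : ℤ := if ε i then -s i else s i

theorem signFlip_signFlip (ε : Fin k → Bool) (s : Fin k → ℤ) :
    signFlip ε (signFlip ε s) = s := by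
  ext i
  simp only [signFlip]
  split_ifs <;> simp

/-- The vectors are `(1, 2)` modulo `5` and `(1, 1, 1)` modulo `3`. -/
theorem sum_seedA_sq (hqk : (q = 4 ∧ k = 2) ∨ (q = 2 ∧ k = 3)) :
    ∑ i, (seedA k i : ZMod (q + 1)) * seedA k i = 0 := by
  rcases hqk with ⟨rfl, rfl⟩ | ⟨rfl, rfl⟩ <;> decide

/-- Modulo `5`, `t₀² + t₁² = 0` means `t₁ = ± 2 t₀`. Modulo `3`, a nonzero zero of a sum of three
squares has all entries `± 1`. Checked by enumeration. -/
theorem exists_signFlip_seedA (hqk : (q = 4 ∧ k = 2) ∨ (q = 2 ∧ k = 3)) (t : Fin k → ZMod (q + 1))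
    (ht : t ≠ 0) (h : ∑ i, t i * t i = 0) : ∃ (c : ZMod (q + 1)) (ε : Fin k → Bool),
    ∀ i, c * t i = (signFlip ε (seedA k) i : ZMod (q + 1)) := by
  revert t
  rcases hqk with ⟨rfl, rfl⟩ | ⟨rfl, rfl⟩ <;> decide

/-- A totally isotropic subspace for `∑ tᵢ²` has dimension at most one in these two cases, so an
isotropic vector orthogonal to `seedA k` is proportional to it. -/
theorem exists_eq_mul_seedA (hqk : (q = 4 ∧ k = 2) ∨ (q = 2 ∧ k = 3)) (t : Fin k → ZMod (q + 1))
    (h : ∑ i, t i * t i = 0) (h' : ∑ i, t i * seedA k i = 0) :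
    ∃ c : ZMod (q + 1), ∀ i, t i = c * seedA k i := by
  revert t
  rcases hqk with ⟨rfl, rfl⟩ | ⟨rfl, rfl⟩ <;> decide

theorem glueA_signFlip_seedA_notMem (hqk : (q = 4 ∧ k = 2) ∨ (q = 2 ∧ k = 3)) (ε : Fin k → Bool) :
    glueA (signFlip ε (seedA k)) ∉ latticeA k (q + 1) := by
  rw [glueA_mem_iff]
  intro h
  revert ε
  rcases hqk with ⟨rfl, rfl⟩ | ⟨rfl, rfl⟩ <;> decide

theorem sub_glueA_mem_congr {x : spaceA k (q + 1)} {s t : Fin k → ℤ}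
    (hx : x - glueA s ∈ latticeA k (q + 1)) (h : ∀ i, (s i : ZMod (q + 1)) = t i) :
    x - glueA t ∈ latticeA k (q + 1) := by
  have h1 : glueA (s - t) ∈ latticeA k (q + 1) := (glueA_mem_iff _).2 fun i => by
    rw [← ZMod.intCast_zmod_eq_zero_iff_dvd]
    simp [h]
  rw [map_sub] at h1
  have := (latticeA k (q + 1)).add_mem hx h1
  rwa [sub_add_sub_cancel] at this

/-- A vector of `M` outside `A_q^k` has an isotropic glue class; a multiple of it is a sign change
of `seedA k`, and the index leaves no room for more. -/
theorem IsEvenLattice.eq_overA_signFlip {M : Submodule ℤ (spaceA k (q + 1))} (hM : IsEvenLattice M)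
    (hqk : (q = 4 ∧ k = 2) ∨ (q = 2 ∧ k = 3)) (hAM : latticeA k (q + 1) ≤ M)
    (hidx : (latticeA k (q + 1)).toAddSubgroup.relIndex M.toAddSubgroup = q + 1) :
    ∃ ε : Fin k → Bool, M = overA (signFlip ε (seedA k)) := by
  have hprime : (q + 1).Prime := by rcases hqk with ⟨rfl, -⟩ | ⟨rfl, -⟩ <;> norm_num
  obtain ⟨x, hxM, hxA⟩ : ∃ x ∈ M, x ∉ latticeA k (q + 1) := by
    by_contra! hcon
    have h1 : (latticeA k (q + 1)).toAddSubgroup.relIndex M.toAddSubgroup = 1 :=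
      AddSubgroup.relIndex_eq_one.2 hcon
    exact hprime.one_lt.ne' (hidx.symm.trans h1)
  obtain ⟨t, ht⟩ := exists_sub_glueA_mem (le_dual_of_even hM hAM hxM)
  have ht0 : (fun i => (t i : ZMod (q + 1))) ≠ 0 := fun h => hxA <| by
    have := sub_glueA_mem_congr ht (t := 0) fun i => by simpa using congrFun h i
    simpa using this
  obtain ⟨c, ε, hc⟩ := exists_signFlip_seedA hqk _ ht0
    (dvd_of_inner_int ht ht (hM.exists_inner_eq hxM hxM))
  have hcx : (c.val : ℤ) • x - glueA (signFlip ε (seedA k)) ∈ latticeA k (q + 1) := by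
    refine sub_glueA_mem_congr (s := (c.val : ℤ) • t) ?_ fun i => ?_
    · rw [map_smul, ← smul_sub]
      exact (latticeA k (q + 1)).smul_mem _ ht
    · rw [← hc]
      simp
  have hg : glueA (signFlip ε (seedA k)) ∈ M := by
    have := M.sub_mem (M.smul_mem (c.val : ℤ) hxM) (hAM hcx)
    rwa [sub_sub_cancel] at this
  have hle : overA (signFlip ε (seedA k)) ≤ M := fun y hy => by
    obtain ⟨d, hd⟩ := mem_overA.1 hy
    have := M.add_mem (hAM hd) (M.smul_mem d hg)
    rwa [sub_add_cancel] at this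
  refine ⟨ε, le_antisymm ?_ hle⟩
  have h1 := AddSubgroup.relIndex_mul_relIndex (latticeA k (q + 1)).toAddSubgroup
    (overA (signFlip ε (seedA k))).toAddSubgroup M.toAddSubgroup (latticeA_le_overA _) hle
  rw [hidx, relIndex_overA hprime (glueA_signFlip_seedA_notMem hqk ε)] at h1
  exact AddSubgroup.relIndex_eq_one.1
    (Nat.eq_of_mul_eq_mul_left (Nat.succ_pos q) (h1.trans (mul_one _).symm))

/-- An even overlattice of `A_q^k` containing the reference glue vector. -/
theorem IsEvenLattice.eq_overA {M : Submodule ℤ (spaceA k (q + 1))} (hM : IsEvenLattice M)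
    (hqk : (q = 4 ∧ k = 2) ∨ (q = 2 ∧ k = 3)) (hAM : latticeA k (q + 1) ≤ M)
    (hg : glueA (seedA k) ∈ M) : M = overA (seedA k) := by
  refine le_antisymm (fun x hx => ?_) fun y hy => ?_
  · obtain ⟨t, ht⟩ := exists_sub_glueA_mem (le_dual_of_even hM hAM hx)
    obtain ⟨c, hc⟩ := exists_eq_mul_seedA hqk _
      (dvd_of_inner_int ht ht (hM.exists_inner_eq hx hx))
      (dvd_of_inner_int ht (by simp) (hM.exists_inner_eq hx hg))
    refine mem_overA.2 ⟨c.val, ?_⟩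
    rw [← map_smul]
    exact sub_glueA_mem_congr ht fun i => by rw [hc]; simp
  · obtain ⟨d, hd⟩ := mem_overA.1 hy
    have := M.add_mem (hAM hd) (M.smul_mem d hg)
    rwa [sub_add_cancel] at this

end Glue

/-! ### Isometries of `A_q^k` fixing the Weyl vector, and transitivity on flags -/

section Flags

variable {k q : ℕ}

/-- The permutation of the coordinates of a Weyl vector that changes its sign. -/
def weylRev (π : Fin k → Equiv.Perm (Fin (q + 1))) (i : Fin k) : Equiv.Perm (Fin (q + 1)) :=
  ((π i).trans Fin.revPerm).trans (π i).symm

theorem weylRev_weylRev (π : Fin k → Equiv.Perm (Fin (q + 1))) (i : Fin k) (a : Fin (q + 1)) :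
    weylRev π i (weylRev π i a) = a := by
  simp [weylRev]

theorem sum_weylRev (π : Fin k → Equiv.Perm (Fin (q + 1))) (i : Fin k) (f : Fin (q + 1) → ℝ) :
    ∑ a, f (weylRev π i a) = ∑ a, f a := Equiv.sum_comp _ f

/-- The linear map acting on the summands selected by `ε` as the opposite of `weylRev`. -/
noncomputable def signMap (π : Fin k → Equiv.Perm (Fin (q + 1))) (ε : Fin k → Bool) :
    spaceA k (q + 1) →ₗ[ℝ] spaceA k (q + 1) where
  toFun x := ⟨WithLp.toLp 2 fun y =>
      if ε y.1 then -(x : EuclideanSpace ℝ (Fin k × Fin (q + 1))) (y.1, weylRev π y.1 y.2)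
      else (x : EuclideanSpace ℝ (Fin k × Fin (q + 1))) y, fun i => by
    have h := sum_spaceA x i
    by_cases hi : ε i
    · have h' := sum_weylRev π i fun a => (x : EuclideanSpace ℝ (Fin k × Fin (q + 1))) (i, a)
      simp only [hi, if_true, Finset.sum_neg_distrib, h', h, neg_zero]
    · simp only [hi]
      exact h⟩
  map_add' x y := spaceA_ext fun i a => by
    simp only [Submodule.coe_add, PiLp.add_apply]
    split_ifs <;> ring
  map_smul' c x := spaceA_ext fun i a => by
    simp only [Submodule.coe_smul, PiLp.smul_apply, smul_eq_mul, RingHom.id_apply]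
    split_ifs <;> ring

theorem signMap_apply (π : Fin k → Equiv.Perm (Fin (q + 1))) (ε : Fin k → Bool)
    (x : spaceA k (q + 1)) (i : Fin k) (a : Fin (q + 1)) :
    (signMap π ε x : EuclideanSpace ℝ (Fin k × Fin (q + 1))) (i, a) =
      if ε i then -(x : EuclideanSpace ℝ (Fin k × Fin (q + 1))) (i, weylRev π i a)
      else (x : EuclideanSpace ℝ (Fin k × Fin (q + 1))) (i, a) := rfl

theorem signMap_involutive (π : Fin k → Equiv.Perm (Fin (q + 1))) (ε : Fin k → Bool) :
    Function.Involutive (signMap π ε) := fun x => spaceA_ext fun i a => by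
  rw [signMap_apply, signMap_apply, signMap_apply, weylRev_weylRev]
  split_ifs <;> simp

/-- The isometry of `A_q^k` acting on the summands selected by `ε` as the opposite of `weylRev`. -/
noncomputable def signIsometry (π : Fin k → Equiv.Perm (Fin (q + 1))) (ε : Fin k → Bool) :
    spaceA k (q + 1) ≃ₗᵢ[ℝ] spaceA k (q + 1) :=
  (LinearEquiv.ofInvolutive (signMap π ε) (signMap_involutive π ε)).isometryOfInner fun x y => by
    change ⟪signMap π ε x, signMap π ε y⟫_ℝ = _
    rw [inner_spaceA, inner_spaceA]
    refine Finset.sum_congr rfl fun i _ => ?_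
    simp only [signMap_apply]
    by_cases hi : ε i
    · simp only [hi, if_true, neg_mul_neg]
      exact sum_weylRev π i fun a => (x : EuclideanSpace ℝ (Fin k × Fin (q + 1))) (i, a) *
        (y : EuclideanSpace ℝ (Fin k × Fin (q + 1))) (i, a)
    · simp [hi]

theorem signIsometry_apply (π : Fin k → Equiv.Perm (Fin (q + 1))) (ε : Fin k → Bool)
    (x : spaceA k (q + 1)) (i : Fin k) (a : Fin (q + 1)) :
    (signIsometry π ε x : EuclideanSpace ℝ (Fin k × Fin (q + 1))) (i, a) =
      if ε i then -(x : EuclideanSpace ℝ (Fin k × Fin (q + 1))) (i, weylRev π i a)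
      else (x : EuclideanSpace ℝ (Fin k × Fin (q + 1))) (i, a) := rfl

theorem signIsometry_signIsometry (π : Fin k → Equiv.Perm (Fin (q + 1))) (ε : Fin k → Bool)
    (x : spaceA k (q + 1)) : signIsometry π ε (signIsometry π ε x) = x :=
  signMap_involutive π ε x

theorem signIsometry_mem_latticeA (π : Fin k → Equiv.Perm (Fin (q + 1))) (ε : Fin k → Bool)
    {x : spaceA k (q + 1)} (hx : x ∈ latticeA k (q + 1)) :
    signIsometry π ε x ∈ latticeA k (q + 1) := by
  rintro ⟨i, a⟩
  rw [signIsometry_apply]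
  obtain ⟨m, hm⟩ := hx (i, weylRev π i a)
  obtain ⟨n, hn⟩ := hx (i, a)
  split_ifs
  · exact ⟨-m, by rw [hm]; simp⟩
  · exact ⟨n, hn⟩

theorem signIsometry_glueA_sub (π : Fin k → Equiv.Perm (Fin (q + 1))) (ε : Fin k → Bool)
    (s : Fin k → ℤ) :
    signIsometry π ε (glueA s) - glueA (signFlip ε s) ∈ latticeA k (q + 1) := by
  rintro ⟨i, a⟩
  rw [Submodule.coe_sub, PiLp.sub_apply, signIsometry_apply]
  simp only [glueA_apply, signFlip]
  by_cases hi : ε i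
  · refine ⟨(if weylRev π i a = 0 then s i else 0) - if a = 0 then s i else 0, ?_⟩
    simp only [hi, if_true]
    push_cast
    split_ifs <;> ring
  · exact ⟨0, by simp [hi]⟩

/-- Reversing the order of the coordinates negates `ρ` in a summand, and the sign restores it. The
glue class of that summand, however, is negated, which is what makes these isometries useful. -/
theorem signIsometry_weyl {ρ : spaceA k (q + 1)} {π : Fin k → Equiv.Perm (Fin (q + 1))}
    (hπ : ∀ i a, (ρ : EuclideanSpace ℝ (Fin k × Fin (q + 1))) (i, a) = ((π i a : ℕ) : ℝ) - q / 2)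
    (ε : Fin k → Bool) : signIsometry π ε ρ = ρ := spaceA_ext fun i a => by
  rw [signIsometry_apply]
  split_ifs
  · rw [hπ, hπ]
    have h1 : π i (weylRev π i a) = Fin.rev (π i a) := by simp [weylRev]
    have h2 : ((Fin.rev (π i a) : ℕ) : ℝ) = q - (π i a : ℕ) := by
      rw [Fin.val_rev, Nat.add_sub_add_right, Nat.cast_sub (Nat.lt_succ_iff.1 (π i a).isLt)]
    rw [h1, h2]
    ring
  · rfl

theorem mapLattice_eq_of_involutive {E : Type*} [NormedAddCommGroup E] [InnerProductSpace ℝ E]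
    {φ : E ≃ₗᵢ[ℝ] E} (hφ : ∀ x, φ (φ x) = x) {L M : Submodule ℤ E} (h : ∀ x ∈ L, φ x ∈ M)
    (h' : ∀ x ∈ M, φ x ∈ L) : mapLattice φ L = M := by
  ext y
  rw [mem_mapLattice]
  constructor
  · rintro ⟨x, hx, rfl⟩
    exact h x hx
  · exact fun hy => ⟨φ y, h' y hy, hφ y⟩

theorem mapLattice_signIsometry_latticeA (π : Fin k → Equiv.Perm (Fin (q + 1))) (ε : Fin k → Bool) :
    mapLattice (signIsometry π ε) (latticeA k (q + 1)) = latticeA k (q + 1) :=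
  mapLattice_eq_of_involutive (signIsometry_signIsometry π ε)
    (fun _ => signIsometry_mem_latticeA π ε) fun _ => signIsometry_mem_latticeA π ε

theorem mapLattice_signIsometry_latticeQ {ρ : spaceA k (q + 1)}
    {π : Fin k → Equiv.Perm (Fin (q + 1))} (hπ : ∀ i a,
      (ρ : EuclideanSpace ℝ (Fin k × Fin (q + 1))) (i, a) = ((π i a : ℕ) : ℝ) - q / 2)
    (ε : Fin k → Bool) :
    mapLattice (signIsometry π ε) (latticeQ k (q + 1) ρ) = latticeQ k (q + 1) ρ := by
  have h : ∀ x ∈ latticeQ k (q + 1) ρ, signIsometry π ε x ∈ latticeQ k (q + 1) ρ := by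
    rintro x ⟨hx, n, hn⟩
    refine ⟨signIsometry_mem_latticeA π ε hx, n, ?_⟩
    rw [← hn]
    nth_rw 1 [← signIsometry_weyl hπ ε]
    exact LinearIsometryEquiv.inner_map_map _ _ _
  exact mapLattice_eq_of_involutive (signIsometry_signIsometry π ε) h h

theorem mapLattice_signIsometry_overA (π : Fin k → Equiv.Perm (Fin (q + 1))) (ε : Fin k → Bool)
    (s : Fin k → ℤ) :
    mapLattice (signIsometry π ε) (overA (signFlip ε s)) = overA s := by
  have h (s : Fin k → ℤ) : ∀ x ∈ overA s, signIsometry π ε x ∈ overA (signFlip ε s) := by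
    intro x hx
    obtain ⟨c, hc⟩ := mem_overA.1 hx
    refine mem_overA.2 ⟨c, ?_⟩
    have h1 := (latticeA k (q + 1)).add_mem (signIsometry_mem_latticeA π ε hc)
      ((latticeA k (q + 1)).smul_mem c (signIsometry_glueA_sub π ε s))
    rwa [map_sub, map_zsmul, smul_sub, sub_add_sub_cancel] at h1
  refine mapLattice_eq_of_involutive (signIsometry_signIsometry π ε) (fun x hx => ?_) (h s)
  have := h _ x hx
  rwa [signFlip_signFlip] at this

section Isometries

variable {E F G : Type*} [NormedAddCommGroup E] [InnerProductSpace ℝ E] [NormedAddCommGroup F]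
  [InnerProductSpace ℝ F] [NormedAddCommGroup G] [InnerProductSpace ℝ G]

theorem mapLattice_trans (φ : E ≃ₗᵢ[ℝ] F) (ψ : F ≃ₗᵢ[ℝ] G) (L : Submodule ℤ E) :
    mapLattice (φ.trans ψ) L = mapLattice ψ (mapLattice φ L) := by
  ext y
  simp [mem_mapLattice]

theorem mapLattice_symm_eq {φ : E ≃ₗᵢ[ℝ] F} {L : Submodule ℤ E} {M : Submodule ℤ F}
    (h : mapLattice φ L = M) : mapLattice φ.symm M = L := by
  subst h
  ext y
  simp [mem_mapLattice]

theorem mapLattice_mono (φ : E ≃ₗᵢ[ℝ] F) {L M : Submodule ℤ E} (h : L ≤ M) :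
    mapLattice φ L ≤ mapLattice φ M := Submodule.map_mono h

theorem LatticeIsometric.trans {L : Submodule ℤ E} {M : Submodule ℤ F} {N : Submodule ℤ G}
    (h : LatticeIsometric L M) (h' : LatticeIsometric M N) : LatticeIsometric L N := by
  obtain ⟨φ, hφ⟩ := h
  obtain ⟨ψ, hψ⟩ := h'
  exact ⟨φ.trans ψ, by rw [mapLattice_trans, hφ, hψ]⟩

theorem LatticeIsometric.symm {L : Submodule ℤ E} {M : Submodule ℤ F}
    (h : LatticeIsometric L M) : LatticeIsometric M L := by
  obtain ⟨φ, hφ⟩ := h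
  exact ⟨φ.symm, mapLattice_symm_eq hφ⟩

theorem IsEvenLattice.mapLattice {L : Submodule ℤ E} (hL : IsEvenLattice L) (φ : E ≃ₗᵢ[ℝ] F) :
    IsEvenLattice (mapLattice φ L) := by
  refine isEvenLattice_of_even ?_ ?_
  · have h1 : ((_root_.mapLattice φ L : Submodule ℤ F) : Set F) =
        φ.toLinearEquiv.toLinearMap '' (L : Set E) := rfl
    rw [h1, ← Submodule.map_span, hL.span_eq_top, Submodule.map_top]
    exact LinearEquiv.range φ.toLinearEquiv
  · rintro _ ⟨x, hx, rfl⟩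
    obtain ⟨n, hn⟩ := hL.even x hx
    exact ⟨n, by rw [← hn]; exact φ.inner_map_map x x⟩

theorem relIndex_mapLattice (φ : E ≃ₗᵢ[ℝ] F) (L M : Submodule ℤ E) :
    (mapLattice φ L).toAddSubgroup.relIndex (mapLattice φ M).toAddSubgroup =
      L.toAddSubgroup.relIndex M.toAddSubgroup :=
  AddSubgroup.relIndex_map_map_of_injective L.toAddSubgroup M.toAddSubgroup
    (f := (φ.toLinearEquiv.toLinearMap.restrictScalars ℤ).toAddMonoidHom) φ.injective

end Isometries

variable {ρ : spaceA k (q + 1)} {π : Fin k → Equiv.Perm (Fin (q + 1))}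

/-- Up to the orthogonal group of `Q_g`, there is only one totally isotropic flag. -/
theorem IsIsotropicFlag.exists_isometry (hqk : (q = 4 ∧ k = 2) ∨ (q = 2 ∧ k = 3)) (hπ : ∀ i a,
      (ρ : EuclideanSpace ℝ (Fin k × Fin (q + 1))) (i, a) = ((π i a : ℕ) : ℝ) - q / 2)
    {hQ : IsEvenLattice (latticeQ k (q + 1) ρ)} {D P : Submodule ℤ (Res (latticeQ k (q + 1) ρ))}
    (h : IsIsotropicFlag hQ (q + 1) D P) :
    ∃ γ : spaceA k (q + 1) ≃ₗᵢ[ℝ] spaceA k (q + 1),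
      mapLattice γ (latticeQ k (q + 1) ρ) = latticeQ k (q + 1) ρ ∧
      mapLattice γ (resPreimage (latticeQ k (q + 1) ρ) D) = latticeA k (q + 1) ∧
      mapLattice γ (resPreimage (latticeQ k (q + 1) ρ) P) = overA (seedA k) := by
  obtain ⟨hD, hP, hDP⟩ := h
  obtain ⟨φ, hφA, hφQ⟩ := exists_isometry_of_line hqk (isEvenRootless_latticeQ hqk hπ) hD.2
    (by rw [hD.card, pow_one]) hπ
  have hle := resPreimage_mono hDP
  have h1 := AddSubgroup.relIndex_mul_relIndex (latticeQ k (q + 1) ρ).toAddSubgroup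
    (resPreimage (latticeQ k (q + 1) ρ) D).toAddSubgroup
    (resPreimage (latticeQ k (q + 1) ρ) P).toAddSubgroup (le_resPreimage hQ D) hle
  rw [relIndex_resPreimage, relIndex_resPreimage, hD.card, hP.card, pow_one, sq] at h1
  have hidx := Nat.eq_of_mul_eq_mul_left (Nat.succ_pos q) h1
  -- With the line moved to `A_q^k`, the plane becomes an even overlattice of index `q + 1`; a sign
  -- isometry brings it to the reference one without moving `A_q^k` or `Q_g`.
  rw [← relIndex_mapLattice φ, hφA] at hidx
  obtain ⟨ε, hε⟩ := IsEvenLattice.eq_overA_signFlip ((isEvenLattice_resPreimage hQ hP.2).mapLattice φ) hqk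
    (hφA ▸ mapLattice_mono φ hle) hidx
  refine ⟨φ.trans (signIsometry π ε), ?_, ?_, ?_⟩
  · rw [mapLattice_trans, hφQ, mapLattice_signIsometry_latticeQ hπ]
  · rw [mapLattice_trans, hφA, mapLattice_signIsometry_latticeA]
  · rw [mapLattice_trans, hε, mapLattice_signIsometry_overA]

/-- The element is `ψ⁻¹ φ`. A single `γ` serves all pairs of subgroups, so that a line and a plane
can be moved simultaneously. -/
theorem exists_latticeO_of_isometry {E F : Type*} [NormedAddCommGroup E] [InnerProductSpace ℝ E]
    [NormedAddCommGroup F] [InnerProductSpace ℝ F] {L : Submodule ℤ E} (hL : IsEvenLattice L)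
    {φ ψ : E ≃ₗᵢ[ℝ] F} (h : mapLattice φ L = mapLattice ψ L) :
    ∃ γ : latticeO L, ∀ D D' : Submodule ℤ (Res L),
      mapLattice φ (resPreimage L D) = mapLattice ψ (resPreimage L D') →
        D.map (resMap γ) = D' := by
  have hγ (M N : Submodule ℤ E) (h : mapLattice φ M = mapLattice ψ N) :
      mapLattice (φ.trans ψ.symm) M = N := by
    rw [mapLattice_trans, h, mapLattice_symm_eq rfl]
  refine ⟨⟨φ.trans ψ.symm, hγ _ _ h⟩, fun D D' hD => resPreimage_injective ?_⟩
  rw [← mapLattice_resPreimage hL]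
  exact hγ _ _ hD

theorem exists_latticeO_of_flag (hqk : (q = 4 ∧ k = 2) ∨ (q = 2 ∧ k = 3)) (hπ : ∀ i a,
      (ρ : EuclideanSpace ℝ (Fin k × Fin (q + 1))) (i, a) = ((π i a : ℕ) : ℝ) - q / 2)
    {hQ : IsEvenLattice (latticeQ k (q + 1) ρ)}
    {D P D' P' : Submodule ℤ (Res (latticeQ k (q + 1) ρ))}
    (h : IsIsotropicFlag hQ (q + 1) D P) (h' : IsIsotropicFlag hQ (q + 1) D' P') :
    ∃ γ : latticeO (latticeQ k (q + 1) ρ), D.map (resMap γ) = D' ∧ P.map (resMap γ) = P' := by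
  obtain ⟨φ, h1, h2, h3⟩ := h.exists_isometry hqk hπ
  obtain ⟨ψ, h1', h2', h3'⟩ := h'.exists_isometry hqk hπ
  obtain ⟨γ, hγ⟩ := exists_latticeO_of_isometry hQ (h1.trans h1'.symm)
  exact ⟨γ, hγ _ _ (h2.trans h2'.symm), hγ _ _ (h3.trans h3'.symm)⟩

theorem exists_latticeO_of_line (hqk : (q = 4 ∧ k = 2) ∨ (q = 2 ∧ k = 3)) (hπ : ∀ i a,
      (ρ : EuclideanSpace ℝ (Fin k × Fin (q + 1))) (i, a) = ((π i a : ℕ) : ℝ) - q / 2)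
    {hQ : IsEvenLattice (latticeQ k (q + 1) ρ)} {D D' : Submodule ℤ (Res (latticeQ k (q + 1) ρ))}
    (h : IsTotIsotropic hQ (q + 1) 1 D) (h' : IsTotIsotropic hQ (q + 1) 1 D') :
    ∃ γ : latticeO (latticeQ k (q + 1) ρ), D.map (resMap γ) = D' := by
  obtain ⟨φ, h1, h2⟩ := exists_isometry_of_line hqk (isEvenRootless_latticeQ hqk hπ) h.2
    (by rw [h.card, pow_one]) hπ
  obtain ⟨ψ, h1', h2'⟩ := exists_isometry_of_line hqk (isEvenRootless_latticeQ hqk hπ) h'.2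
    (by rw [h'.card, pow_one]) hπ
  obtain ⟨γ, hγ⟩ := exists_latticeO_of_isometry hQ (h2.trans h2'.symm)
  exact ⟨γ, hγ _ _ (h1.trans h1'.symm)⟩

/-- A totally isotropic plane contains a line. -/
theorem IsTotIsotropic.exists_flag {E : Type*} [NormedAddCommGroup E] [InnerProductSpace ℝ E]
    {L : Submodule ℤ E} {hL : IsEvenLattice L} {p : ℕ} (hp : p.Prime) {P : Submodule ℤ (Res L)}
    (hP : IsTotIsotropic hL p 2 P) : ∃ D, IsIsotropicFlag hL p D P := by
  have : Fact p.Prime := ⟨hp⟩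
  obtain ⟨⟨e⟩, hP0⟩ := id hP
  -- Any nonzero vector would do, since it is killed by `p`.
  set y : P := e.symm fun _ => 1 with hy
  have hy0 : (y : Res L) ≠ 0 := by
    intro h
    have h1 : y = 0 := Subtype.ext h
    have h2 : (fun _ => 1 : Fin 2 → ZMod p) = 0 := by
      rw [← e.apply_symm_apply fun _ => 1, ← hy, h1, map_zero]
    exact one_ne_zero (congrFun h2 0)
  have hkill (x : Res L) (hx : x ∈ P) : p • x = 0 := by
    have h1 : p • (⟨x, hx⟩ : P) = 0 := by
      rw [← e.map_eq_zero_iff, map_nsmul]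
      ext i
      simp
    exact congrArg Subtype.val h1
  have hle : Submodule.span ℤ {(y : Res L)} ≤ P :=
    (Submodule.span_singleton_le_iff_mem _ _).2 y.2
  refine ⟨Submodule.span ℤ {(y : Res L)}, ⟨nonempty_addEquiv_of_card hp (fun x => ?_) ?_,
    fun x hx => hP0 x (hle hx)⟩, hP, hle⟩
  · ext
    exact hkill _ (hle x.2)
  · rw [card_span_singleton_of_prime hp (hkill _ y.2) hy0, pow_one]

/-- The chain of even lattices `Q_g ⊂ A_q^k ⊂ overA (seedA k)`, with both steps of index `q + 1`, is
such a flag. -/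
theorem exists_isotropicFlag (hqk : (q = 4 ∧ k = 2) ∨ (q = 2 ∧ k = 3)) (hπ : ∀ i a,
      (ρ : EuclideanSpace ℝ (Fin k × Fin (q + 1))) (i, a) = ((π i a : ℕ) : ℝ) - q / 2)
    (hQ : IsEvenLattice (latticeQ k (q + 1) ρ)) : ∃ D P, IsIsotropicFlag hQ (q + 1) D P := by
  have hprime : (q + 1).Prime := by rcases hqk with ⟨rfl, -⟩ | ⟨rfl, -⟩ <;> norm_num
  have heven : Even q := by rcases hqk with ⟨rfl, -⟩ | ⟨rfl, -⟩ <;> decide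
  have hM := isEvenLattice_overA heven (sum_seedA_sq hqk)
  have hQM : latticeQ k (q + 1) ρ ≤ overA (seedA k) := latticeQ_le.trans (latticeA_le_overA _)
  have hkill : ∀ x ∈ dualLattice (latticeQ k (q + 1) ρ),
      ((q + 1 : ℕ) : ℤ) • x ∈ latticeQ k (q + 1) ρ := fun x hx => zsmul_mem_latticeQ_of_dual hqk hπ hx
  have hidx := relIndex_latticeQ (by omega) (by omega) hπ
  have hidx' := AddSubgroup.relIndex_mul_relIndex (latticeQ k (q + 1) ρ).toAddSubgroup
    (latticeA k (q + 1)).toAddSubgroup (overA (seedA k)).toAddSubgroup latticeQ_le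
    (latticeA_le_overA _)
  rw [hidx, relIndex_overA (s := seedA k) hprime (glueA_signFlip_seedA_notMem hqk fun _ => false)] at hidx'
  refine ⟨resImage _ (latticeA k (q + 1)), resImage _ (overA (seedA k)),
    isTotIsotropic_resImage hQ hprime isEvenLattice_latticeA latticeQ_le hkill
      (hidx.trans (pow_one _).symm),
    isTotIsotropic_resImage hQ hprime hM hQM hkill (hidx'.symm.trans (sq _).symm),
    le_of_resPreimage_le ?_⟩
  rw [resPreimage_resImage latticeQ_le (le_dual_of_even isEvenLattice_latticeA latticeQ_le),
    resPreimage_resImage hQM (le_dual_of_even hM hQM)]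
  exact latticeA_le_overA _

end Flags

/-! ### `E_8` and `E_6` as overlattices of `A_4 ⊕ A_4` and `A_2 ⊕ A_2 ⊕ A_2` -/

section ExceptionalLattices

/-- Recognition criterion: an even lattice containing the root blocks of `A_q^k` and a vector with
the same products against them as the reference glue vector has an image containing both, and
`IsEvenLattice.eq_overA` leaves only one possibility. -/
theorem latticeIsometric_overA {F : Type*} [NormedAddCommGroup F] [InnerProductSpace ℝ F]
    [FiniteDimensional ℝ F] {k q : ℕ} (hqk : (q = 4 ∧ k = 2) ∨ (q = 2 ∧ k = 3))
    {N : Submodule ℤ F} (hN : ∀ x ∈ N, ∃ n : ℤ, ⟪x, x⟫_ℝ = 2 * n)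
    (hF : Module.finrank ℝ F ≤ k * q) {u : Fin k × Fin q → F} (hu : ∀ x, u x ∈ N)
    (hgram : ∀ x y, ⟪u x, u y⟫_ℝ = if x.1 = y.1 then (if x.2 = y.2 then 2 else 1) else 0)
    {y : F} (hy : y ∈ N) (hyu : ∀ x, ⟪y, u x⟫_ℝ = seedA k x.1) :
    LatticeIsometric N (overA (seedA k) : Submodule ℤ (spaceA k (q + 1))) := by
  set v : Fin k × Fin q → spaceA k (q + 1) := stdA fun _ => 1 with hv
  have hgram' (x y) : ⟪u x, u y⟫_ℝ = ⟪v x, v y⟫_ℝ := by rw [hgram, hv, inner_stdA]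
  have hli : LinearIndependent ℝ u := by
    rw [← Matrix.det_gram_ne_zero_iff_linearIndependent,
      show Matrix.gram ℝ u = Matrix.gram ℝ v by ext x y; exact hgram' x y,
      Matrix.det_gram_ne_zero_iff_linearIndependent]
    exact linearIndependent_stdA _
  have hspan : Submodule.span ℝ (Set.range u) = ⊤ :=
    hli.span_eq_top_of_card_eq_finrank' (le_antisymm hli.fintype_card_le_finrank (by simpa using hF))
  obtain ⟨φ, hφ⟩ := exists_isometry_of_gram_eq hli hspan (linearIndependent_stdA fun _ => 1)
    (span_real_stdA fun _ => 1) hgram'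
  have hNe : IsEvenLattice N := by
    refine isEvenLattice_of_even (top_le_iff.1 (hspan ▸ Submodule.span_mono ?_)) hN
    rintro _ ⟨x, rfl⟩
    exact hu x
  have hA : latticeA k (q + 1) ≤ mapLattice φ N := by
    rw [← span_int_stdA fun _ => 1, ← mapLattice_span φ hφ]
    refine mapLattice_mono φ (Submodule.span_le.2 ?_)
    rintro _ ⟨x, rfl⟩
    exact hu x
  have hφy : φ y = glueA (seedA k) := by
    have h1 (x : spaceA k (q + 1)) : ⟪φ y - glueA (seedA k), x⟫_ℝ = 0 := by
      have hx : x ∈ Submodule.span ℝ (Set.range v) := by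
        rw [hv, span_real_stdA]
        trivial
      induction hx using Submodule.span_induction with
      | mem x hx =>
        obtain ⟨⟨i, a⟩, rfl⟩ := hx
        have h2 : ⟪(glueA (seedA k) : spaceA k (q + 1)), v (i, a)⟫_ℝ = seedA k i :=
          inner_glueA_rootA _ i (Fin.succ_ne_zero a)
        rw [inner_sub_left, h2, show v (i, a) = φ (u (i, a)) from (hφ _).symm, φ.inner_map_map, hyu,
          sub_self]
      | zero => exact inner_zero_right _
      | add x y _ _ hx hy => rw [inner_add_right, hx, hy, add_zero]
      | smul c x _ hx => rw [inner_smul_right, hx, mul_zero]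
    exact sub_eq_zero.1 (inner_self_eq_zero.1 (h1 _))
  exact ⟨φ, (hNe.mapLattice φ).eq_overA hqk hA (hφy ▸ ⟨y, hy, rfl⟩)⟩

/-- The vector of `ℝ^8` with coordinates `wᵢ / 2`. -/
noncomputable def halfVec (w : Fin 8 → ℤ) : EuclideanSpace ℝ (Fin 8) :=
  WithLp.toLp 2 fun i => (w i : ℝ) / 2

theorem inner_halfVec (v w : Fin 8 → ℤ) :
    ⟪halfVec v, halfVec w⟫_ℝ = ((∑ i, v i * w i : ℤ) : ℝ) / 4 := by
  rw [PiLp.inner_apply]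
  push_cast
  rw [Finset.sum_div]
  refine Finset.sum_congr rfl fun i _ => ?_
  simp [halfVec]
  ring

theorem halfVec_mem {w : Fin 8 → ℤ} (h : (∀ i, 2 ∣ w i) ∨ ∀ i, 2 ∣ w i - 1)
    (h' : 4 ∣ ∑ i, w i) : halfVec w ∈ latticeE8 := by
  refine ⟨?_, ?_⟩
  · refine h.imp (fun h i => ?_) fun h i => ?_ <;> obtain ⟨n, hn⟩ := h i
    · exact ⟨n, by simp [halfVec, hn]⟩
    · refine ⟨n, ?_⟩
      have h1 : (w i : ℝ) = 2 * n + 1 := by exact_mod_cast (by omega : w i = 2 * n + 1)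
      simp only [halfVec, h1]
      ring
  · obtain ⟨n, hn⟩ := h'
    refine ⟨n, ?_⟩
    have h1 : ((∑ i, w i : ℤ) : ℝ) = 4 * n := by exact_mod_cast hn
    push_cast at h1
    simp only [halfVec, ← Finset.sum_div, h1]
    ring

theorem even_inner_latticeE8 {x : EuclideanSpace ℝ (Fin 8)} (hx : x ∈ latticeE8) :
    ∃ n : ℤ, ⟪x, x⟫_ℝ = 2 * n := by
  obtain ⟨h, m, hm⟩ := hx
  have hsq : ⟪x, x⟫_ℝ = ∑ i, x i * x i := by
    rw [PiLp.inner_apply]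
    rfl
  rcases h with h | h
  · choose n hn using h
    simp only [hn] at hm hsq
    have h1 : Even (∑ i, (n i - 1) * (n i - 1 + 1)) :=
      Finset.even_sum _ fun i _ => Int.even_mul_succ_self _
    obtain ⟨r, hr⟩ := h1
    have hr' : (∑ i, (n i * n i : ℝ)) - ∑ i, (n i : ℝ) = r + r := by
      rw [← Finset.sum_sub_distrib]
      have : (∑ i, ((n i : ℝ) - 1) * (n i - 1 + 1)) = r + r := by exact_mod_cast hr
      rw [← this]
      exact Finset.sum_congr rfl fun i _ => by ring
    refine ⟨r + m, ?_⟩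
    rw [hsq]
    push_cast
    linarith
  · choose n hn using h
    simp only [hn] at hsq
    have h1 : Even (∑ i, n i * (n i + 1)) := Finset.even_sum _ fun i _ => Int.even_mul_succ_self _
    obtain ⟨r, hr⟩ := h1
    have hr' : (∑ i, (n i : ℝ) * (n i + 1)) = r + r := by exact_mod_cast hr
    refine ⟨r + 1, ?_⟩
    have h2 (i : Fin 8) : ((n i : ℝ) + 1 / 2) * (n i + 1 / 2) = n i * (n i + 1) + 1 / 4 := by ring
    rw [hsq]
    simp only [h2, Finset.sum_add_distrib, hr']
    simp
    ring

/-- Twice a basis of a sublattice `A_4 ⊕ A_4` of `E_8`. -/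
def blocksE8 : Fin 2 × Fin 4 → Fin 8 → ℤ := fun x =>
  ![![![2, 2, 0, 0, 0, 0, 0, 0], ![2, 0, 2, 0, 0, 0, 0, 0], ![2, 0, 0, 2, 0, 0, 0, 0],
      ![2, 0, 0, 0, 2, 0, 0, 0]],
    ![![0, 0, 0, 0, 0, 2, 2, 0], ![0, 0, 0, 0, 0, 2, 0, 2], ![0, 0, 0, 0, 0, 0, 2, 2],
      ![1, -1, -1, -1, -1, 1, 1, 1]]] x.1 x.2

theorem latticeIsometric_latticeE8_overA :
    LatticeIsometric latticeE8 (overA (seedA 2) : Submodule ℤ (spaceA 2 (4 + 1))) := by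
  refine latticeIsometric_overA (Or.inl ⟨rfl, rfl⟩) (fun _ => even_inner_latticeE8) (by simp)
    (u := fun x => halfVec (blocksE8 x)) (fun x => ?_) (fun x y => ?_)
    -- The vector `e₁ + e₆ + e₇ + e₈` has product `1` with the first block and `2` with the second,
    -- matching `(1, 2)`.
    (y := halfVec ![2, 0, 0, 0, 0, 2, 2, 2]) (halfVec_mem (by decide) (by decide)) fun x => ?_
  · exact halfVec_mem (by revert x; decide) (by revert x; decide)
  · have h : ∀ x y, ∑ i, blocksE8 x i * blocksE8 y i =
        4 * if x.1 = y.1 then (if x.2 = y.2 then 2 else 1) else 0 := by decide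
    rw [inner_halfVec, h]
    split_ifs <;> norm_num
  · have h : ∀ x, ∑ i, (![2, 0, 0, 0, 0, 2, 2, 2] : Fin 8 → ℤ) i * blocksE8 x i =
        4 * seedA 2 x.1 := by decide
    rw [inner_halfVec, h]
    push_cast
    ring

/-- Twice a basis of a sublattice `A_2 ⊕ A_2 ⊕ A_2` of `E_6`. -/
def blocksE6 : Fin 3 × Fin 2 → Fin 8 → ℤ := fun x =>
  ![![![2, 2, 0, 0, 0, 0, 0, 0], ![2, 0, 2, 0, 0, 0, 0, 0]],
    ![![0, 0, 0, 2, 2, 0, 0, 0], ![1, -1, -1, 1, 1, -1, -1, 1]],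
    ![![0, 0, 0, 2, -2, 0, 0, 0], ![1, -1, -1, 1, -1, 1, 1, -1]]] x.1 x.2

theorem halfVec_mem_spaceE6 {w : Fin 8 → ℤ} (h : w 5 = w 6 ∧ w 6 = -w 7) :
    halfVec w ∈ spaceE6 := by
  refine ⟨by simp [halfVec, h.1], ?_⟩
  simp only [halfVec, h.2]
  push_cast
  ring

theorem finrank_spaceE6_le : Module.finrank ℝ spaceE6 ≤ 6 := by
  let f : spaceE6 →ₗ[ℝ] (Fin 6 → ℝ) :=
    { toFun := fun x i => (x : EuclideanSpace ℝ (Fin 8)) (Fin.castLE (by omega) i)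
      map_add' := fun x y => rfl
      map_smul' := fun c x => rfl }
  have hf : Function.Injective f := by
    intro x y hxy
    have h (i : Fin 6) : (x : EuclideanSpace ℝ (Fin 8)) (Fin.castLE (by omega) i) =
      (y : EuclideanSpace ℝ (Fin 8)) (Fin.castLE (by omega) i) := congrFun hxy i
    have h5 : (x : EuclideanSpace ℝ (Fin 8)) 5 = (y : EuclideanSpace ℝ (Fin 8)) 5 := h 5
    have h6 : (x : EuclideanSpace ℝ (Fin 8)) 6 = (y : EuclideanSpace ℝ (Fin 8)) 6 := by
      rw [← x.2.1, ← y.2.1, h5]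
    have h7 : (x : EuclideanSpace ℝ (Fin 8)) 7 = (y : EuclideanSpace ℝ (Fin 8)) 7 := by
      have h1 := x.2.2
      have h2 := y.2.2
      linarith
    ext i
    fin_cases i
    exacts [h 0, h 1, h 2, h 3, h 4, h5, h6, h7]
  simpa using LinearMap.finrank_le_finrank_of_injective hf

theorem latticeIsometric_latticeE6_overA :
    LatticeIsometric latticeE6 (overA (seedA 3) : Submodule ℤ (spaceA 3 (2 + 1))) := by
  have hb : ∀ x, blocksE6 x 5 = blocksE6 x 6 ∧ blocksE6 x 6 = -blocksE6 x 7 := by decide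
  refine latticeIsometric_overA (Or.inr ⟨rfl, rfl⟩) (fun _ hx => even_inner_latticeE8 hx)
    finrank_spaceE6_le
    (u := fun x => ⟨halfVec (blocksE6 x), halfVec_mem_spaceE6 (hb x)⟩)
    (fun x => ?_) (fun x y => ?_)
    -- The root `e₁ + e₄` has product `1` with all six block vectors, matching `(1, 1, 1)`.
    (y := ⟨halfVec ![2, 0, 0, 2, 0, 0, 0, 0], halfVec_mem_spaceE6 (by decide)⟩)
    (halfVec_mem (by decide) (by decide)) fun x => ?_
  · exact halfVec_mem (by revert x; decide) (by revert x; decide)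
  · have h : ∀ x y, ∑ i, blocksE6 x i * blocksE6 y i =
        4 * if x.1 = y.1 then (if x.2 = y.2 then 2 else 1) else 0 := by decide
    rw [Submodule.coe_inner, inner_halfVec, h]
    split_ifs <;> norm_num
  · have h : ∀ x, ∑ i, (![2, 0, 0, 2, 0, 0, 0, 0] : Fin 8 → ℤ) i * blocksE6 x i =
        4 * seedA 3 x.1 := by decide
    rw [Submodule.coe_inner, inner_halfVec, h]
    push_cast
    ring

end ExceptionalLattices

/-! ### Assembly of the theorem -/

/-- The classification and transitivity statements, apart from the identification of the inverse
images of the totally isotropic planes. -/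
theorem latticeQ_classification {k q : ℕ} (hqk : (q = 4 ∧ k = 2) ∨ (q = 2 ∧ k = 3))
    {ρ : spaceA k (q + 1)} (hρ : IsWeylVector (latticeA k (q + 1)) ρ) :
    IsEvenRootless (k * q) (q + 1) (k + 2) (latticeQ k (q + 1) ρ) ∧
    (∀ (E : Type*) [NormedAddCommGroup E] [InnerProductSpace ℝ E] [FiniteDimensional ℝ E]
      (L : Submodule ℤ E), IsEvenRootless (k * q) (q + 1) (k + 2) L →
        LatticeIsometric L (latticeQ k (q + 1) ρ)) ∧
    ∃ hQ : IsEvenLattice (latticeQ k (q + 1) ρ),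
      (∃ D P, IsIsotropicFlag hQ (q + 1) D P) ∧
      (∀ P P', IsTotIsotropic hQ (q + 1) 2 P → IsTotIsotropic hQ (q + 1) 2 P' →
        ∃ γ : latticeO (latticeQ k (q + 1) ρ), P.map (resMap γ) = P') ∧
      (∀ D D', IsTotIsotropic hQ (q + 1) 1 D → IsTotIsotropic hQ (q + 1) 1 D' →
        ∃ γ : latticeO (latticeQ k (q + 1) ρ), D.map (resMap γ) = D') ∧
      (∀ D P D' P', IsIsotropicFlag hQ (q + 1) D P → IsIsotropicFlag hQ (q + 1) D' P' →
        ∃ γ : latticeO (latticeQ k (q + 1) ρ), D.map (resMap γ) = D' ∧ P.map (resMap γ) = P') ∧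
      (∀ P, IsTotIsotropic hQ (q + 1) 2 P →
        LatticeIsometric (resPreimage (latticeQ k (q + 1) ρ) P)
          (overA (seedA k) : Submodule ℤ (spaceA k (q + 1)))) ∧
      (∀ D, IsTotIsotropic hQ (q + 1) 1 D →
        LatticeIsometric (resPreimage (latticeQ k (q + 1) ρ) D) (latticeA k (q + 1))) := by
  obtain ⟨π, hπ⟩ := hρ.exists_perm
  have hprime : (q + 1).Prime := by rcases hqk with ⟨rfl, -⟩ | ⟨rfl, -⟩ <;> norm_num
  have hQ := isEvenLattice_latticeQ hπ
  refine ⟨isEvenRootless_latticeQ hqk hπ,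
    fun E _ _ _ L hL => latticeIsometric_latticeQ hqk hL hπ, hQ,
    exists_isotropicFlag hqk hπ hQ, fun P P' hP hP' => ?_,
    fun D D' hD hD' => exists_latticeO_of_line hqk hπ hD hD',
    fun D P D' P' h h' => exists_latticeO_of_flag hqk hπ h h', fun P hP => ?_, fun D hD => ?_⟩
  · obtain ⟨D, h⟩ := hP.exists_flag hprime
    obtain ⟨D', h'⟩ := hP'.exists_flag hprime
    obtain ⟨γ, -, hγ⟩ := exists_latticeO_of_flag hqk hπ h h'
    exact ⟨γ, hγ⟩
  · obtain ⟨D, h⟩ := hP.exists_flag hprime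
    obtain ⟨φ, -, -, hφ⟩ := h.exists_isometry hqk hπ
    exact ⟨φ, hφ⟩
  · obtain ⟨φ, hφ, -⟩ := exists_isometry_of_line hqk (isEvenRootless_latticeQ hqk hπ) hD.2
      (by rw [hD.card, pow_one]) hπ
    exact ⟨φ, hφ⟩

theorem mainTheorem9 (g p m k : ℕ)
    (hc : (g = 8 ∧ p = 5 ∧ m = 4 ∧ k = 2) ∨ (g = 6 ∧ p = 3 ∧ m = 5 ∧ k = 3))
    (ρ : spaceA k p) (hρ : IsWeylVector (latticeA k p) ρ) :
    IsEvenRootless g p m (latticeQ k p ρ) ∧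
    (∀ (E : Type*) [NormedAddCommGroup E] [InnerProductSpace ℝ E] [FiniteDimensional ℝ E]
      (L : Submodule ℤ E), IsEvenRootless g p m L → LatticeIsometric L (latticeQ k p ρ)) ∧
    ∃ hQ : IsEvenLattice (latticeQ k p ρ),
      (∃ D P, IsIsotropicFlag hQ p D P) ∧
      (∀ P P', IsTotIsotropic hQ p 2 P → IsTotIsotropic hQ p 2 P' →
        ∃ γ : latticeO (latticeQ k p ρ), P.map (resMap γ) = P') ∧
      (∀ D D', IsTotIsotropic hQ p 1 D → IsTotIsotropic hQ p 1 D' →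
        ∃ γ : latticeO (latticeQ k p ρ), D.map (resMap γ) = D') ∧
      (∀ D P D' P', IsIsotropicFlag hQ p D P → IsIsotropicFlag hQ p D' P' →
        ∃ γ : latticeO (latticeQ k p ρ), D.map (resMap γ) = D' ∧ P.map (resMap γ) = P') ∧
      (∀ P, IsTotIsotropic hQ p 2 P →
        (g = 8 → LatticeIsometric (resPreimage (latticeQ k p ρ) P) latticeE8) ∧
        (g = 6 → LatticeIsometric (resPreimage (latticeQ k p ρ) P) latticeE6)) ∧
      (∀ D, IsTotIsotropic hQ p 1 D →
        LatticeIsometric (resPreimage (latticeQ k p ρ) D) (latticeA k p)) := by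
  rcases hc with ⟨rfl, rfl, rfl, rfl⟩ | ⟨rfl, rfl, rfl, rfl⟩
  · obtain ⟨h1, h2, hQ, h3, h4, h5, h6, h7, h8⟩ :=
      latticeQ_classification (q := 4) (Or.inl ⟨rfl, rfl⟩) hρ
    exact ⟨h1, h2, hQ, h3, h4, h5, h6, fun P hP =>
      ⟨fun _ => (h7 P hP).trans latticeIsometric_latticeE8_overA.symm, fun h => by omega⟩, h8⟩
  · obtain ⟨h1, h2, hQ, h3, h4, h5, h6, h7, h8⟩ :=
      latticeQ_classification (q := 2) (Or.inr ⟨rfl, rfl⟩) hρ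
    exact ⟨h1, h2, hQ, h3, h4, h5, h6, fun P hP =>
      ⟨fun h => by omega, fun _ => (h7 P hP).trans latticeIsometric_latticeE6_overA.symm⟩, h8⟩
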